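/- **Theorem (edge-of-chaos initialization is crucial for sensitivity-based pruning), in the mean-field model.** *Activation and phase.* Let $\phi:\mathbb R\to\mathbb R$ satisfy $|\phi(u)-\phi(v)|\le K(1+|u|+|v|)^p|u-v|$ for some $K\in\mathbb R$, $p\in\mathbb N$ (e.g. $\phi$ Lipschitz), let $\sigma_b\ge 0$, $\sigma_w>0$, and let $q>0$ be a stationary variance, $q=\sigma_b^2+\sigma_w^2\mathbb E[\phi(\sqrt q Z)^2]$, $Z\sim\mathcal N(0,1)$. Let $$f(c)=\frac{\sigma_b^2+\sigma_w^2\,\mathbb E\big[\phi(\sqrt q Z_1)\,\phi\big(\sqrt q(cZ_1+\sqrt{1-c^2}Z_2)\big)\big]}{q},\qquad c\in[-1,1],$$ with $Z_1,Z_2$ independent standard Gaussians, and put $\chi=f'(1)$ and $\kappa=|\log\chi|/8$. The phase is ordered if $\chi<1$; the parameters are on the Edge of Chaos if $\chi=1$. *Network.* A 1D convolutional network (CNN) of depth $L\ge1$ has $n_l\ge1$ channels in layer $l=0,\dots,L$, $P\ge 1$ positions per channel (periodic), filter range $[-k,k]$, weights $W^l_{i,j,\beta}\sim\mathcal N(0,\sigma_w^2/v_l)$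 with $v_l=n_{l-1}(2k+1)$, and $M_l=n_{l-1}n_l(2k+1)$ weights in layer $l$. A fully connected network (FFNN) is the case $P=1$, $k=0$. Given are a finite batch $\mathcal D$ of inputs $x$, with entries $x_{j,\alpha}$ for $j\le n_0$, and for each of them a differentiable loss $\ell_x$ of the output. The initialization is studied under three approximations: the weights are independent and the pre-activations $y^l_i$ ($1\le l\le L$, $i\le n_l$) are i.i.d. $\mathcal N(0,q)$, independent of the weights (infinite width); they are the same for all inputs $x$ and all positions $\alpha$ (degeneracy); and back-propagation uses an i.i.d. copy $\widetilde W$ of the weights (gradient independence), so that with $\delta^L_{i,\alpha}(x)=\partial\ell_x/\partial y^L_{i,\alpha}$ evaluated at the output with channels $y^L_i$, $$\delta^l_{i,\alpha}(x)=\phi'(y^l_i)\sum_{j,\beta}\delta^{l+1}_{j,\alpha-\beta}(x)\,\widetilde W^{l+1}_{j,i,\beta}\quad(l<L),\qquad \frac{\partial\mathcal L}{\partial W^l_{i,j,\beta}}=\frac1{|\mathcal D|}\sum_{x\in\mathcal D}\sum_\alpha\delta^l_{i,\alpha}(x)\,a^{l-1}_{j,\alpha+\beta}(x),$$ where $a^0_{j,\alpha}(x)=x_{j,\alpha}$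 and $a^l_{j,\alpha}(x)=\phi(y^l_j)$ for $l\ge1$. All $\delta^L_{i,\alpha}(x)$ are assumed to have finite second moments. *Pruning.* At sparsity $s\in(0,1)$ a weight of the network is pruned if its score $|W\,\partial\mathcal L/\partial W|$ is smaller than the $k_s$-th largest score of all weights, $k_s=\lfloor(1-s)\sum_l M_l\rfloor$ (all weights are pruned if $k_s=0$). The critical sparsity $s_{cr}$ is the infimum of the $s\in(0,1)$ for which some layer is entirely pruned. Let $m_l$ be the second moment of the score of the first weight $(i,j,\beta)=(1,1,-k)$ of layer $l$. A family of networks, one for each depth $L\ge1$, is *well-conditioned* if there are $A,B>0$ such that $A\le m_l/m_L\le B$ for all $L\ge1$ and $1\le l\le L$, and *ill-conditioned* otherwise. 1. *Conditioning.* Fix $P$, $k$, the batch and the losses, and take for every depth $L\ge 1$ a network with widths $n_0,\dots,n_L$ that may depend on $L$ but are bounded uniformly in $L$ and $l$. Assume that neither $\sum_{x,\alpha}\delta^L_{1,\alpha}(x)$ nor $\sum_{x,\alpha}\delta^L_{1,\alpha}(x)\,x_{1,\alpha-k}$ vanishes almost surely. If $\chi<1$, the family is ill-conditioned. If $\chi=1$,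 then $\kappa=0$ and the family is well-conditioned. 2. *Critical sparsity.* Let $\chi<1$, and assume that $\phi(\sqrt qZ)$ and $\phi'(\sqrt qZ)$ are almost surely nonzero with $\log|\phi(\sqrt q Z)|$ and $\log|\phi'(\sqrt q Z)|$ integrable. For all $k$ and all real $a>0$ and $b$ there is a constant $C$, depending only on $\phi,\sigma_b,\sigma_w,q,k,a,b$, such that for all $N,L,P\ge1$, all widths with $n_l\le bN$ for $0\le l\le L$ and $n_l\ge aN$ for $1\le l<L$, and all batches and losses for which almost surely the vector $\big(\sum_{x,\alpha}\delta^L_{i,\alpha}(x)\big)_{i\le n_L}$ is nonzero, $s_{cr}$ is integrable and $$\mathbb E[s_{cr}]\le\frac1L\Big(1+\frac{\log(\kappa LN^2)}{\kappa}\Big)+\frac{C}{\kappa^2\sqrt{LN^2}}.$$ -/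

import Mathlib

open MeasureTheory ProbabilityTheory
open scoped NNReal

noncomputable section

namespace SBP

/-! ### Mean-field quantities attached to an activation function -/

/-- The standard Gaussian law on the line. -/
def stdNormal : Measure ℝ := gaussianReal 0 1

/-- Regularity of the activation: locally Lipschitz with polynomially growing constant.  Every
Lipschitz function qualifies (with `p = 0`); such a function is differentiable almost everywhere
and `deriv φ` is its derivative there. -/
def PseudoLipschitz (φ : ℝ → ℝ) : Prop :=
  ∃ (K : ℝ) (p : ℕ), ∀ u v : ℝ, |φ u - φ v| ≤ K * (1 + |u| + |v|) ^ p * |u - v|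

/-- One step of the variance recursion
`q ↦ σ_b² + σ_w² E[φ(√q Z)²]`. -/
def varianceMap (φ : ℝ → ℝ) (σb σw q : ℝ) : ℝ :=
  σb ^ 2 + σw ^ 2 * ∫ z, φ (√q * z) ^ 2 ∂stdNormal

/-- The correlation function
`f(c) = (σ_b² + σ_w² E[φ(√q Z₁) φ(√q (c Z₁ + √(1 - c²) Z₂))]) / q`. -/
def corrFun (φ : ℝ → ℝ) (σb σw q c : ℝ) : ℝ :=
  (σb ^ 2 + σw ^ 2 * ∫ z : ℝ × ℝ,
    φ (√q * z.1) * φ (√q * (c * z.1 + √(1 - c ^ 2) * z.2))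
      ∂(stdNormal.prod stdNormal)) / q

/-- `χ = f'(1)`, the derivative at `1` of the correlation function on `[-1, 1]`. -/
def chi (φ : ℝ → ℝ) (σb σw q : ℝ) : ℝ :=
  derivWithin (corrFun φ σb σw q) (Set.Icc (-1) 1) 1

/-- `κ = |log χ| / 8`. -/
def kappa (φ : ℝ → ℝ) (σb σw q : ℝ) : ℝ :=
  |Real.log (chi φ σb σw q)| / 8

/-- The activation and its derivative do not vanish on a non-null set and are not too small:
`log |φ(√q Z)|` and `log |φ'(√q Z)|` are almost surely finite and integrable. -/
def LogIntegrable (φ : ℝ → ℝ) (q : ℝ) : Prop :=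
  (∀ᵐ z ∂stdNormal, φ (√q * z) ≠ 0 ∧ deriv φ (√q * z) ≠ 0) ∧
    Integrable (fun z => Real.log |φ (√q * z)|) stdNormal ∧
    Integrable (fun z => Real.log |deriv φ (√q * z)|) stdNormal

/-! ### Pruning by a score -/

open Classical in
/-- The `k`-th largest value of `g` on `S`, counted with multiplicity.  It is `⊤` for `k = 0`:
when no weight is to be kept, all of them are below the threshold. -/
def kthLargest {ι : Type*} (S : Finset ι) (g : ι → ℝ) (k : ℕ) : EReal :=
  sSup {t : EReal | k ≤ (S.filter fun i => t ≤ (g i : EReal)).card}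

open Classical in
/-- The weights of layer `l` that are pruned at sparsity `s` in a network with layers
`1, …, L`: those whose score is below the `k`-th largest score of all layers together, where
`k = ⌊(1 - s) ∑ M_l⌋`. -/
def prunedSet {ι : Type*} (L : ℕ) (layer : ℕ → Finset ι) (g : ℕ → ι → ℝ) (s : ℝ) (l : ℕ) :
    Finset ι :=
  (layer l).filter fun i =>
    (g l i : EReal) <
      kthLargest ((Finset.Icc 1 L).sigma layer) (fun w => g w.1 w.2)
        ⌊(1 - s) * ((∑ l' ∈ Finset.Icc 1 L, (layer l').card : ℕ) : ℝ)⌋₊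

/-- The critical sparsity: the least sparsity in `(0, 1)` at which some layer is pruned
entirely. -/
def criticalSparsity {ι : Type*} (L : ℕ) (layer : ℕ → Finset ι) (g : ℕ → ι → ℝ) : ℝ :=
  sInf {s : ℝ | s ∈ Set.Ioo 0 1 ∧
    ∃ l ∈ Finset.Icc 1 L, (prunedSet L layer g s l).card = (layer l).card}

/-- `m L l` is the second moment of the score in layer `l` of the network of depth `L`. -/
def WellConditioned (m : ℕ → ℕ → ℝ) : Prop :=
  ∃ A B : ℝ, 0 < A ∧ 0 < B ∧
    ∀ L : ℕ, 1 ≤ L → ∀ l ∈ Finset.Icc 1 L, A ≤ m L l / m L L ∧ m L l / m L L ≤ B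

def IllConditioned (m : ℕ → ℕ → ℝ) : Prop := ¬ WellConditioned m

/-! ### Data, loss and network -/

/-- A batch of inputs with `inp` channels of `P` positions each (periodic), and for each of them
a loss as a function of the output, which has `out` channels of `P` positions each. -/
structure Batch (P : ℕ) where
  size : ℕ
  inp : ℕ
  out : ℕ
  input : Fin size → Fin inp → ZMod P → ℝ
  loss : Fin size → (Fin out → ZMod P → ℝ) → ℝ

namespace Batch

variable {P : ℕ} [NeZero P]

/-- The partial derivative of the loss of sample `s` in the output coordinate `(i, α)`, at an
output that takes the value `y i'` at every position of channel `i'`. -/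
def outGrad (T : Batch P) (y : Fin T.out → ℝ) (s : Fin T.size) (i : Fin T.out) (α : ZMod P) : ℝ :=
  fderiv ℝ (T.loss s) (fun i' _ => y i') (Pi.single i (Pi.single α 1))

/-- The law of the outputs: independent centred Gaussians of variance `q`. -/
def outLaw (T : Batch P) (q : ℝ) : Measure (Fin T.out → ℝ) :=
  Measure.pi fun _ => gaussianReal 0 q.toNNReal

/-- The losses are differentiable and their gradients at the output have finite second
moments. -/
def Regular (T : Batch P) (q : ℝ) : Prop :=
  (∀ s, Differentiable ℝ (T.loss s)) ∧
    ∀ s i α, MemLp (fun y => T.outGrad y s i α) 2 (T.outLaw q)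

/-- Almost surely the total gradient at the output (summed over samples and positions) is
not zero. -/
def GradNonzero (T : Batch P) (q : ℝ) : Prop :=
  ∀ᵐ y ∂T.outLaw q, ∃ i, ∑ s, ∑ α, T.outGrad y s i α ≠ 0

/-- The loss sees the first output channel, and sees the first input channel through it: neither
the total gradient at the first output channel, nor its pairing with the first input channel
(shifted by `k` positions, as for the first weight of a filter of range `[-k, k]`), vanishes almost
surely. -/
def FirstNonzero (T : Batch P) (q : ℝ) (k : ℕ) : Prop :=
  ∃ (hi : 0 < T.inp) (ho : 0 < T.out),
    (¬ ∀ᵐ y ∂T.outLaw q, ∑ s, ∑ α, T.outGrad y s ⟨0, ho⟩ α = 0) ∧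
    (¬ ∀ᵐ y ∂T.outLaw q,
      ∑ s, ∑ α, T.outGrad y s ⟨0, ho⟩ α * T.input s ⟨0, hi⟩ (α - k) = 0)

end Batch

/-- A one-dimensional convolutional network with periodic boundary, with `width l` channels of `P`
neurons in layer `l` (layer `0` is the input), filters of range `[-k, k]`, weights of
variance `σ_w² / v_l` with `v_l = width (l - 1) * (2 k + 1)`, and pre-activations of stationary
variance `q`.  The case `P = 1`, `k = 0` is the fully connected network. -/
structure Net (P : ℕ) where
  φ : ℝ → ℝ
  σw : ℝ
  q : ℝ
  k : ℕ
  depth : ℕ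
  width : ℕ → ℕ
  batch : Batch P

/-- The independent random variables of the network: forward weights `W^l_{i,j,β}`, their
independent copies used in back-propagation, and the pre-activations `y^l_i`. -/
inductive Coord where
  | fwd (l i j : ℕ) (β : ℤ)
  | bwd (l i j : ℕ) (β : ℤ)
  | pre (l i : ℕ)

/-- The variances of the random variables. -/
def Net.variance {P : ℕ} (A : Net P) : Coord → ℝ≥0
  | .fwd l _ _ _ => (A.σw ^ 2 / (A.width (l - 1) * (2 * A.k + 1))).toNNReal
  | .bwd l _ _ _ => (A.σw ^ 2 / (A.width (l - 1) * (2 * A.k + 1))).toNNReal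
  | .pre _ _ => A.q.toNNReal

namespace Net

variable {P : ℕ} [NeZero P]

/-- The joint law at initialization within the three approximations.  Infinite width: the
pre-activations of the channels of a layer are i.i.d. centred Gaussians, independent of the individual
weights and of the other layers.  Gradient independence: back-propagation uses an i.i.d. copy of the
weights.  Degeneracy: all pre-activations have the stationary variance `q`, and those of
one channel have correlation `1` for all inputs and positions, hence are one variable `y^l_i`.
(Coordinates beyond the widths or the depth exist but are never used.) -/
def law (A : Net P) : Measure (Coord → ℝ) :=
  Measure.infinitePi fun c => gaussianReal 0 (A.variance c)

/-- The filter range `[-k, k]`. -/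
def ker (A : Net P) : Finset ℤ := Finset.Icc (-(A.k : ℤ)) A.k

/-- The indices `(i, j, β)` of the weights of layer `l`. -/
def layer (A : Net P) (l : ℕ) : Finset (ℕ × ℕ × ℤ) :=
  Finset.range (A.width l) ×ˢ Finset.range (A.width (l - 1)) ×ˢ A.ker

/-- Back-propagation: `A.delta ω s t i α` is the derivative of the loss of sample `s` in the
pre-activation `(i, α)` of layer `L - t`, where
`∂ℓ/∂y^l_{i,α} = φ'(y^l_i) ∑_j ∑_β ∂ℓ/∂y^{l+1}_{j,α-β} W^{l+1}_{j,i,β}`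
with the backward copy of the weights. -/
def delta (A : Net P) (ω : Coord → ℝ) (s : Fin A.batch.size) : ℕ → ℕ → ZMod P → ℝ
  | 0, i, α =>
      if h : i < A.batch.out then
        A.batch.outGrad (fun i' => ω (.pre A.depth i')) s ⟨i, h⟩ α
      else 0
  | t + 1, i, α =>
      deriv A.φ (ω (.pre (A.depth - (t + 1)) i)) *
        ∑ j ∈ Finset.range (A.width (A.depth - t)), ∑ β ∈ A.ker,
          delta A ω s t j (α - (β : ZMod P)) * ω (.bwd (A.depth - t) j i β)

/-- What layer `l + 1` receives from channel `j` of layer `l`: the input itself if `l = 0`, and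
`φ(y^l_j)` otherwise. -/
def activation (A : Net P) (ω : Coord → ℝ) (s : Fin A.batch.size) : ℕ → ℕ → ZMod P → ℝ
  | 0, j, α => if h : j < A.batch.inp then A.batch.input s ⟨j, h⟩ α else 0
  | l + 1, j, _ => A.φ (ω (.pre (l + 1) j))

/-- The derivative of the batch loss (the mean over the samples) in the weight `W^l_{i,j,β}`. -/
def weightGrad (A : Net P) (ω : Coord → ℝ) (l : ℕ) (w : ℕ × ℕ × ℤ) : ℝ :=
  (A.batch.size : ℝ)⁻¹ * ∑ s, ∑ α : ZMod P,
    A.delta ω s (A.depth - l) w.1 α *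
      A.activation ω s (l - 1) w.2.1 (α + (w.2.2 : ZMod P))

/-- The sensitivity `|W ∂ℒ/∂W|` of a weight. -/
def score (A : Net P) (ω : Coord → ℝ) (l : ℕ) (w : ℕ × ℕ × ℤ) : ℝ :=
  |ω (.fwd l w.1 w.2.1 w.2.2) * A.weightGrad ω l w|

/-- The critical sparsity `s_cr` of sensitivity-based pruning, a random variable. -/
def scr (A : Net P) (ω : Coord → ℝ) : ℝ :=
  criticalSparsity A.depth A.layer (A.score ω)

/-- `m_l = E[|W^l_1 ∂ℒ/∂W^l_1|²]`, for the first weight of layer `l`. -/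
def secondMoment (A : Net P) (l : ℕ) : ℝ :=
  ∫ ω, A.score ω l (0, 0, -(A.k : ℤ)) ^ 2 ∂A.law

/-- The input and output layers have the sizes of the data, and no layer is empty. -/
def Fits (A : Net P) : Prop :=
  A.width 0 = A.batch.inp ∧ A.width A.depth = A.batch.out ∧ ∀ l ≤ A.depth, 1 ≤ A.width l

end Net

end SBP

end

/-! Write L for the depth. Everything rests on the identity χ = σ_w² E[φ'(√q Z)²] (`chi_eq`) and on
the conditional structure of back-propagation in the mean-field model. Given all layers above, the
total gradient in a channel is φ'(y) times a linear combination of fresh Gaussian weights. Hence the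
squared norm of the total gradient (`gradSq`) is multiplied by exactly χ, in conditional mean, with
every step down: the number of channels and the filter length cancel against the variance of the
weights (`lintegral_mul_gradSq_succ`). For the same reason a squared score in an interior layer,
other than the first, is a deterministic scale times the squared gradient norm of the layer above
times a variable of a fixed law that is independent of the layers above (`lintegral_score`,
`normScore`).

Conditioning. For 2 ≤ l < L the second moment m_l is χ^(L - l) times a factor that depends only on
the widths around l and on the data. If χ < 1, the ratio m_2 / m_L tends to 0 as the depth grows. If
χ = 1, these moments stay between positive constants, and only the first layer needs another
argument, because its inputs depend on the position. There the gradient is paired with the input,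
each step up the network translates the input by a filter offset, and averaged over the offsets this
is a symmetric random walk on ℤ / P. Its return probability is at least 1 / (P (2k + 1))
(`le_cyclicAvg_iterate`), so m_1 does not degenerate either.

Critical sparsity. Deterministically, s_cr is at most the fraction of weights that do not beat the
best score of layer 2 (`criticalSparsity_le_div`). A weight of layer d + 2 < L with d ≥ 1 fails to
beat it only if its own normalised score is at most τ, or if the ratio of the two squared gradient
norms times the largest normalised score of layer 2 is at least of order τ. The ratio has mean at
most χ^d = exp(-8κd), so with τ = exp(-4κd) Markov's inequality leaves exp(-4κd) for the second
event (`measure_exists_score_le`). The first event is summable over d because the logarithm of the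
normalised score is integrable: its probabilities add up to at most E|log U| / (4κ). The maximum
over about N² weights costs only N^(2/(m+1)) when it is controlled by moments of order m + 1. Summed
over d this loses about 2 log N / (4κ(m + 1)) layers out of L.

With m large, the coefficient of log(L N²) is at most 1/(4κ), below the 1/κ of the claim. The slack
absorbs all constants when L N² is large, and the term with √(L N²) absorbs them otherwise
(`exists_const_absorb`). -/

noncomputable section

namespace SBP

set_option linter.unusedSectionVars false

open scoped ENNReal
open Filter Topology

/-! ### Independence of functions of disjoint sets of coordinates -/

section Independence

variable {ι : Type*} {γ : ι → Measure ℝ} [∀ i, IsProbabilityMeasure (γ i)]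

open Classical in
/-- Two independent samples of a product measure can be glued along any set of coordinates. -/
lemma map_glue_infinitePi (T : Set ι) :
    ((Measure.infinitePi γ).prod (Measure.infinitePi γ)).map
      (fun p c => if c ∈ T then p.1 c else p.2 c) = Measure.infinitePi γ := by
  have hmeas : Measurable
      (fun (p : (ι → ℝ) × (ι → ℝ)) (c : ι) => if c ∈ T then p.1 c else p.2 c) := by
    refine measurable_pi_lambda _ fun c => ?_
    by_cases h : c ∈ T <;> simp only [h, if_true, if_false] <;> fun_prop
  refine Measure.eq_infinitePi γ fun s t ht => ?_
  rw [Measure.map_apply hmeas (MeasurableSet.pi s.countable_toSet fun i _ => ht i)]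
  have : (fun (p : (ι → ℝ) × (ι → ℝ)) (c : ι) => if c ∈ T then p.1 c else p.2 c) ⁻¹'
      (Set.pi s t) = (Set.pi (s.filter (· ∈ T)) t) ×ˢ (Set.pi (s.filter (· ∉ T)) t) := by
    ext p
    simp only [Set.mem_preimage, Set.mem_pi, Finset.mem_coe, Set.mem_prod, Finset.mem_filter]
    constructor
    · intro h
      refine ⟨fun i hi => ?_, fun i hi => ?_⟩
      · simpa [hi.2] using h i hi.1
      · simpa [hi.2] using h i hi.1
    · rintro ⟨h1, h2⟩ i hi
      by_cases hT : i ∈ T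
      · simpa [hT] using h1 i ⟨hi, hT⟩
      · simpa [hT] using h2 i ⟨hi, hT⟩
  rw [this, Measure.prod_prod, Measure.infinitePi_pi _ (fun i _ => ht i),
    Measure.infinitePi_pi _ (fun i _ => ht i), Finset.prod_filter_mul_prod_filter_not]

/-- After gluing two independent samples along `T`, `X` reads only the first and `Y` only the
second. Stated through `DependsOn`, independence of recursively defined quantities reduces to
tracking which coordinates they use. -/
lemma map_prodMk_of_dependsOn {α β : Type*} [MeasurableSpace α] [MeasurableSpace β]
    {X : (ι → ℝ) → α} {Y : (ι → ℝ) → β} (hX : Measurable X) (hY : Measurable Y) {T : Set ι}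
    (hXT : DependsOn X T) (hYT : DependsOn Y Tᶜ) :
    (Measure.infinitePi γ).map (fun ω => (X ω, Y ω)) =
      ((Measure.infinitePi γ).map X).prod ((Measure.infinitePi γ).map Y) := by
  classical
  have hmeas : Measurable
      (fun (p : (ι → ℝ) × (ι → ℝ)) (c : ι) => if c ∈ T then p.1 c else p.2 c) := by
    refine measurable_pi_lambda _ fun c => ?_
    by_cases h : c ∈ T <;> simp only [h, if_true, if_false] <;> fun_prop
  rw [Measure.map_prod_map _ _ hX hY]
  conv_lhs => rw [← map_glue_infinitePi (γ := γ) T]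
  rw [Measure.map_map (by fun_prop) hmeas]
  congr 1
  funext p
  simp only [Function.comp, Prod.map]
  refine Prod.ext (hXT fun i hi => by simp [hi]) (hYT fun i hi => ?_)
  have : i ∉ T := hi
  simp [this]

lemma indepFun_of_dependsOn {α β : Type*} [MeasurableSpace α] [MeasurableSpace β]
    {X : (ι → ℝ) → α} {Y : (ι → ℝ) → β} (hX : Measurable X) (hY : Measurable Y) {T : Set ι}
    (hXT : DependsOn X T) (hYT : DependsOn Y Tᶜ) :
    IndepFun X Y (Measure.infinitePi γ) := by
  rw [indepFun_iff_map_prod_eq_prod_map_map hX.aemeasurable hY.aemeasurable]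
  exact map_prodMk_of_dependsOn hX hY hXT hYT

lemma lintegral_mul_of_dependsOn {X Y : (ι → ℝ) → ℝ≥0∞} (hX : Measurable X) (hY : Measurable Y)
    {T : Set ι} (hXT : DependsOn X T) (hYT : DependsOn Y Tᶜ) :
    ∫⁻ ω, X ω * Y ω ∂(Measure.infinitePi γ) =
      (∫⁻ ω, X ω ∂(Measure.infinitePi γ)) * ∫⁻ ω, Y ω ∂(Measure.infinitePi γ) :=
  lintegral_mul_eq_lintegral_mul_lintegral_of_indepFun hX hY
    (indepFun_of_dependsOn hX hY hXT hYT)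

open Classical in
/-- Resampling the coordinates outside `T`. -/
lemma lintegral_glue {H : (ι → ℝ) → ℝ≥0∞} (hH : Measurable H) (T : Set ι) :
    ∫⁻ ω, H ω ∂(Measure.infinitePi γ) =
      ∫⁻ ω, ∫⁻ ω', H (fun c => if c ∈ T then ω c else ω' c)
        ∂(Measure.infinitePi γ) ∂(Measure.infinitePi γ) := by
  have hmeas : Measurable
      (fun (p : (ι → ℝ) × (ι → ℝ)) (c : ι) => if c ∈ T then p.1 c else p.2 c) := by
    refine measurable_pi_lambda _ fun c => ?_
    by_cases h : c ∈ T <;> simp only [h, if_true, if_false] <;> fun_prop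
  conv_lhs => rw [← map_glue_infinitePi (γ := γ) T]
  rw [lintegral_map hH hmeas]
  exact lintegral_prod _ (hH.comp hmeas).aemeasurable

end Independence

/-! ### Linear combinations of independent Gaussians -/

section GaussianSums

variable {ι κ : Type*} (v : ι → ℝ≥0)

/-- The law of a linear combination of independent centred Gaussians. -/
lemma map_sum_gaussian (S : Finset κ) (e : κ → ℝ) {f : κ → ι} (hf : Function.Injective f) :
    (Measure.infinitePi fun i => gaussianReal 0 (v i)).map (fun ω => ∑ x ∈ S, e x * ω (f x)) =
      gaussianReal 0 (∑ x ∈ S, (e x ^ 2).toNNReal * v (f x)) := by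
  classical
  induction S using Finset.induction_on with
  | empty => simp
  | insert x S hx ih =>
    have h1 : (Measure.infinitePi fun i => gaussianReal 0 (v i)).map (fun ω => e x * ω (f x)) =
        gaussianReal 0 ((e x ^ 2).toNNReal * v (f x)) := by
      have := Measure.map_map (μ := Measure.infinitePi fun i => gaussianReal 0 (v i))
        (g := fun y : ℝ => e x * y) (f := fun ω : ι → ℝ => ω (f x)) (by fun_prop) (by fun_prop)
      simp only [Function.comp_def] at this
      rw [← this, Measure.infinitePi_map_eval, gaussianReal_map_const_mul]
      congr 1
      · simp
      · congr 1
        ext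
        simp [Real.coe_toNNReal _ (sq_nonneg (e x))]
    have hind : IndepFun (fun ω : ι → ℝ => e x * ω (f x)) (fun ω => ∑ y ∈ S, e y * ω (f y))
        (Measure.infinitePi fun i => gaussianReal 0 (v i)) := by
      refine indepFun_of_dependsOn (T := {f x}) (by fun_prop) (by fun_prop) ?_ ?_
      · intro a b h
        simp [h (f x) rfl]
      · intro a b h
        refine Finset.sum_congr rfl fun y hy => ?_
        rw [h (f y) (fun h' => hx (hf h' ▸ hy))]
    have := gaussianReal_add_gaussianReal_of_indepFun hind h1 ih
    rw [Finset.sum_insert hx]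
    simp only [Finset.sum_insert hx]
    rw [add_zero] at this
    exact this

lemma gaussianReal_eq_map_stdNormal (v : ℝ≥0) :
    gaussianReal 0 v = stdNormal.map (fun z => √(v : ℝ) * z) := by
  rw [stdNormal, gaussianReal_map_const_mul]
  congr 1
  · simp
  · ext
    simp

instance : IsProbabilityMeasure stdNormal := by
  unfold stdNormal
  infer_instance

/-- Four independent standard Gaussians. -/
def stdNormalFour : Measure (ℝ × ℝ × ℝ × ℝ) :=
  stdNormal.prod (stdNormal.prod (stdNormal.prod stdNormal))

instance : IsProbabilityMeasure stdNormalFour := by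
  unfold stdNormalFour
  infer_instance

/-- Three coordinates and a linear combination of further coordinates are jointly Gaussian. -/
lemma map_coords_sum_gaussian (S : Finset κ) (e : κ → ℝ) {f : κ → ι} (hf : Function.Injective f)
    {c₁ c₂ c₃ : ι} (h₁₂ : c₁ ≠ c₂) (h₁₃ : c₁ ≠ c₃) (h₂₃ : c₂ ≠ c₃) (h₁ : ∀ x, f x ≠ c₁)
    (h₂ : ∀ x, f x ≠ c₂) (h₃ : ∀ x, f x ≠ c₃) :
    (Measure.infinitePi fun i => gaussianReal 0 (v i)).map
        (fun ω => (ω c₁, ω c₂, ω c₃, ∑ x ∈ S, e x * ω (f x))) =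
      stdNormalFour.map (fun z => (√(v c₁ : ℝ) * z.1, √(v c₂ : ℝ) * z.2.1,
        √(v c₃ : ℝ) * z.2.2.1, √(∑ x ∈ S, e x ^ 2 * (v (f x) : ℝ)) * z.2.2.2)) := by
  have hV : ((∑ x ∈ S, (e x ^ 2).toNNReal * v (f x) : ℝ≥0) : ℝ) =
      ∑ x ∈ S, e x ^ 2 * (v (f x) : ℝ) := by
    push_cast
    refine Finset.sum_congr rfl fun x _ => ?_
    rw [Real.coe_toNNReal _ (sq_nonneg _)]
  rw [← hV]
  have e3 := map_prodMk_of_dependsOn (γ := fun i => gaussianReal 0 (v i)) (X := fun ω => ω c₃)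
    (Y := fun ω => ∑ x ∈ S, e x * ω (f x)) (T := {c₃}) (by fun_prop) (by fun_prop)
    (fun a b h => h c₃ rfl)
    (fun a b h => Finset.sum_congr rfl fun x _ => by rw [h (f x) (h₃ x)])
  have e2 := map_prodMk_of_dependsOn (γ := fun i => gaussianReal 0 (v i)) (X := fun ω => ω c₂)
    (Y := fun ω => (ω c₃, ∑ x ∈ S, e x * ω (f x))) (T := {c₂}) (by fun_prop) (by fun_prop)
    (fun a b h => h c₂ rfl)
    (fun a b h => Prod.ext (h c₃ h₂₃.symm)
      (Finset.sum_congr rfl fun x _ => by rw [h (f x) (h₂ x)]))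
  have e1 := map_prodMk_of_dependsOn (γ := fun i => gaussianReal 0 (v i)) (X := fun ω => ω c₁)
    (Y := fun ω => (ω c₂, ω c₃, ∑ x ∈ S, e x * ω (f x))) (T := {c₁}) (by fun_prop) (by fun_prop)
    (fun a b h => h c₁ rfl)
    (fun a b h => Prod.ext (h c₂ h₁₂.symm) (Prod.ext (h c₃ h₁₃.symm)
      (Finset.sum_congr rfl fun x _ => by rw [h (f x) (h₁ x)])))
  rw [e1, e2, e3, map_sum_gaussian v S e hf, Measure.infinitePi_map_eval,
    Measure.infinitePi_map_eval, Measure.infinitePi_map_eval]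
  simp only [gaussianReal_eq_map_stdNormal]
  rw [Measure.map_prod_map _ _ (by fun_prop) (by fun_prop),
    Measure.map_prod_map _ _ (by fun_prop) (by fun_prop),
    Measure.map_prod_map _ _ (by fun_prop) (by fun_prop)]
  rfl

end GaussianSums

/-! ### Integrability against the standard Gaussian -/

section Moments

lemma integrable_one_add_abs_pow (m : ℕ) :
    Integrable (fun z : ℝ => (1 + |z|) ^ m) stdNormal := by
  have h1 : MemLp (fun z : ℝ => 1 + |z|) m stdNormal := by
    have h : MemLp (fun z : ℝ => z) m stdNormal := memLp_id_gaussianReal' m (by simp)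
    exact (memLp_const (1 : ℝ)).add h.norm
  have h2 := h1.integrable_norm_pow'
  refine h2.congr (ae_of_all _ fun z => ?_)
  have : (0 : ℝ) ≤ 1 + |z| := by positivity
  simp [Real.norm_of_nonneg this]

/-- A function of at most polynomial growth. -/
def PolyGrowth (g : ℝ → ℝ) : Prop :=
  ∃ (C : ℝ) (m : ℕ), 0 ≤ C ∧ ∀ x, |g x| ≤ C * (1 + |x|) ^ m

lemma PolyGrowth.comp_mul {g : ℝ → ℝ} (hg : PolyGrowth g) (s : ℝ) :
    PolyGrowth fun x => g (s * x) := by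
  obtain ⟨C, m, hC, h⟩ := hg
  refine ⟨C * (1 + |s|) ^ m, m, by positivity, fun x => (h _).trans ?_⟩
  rw [mul_assoc, ← mul_pow]
  gcongr
  rw [abs_mul]
  nlinarith [abs_nonneg s, abs_nonneg x]

lemma PolyGrowth.pow {g : ℝ → ℝ} (hg : PolyGrowth g) (n : ℕ) : PolyGrowth fun x => g x ^ n := by
  obtain ⟨C, m, hC, h⟩ := hg
  refine ⟨C ^ n, m * n, by positivity, fun x => ?_⟩
  rw [abs_pow, pow_mul, ← mul_pow]
  exact pow_le_pow_left₀ (abs_nonneg _) (h x) n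

lemma polyGrowth_id : PolyGrowth fun x => x :=
  ⟨1, 1, zero_le_one, fun x => by linarith⟩

lemma PolyGrowth.integrable {g : ℝ → ℝ} (hg : PolyGrowth g) (hm : Measurable g) :
    Integrable g stdNormal := by
  obtain ⟨C, m, hC, h⟩ := hg
  exact ((integrable_one_add_abs_pow m).const_mul C).mono' hm.aestronglyMeasurable
    (ae_of_all _ fun x => h x)

/-- The Gaussian density is at most 1, so near 0 the local Lebesgue integrability of the logarithm
suffices; for |z| ≥ 1 the logarithm is dominated by 1 + |z|. -/
lemma integrable_log_abs_stdNormal : Integrable (fun z : ℝ => Real.log |z|) stdNormal := by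
  have hle : stdNormal ≤ volume := by
    rw [stdNormal, gaussianReal_of_var_ne_zero 0 one_ne_zero]
    calc volume.withDensity (gaussianPDF 0 1) ≤ volume.withDensity 1 := by
          refine withDensity_mono (ae_of_all _ fun x => ?_)
          simp only [gaussianPDF, Pi.one_apply]
          rw [← ENNReal.ofReal_one]
          refine ENNReal.ofReal_le_ofReal ?_
          rw [gaussianPDFReal]
          have h1 : (1 : ℝ) ≤ √(2 * Real.pi * ((1 : ℝ≥0) : ℝ)) := by
            rw [Real.one_le_sqrt]
            have := Real.pi_gt_three
            norm_num
            linarith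
          refine mul_le_one₀ (inv_le_one_of_one_le₀ h1) (Real.exp_nonneg _) ?_
          rw [Real.exp_le_one_iff]
          have : 0 ≤ (x - 0) ^ 2 / (2 * ((1 : ℝ≥0) : ℝ)) := by positivity
          rw [neg_div]
          linarith
      _ = volume := withDensity_one
  have h1 : IntegrableOn (fun z : ℝ => Real.log |z|) (Set.Ioc (-1) 1) stdNormal := by
    have : IntervalIntegrable Real.log volume (-1) 1 := intervalIntegral.intervalIntegrable_log'
    rw [intervalIntegrable_iff_integrableOn_Ioc_of_le (by norm_num)] at this
    simp only [Real.log_abs]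
    exact IntegrableOn.mono_measure this hle
  have h2 : IntegrableOn (fun z : ℝ => Real.log |z|) (Set.Ioc (-1) 1)ᶜ stdNormal := by
    have hp : Integrable (fun z : ℝ => (1 + |z|) ^ 1) stdNormal := integrable_one_add_abs_pow 1
    refine Integrable.mono' hp.integrableOn
      (Real.measurable_log.comp (by fun_prop : Measurable fun z : ℝ => |z|)).aestronglyMeasurable ?_
    refine (ae_restrict_iff' (by measurability)).2 (ae_of_all _ fun z hz => ?_)
    have hz1 : 1 ≤ |z| := by
      simp only [Set.mem_compl_iff, Set.mem_Ioc, not_and_or, not_lt, not_le] at hz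
      rcases hz with h | h
      · rw [abs_of_nonpos (by linarith)]
        linarith
      · exact h.le.trans (le_abs_self z)
    rw [Real.norm_of_nonneg (Real.log_nonneg hz1)]
    have := Real.log_le_sub_one_of_pos (show 0 < |z| by linarith)
    simp only [pow_one]
    linarith
  have := h1.union h2
  rwa [Set.union_compl_self, integrableOn_univ] at this

end Moments

/-! ### Regularity of the activation -/

namespace PseudoLipschitz

variable {φ : ℝ → ℝ}

lemma exists_nonneg (hφ : PseudoLipschitz φ) : ∃ (K : ℝ) (p : ℕ), 0 ≤ K ∧
    ∀ u v : ℝ, |φ u - φ v| ≤ K * (1 + |u| + |v|) ^ p * |u - v| := by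
  obtain ⟨K, p, h⟩ := hφ
  refine ⟨K, p, ?_, h⟩
  have := (abs_nonneg _).trans (h 0 1)
  simp only [abs_zero, abs_one, zero_sub, abs_neg, mul_one, add_zero] at this
  exact nonneg_of_mul_nonneg_left this (by positivity)

lemma lipschitzOnWith (hφ : PseudoLipschitz φ) (n : ℕ) :
    ∃ C : ℝ≥0, LipschitzOnWith C φ (Set.Ioo (-(n : ℝ)) n) := by
  obtain ⟨K, p, hK, h⟩ := hφ.exists_nonneg
  refine ⟨⟨K * (1 + n + n) ^ p, by positivity⟩, LipschitzOnWith.of_dist_le_mul fun x hx y hy => ?_⟩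
  rw [Real.dist_eq, Real.dist_eq]
  refine (h x y).trans ?_
  have hx' := (abs_lt.2 hx).le
  have hy' := (abs_lt.2 hy).le
  show _ ≤ K * (1 + n + n) ^ p * _
  gcongr

lemma mem_Ioo_nhds (x : ℝ) : ∃ n : ℕ, Set.Ioo (-(n : ℝ)) n ∈ 𝓝 x := by
  obtain ⟨n, hn⟩ := exists_nat_gt |x|
  rw [abs_lt] at hn
  exact ⟨n, Ioo_mem_nhds hn.1 hn.2⟩

lemma continuous (hφ : PseudoLipschitz φ) : Continuous φ := by
  refine continuous_iff_continuousAt.2 fun x => ?_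
  obtain ⟨n, hn⟩ := mem_Ioo_nhds x
  obtain ⟨C, hC⟩ := hφ.lipschitzOnWith n
  exact hC.continuousOn.continuousAt hn

lemma ae_differentiableAt (hφ : PseudoLipschitz φ) : ∀ᵐ x, DifferentiableAt ℝ φ x := by
  have h : ∀ n : ℕ, ∀ᵐ x : ℝ, x ∈ Set.Ioo (-(n : ℝ)) n →
      DifferentiableWithinAt ℝ φ (Set.Ioo (-(n : ℝ)) n) x := fun n => by
    obtain ⟨C, hC⟩ := hφ.lipschitzOnWith n
    exact hC.ae_differentiableWithinAt_of_mem_real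
  filter_upwards [ae_all_iff.2 h] with x hx
  obtain ⟨n, hn⟩ := mem_Ioo_nhds x
  exact (hx n (mem_of_mem_nhds hn)).differentiableAt hn

lemma abs_deriv_le {K : ℝ} {p : ℕ} (hK : 0 ≤ K)
    (h : ∀ u v : ℝ, |φ u - φ v| ≤ K * (1 + |u| + |v|) ^ p * |u - v|) (x : ℝ) :
    |deriv φ x| ≤ K * (1 + |x| + |x|) ^ p := by
  by_cases hd : DifferentiableAt ℝ φ x
  · have h1 := (hasDerivAt_iff_tendsto_slope.1 hd.hasDerivAt).abs
    have h2 : Tendsto (fun y => K * (1 + |x| + |y|) ^ p) (𝓝[≠] x)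
        (𝓝 (K * (1 + |x| + |x|) ^ p)) :=
      (Continuous.tendsto (by fun_prop) x).mono_left nhdsWithin_le_nhds
    refine le_of_tendsto_of_tendsto h1 h2 ?_
    filter_upwards [self_mem_nhdsWithin] with y hy
    have hy' : 0 < |y - x| := abs_pos.2 (sub_ne_zero.2 hy)
    rw [slope_def_field, abs_div, div_le_iff₀ hy', abs_sub_comm, abs_sub_comm y x]
    exact h x y
  · rw [deriv_zero_of_not_differentiableAt hd, abs_zero]
    positivity

/-- One bound for difference quotients and for the derivative on the diagonal. It provides the
dominating function when χ is computed. -/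
lemma abs_dslope_le {K : ℝ} {p : ℕ} (hK : 0 ≤ K)
    (h : ∀ u v : ℝ, |φ u - φ v| ≤ K * (1 + |u| + |v|) ^ p * |u - v|) (x y : ℝ) :
    |dslope φ x y| ≤ K * (1 + |x| + |y|) ^ p := by
  rcases eq_or_ne y x with rfl | hy
  · rw [dslope_same]
    exact abs_deriv_le hK h y
  · have hy' : 0 < |y - x| := abs_pos.2 (sub_ne_zero.2 hy)
    rw [dslope_of_ne _ hy, slope_def_field, abs_div, div_le_iff₀ hy', abs_sub_comm,
      abs_sub_comm y x]
    exact h x y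

lemma polyGrowth (hφ : PseudoLipschitz φ) : PolyGrowth φ := by
  obtain ⟨K, p, hK, h⟩ := hφ.exists_nonneg
  refine ⟨|φ 0| + K, p + 1, by positivity, fun x => ?_⟩
  have h1 := h x 0
  simp only [abs_zero, add_zero, sub_zero] at h1
  have h2 : |φ x| ≤ |φ 0| + |φ x - φ 0| := by
    have := abs_add_le (φ 0) (φ x - φ 0)
    simpa using this
  have h3 : (1 : ℝ) ≤ (1 + |x|) ^ (p + 1) := one_le_pow₀ (by linarith [abs_nonneg x])
  have h4 : K * (1 + |x|) ^ p * |x| ≤ K * (1 + |x|) ^ (p + 1) := by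
    rw [pow_succ, mul_assoc]
    gcongr
    linarith
  nlinarith [abs_nonneg (φ 0)]

lemma polyGrowth_deriv (hφ : PseudoLipschitz φ) : PolyGrowth (deriv φ) := by
  obtain ⟨K, p, hK, h⟩ := hφ.exists_nonneg
  refine ⟨K * 2 ^ p, p, by positivity, fun x => (abs_deriv_le hK h x).trans ?_⟩
  rw [mul_assoc, ← mul_pow]
  gcongr
  linarith

end PseudoLipschitz

/-! ### The slope χ as a moment of the derivative -/

section Chi

variable {φ : ℝ → ℝ}

lemma ae_stdNormal_of_ae {p : ℝ → Prop} (h : ∀ᵐ x, p x) {s : ℝ} (hs : s ≠ 0) :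
    ∀ᵐ z ∂stdNormal, p (s * z) := by
  have h1 : ∀ᵐ z : ℝ, p (s * z) := by
    have hq : Measure.QuasiMeasurePreserving (fun z : ℝ => s * z) volume volume := by
      refine ⟨by fun_prop, ?_⟩
      rw [Real.map_volume_mul_left hs]
      exact Measure.smul_absolutelyContinuous
    exact hq.ae h
  exact (gaussianReal_absolutelyContinuous 0 one_ne_zero).ae_le h1

lemma map_rotation {c : ℝ} (hc : c ∈ Set.Icc (-1 : ℝ) 1) :
    (stdNormal.prod stdNormal).map (fun z => c * z.1 + √(1 - c ^ 2) * z.2) = stdNormal := by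
  have hc2 : 0 ≤ 1 - c ^ 2 := by nlinarith [hc.1, hc.2]
  have h1 : (stdNormal.prod stdNormal).map (fun z : ℝ × ℝ => c * z.1) =
      gaussianReal 0 (c ^ 2).toNNReal := by
    have := Measure.map_map (μ := stdNormal.prod stdNormal) (g := fun y : ℝ => c * y)
      (f := Prod.fst) (by fun_prop) (by fun_prop)
    simp only [Function.comp_def] at this
    rw [← this, Measure.map_fst_prod, measure_univ, one_smul, stdNormal,
      gaussianReal_map_const_mul]
    congr 1
    · simp
    · ext
      simp [Real.coe_toNNReal _ (sq_nonneg c)]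
  have h2 : (stdNormal.prod stdNormal).map (fun z : ℝ × ℝ => √(1 - c ^ 2) * z.2) =
      gaussianReal 0 (1 - c ^ 2).toNNReal := by
    have := Measure.map_map (μ := stdNormal.prod stdNormal) (g := fun y : ℝ => √(1 - c ^ 2) * y)
      (f := Prod.snd) (by fun_prop) (by fun_prop)
    simp only [Function.comp_def] at this
    rw [← this, Measure.map_snd_prod, measure_univ, one_smul, stdNormal,
      gaussianReal_map_const_mul]
    congr 1
    · simp
    · ext
      simp [Real.coe_toNNReal _ hc2, Real.sq_sqrt hc2]
  have hind : IndepFun (fun z : ℝ × ℝ => c * z.1) (fun z : ℝ × ℝ => √(1 - c ^ 2) * z.2)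
      (stdNormal.prod stdNormal) :=
    indepFun_prod (X := fun x : ℝ => c * x) (Y := fun x : ℝ => √(1 - c ^ 2) * x)
      (by fun_prop) (by fun_prop)
  have := gaussianReal_add_gaussianReal_of_indepFun hind h1 h2
  have h3 : (c ^ 2).toNNReal + (1 - c ^ 2).toNNReal = 1 := by
    rw [← Real.toNNReal_add (sq_nonneg _) hc2]
    simp
  rw [h3, add_zero] at this
  exact this

lemma integrable_one_add_abs_add_abs_pow (m : ℕ) :
    Integrable (fun z : ℝ × ℝ => (1 + |z.1| + |z.2|) ^ m) (stdNormal.prod stdNormal) := by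
  refine ((integrable_one_add_abs_pow m).mul_prod (integrable_one_add_abs_pow m)).mono'
    (by fun_prop) (ae_of_all _ fun z => ?_)
  rw [Real.norm_of_nonneg (by positivity), ← mul_pow]
  refine pow_le_pow_left₀ (by positivity) ?_ m
  nlinarith [abs_nonneg z.1, abs_nonneg z.2, mul_nonneg (abs_nonneg z.1) (abs_nonneg z.2)]

/-- Both Gaussian arguments have the standard law (`map_rotation`), so E[X²] = E[Y²] and 2 E[XY] = 2
E[X²] - E[(X - Y)²]. The increment of the correlation function is thereby a mean square, which is of
first order in 1 - c. -/
lemma corrFun_sub_corrFun_one (hφ : PseudoLipschitz φ) (σb σw q : ℝ) {c : ℝ}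
    (hc : c ∈ Set.Icc (-1 : ℝ) 1) :
    corrFun φ σb σw q c - corrFun φ σb σw q 1 =
      -(σw ^ 2 / (2 * q)) * ∫ z : ℝ × ℝ,
        (φ (√q * (c * z.1 + √(1 - c ^ 2) * z.2)) - φ (√q * z.1)) ^ 2
          ∂(stdNormal.prod stdNormal) := by
  have hcont := hφ.continuous
  have hg : Integrable (fun x => φ (√q * x) ^ 2) stdNormal :=
    ((hφ.polyGrowth.comp_mul (√q)).pow 2).integrable (by fun_prop)
  have hX : Integrable (fun z : ℝ × ℝ => φ (√q * z.1) ^ 2) (stdNormal.prod stdNormal) :=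
    hg.comp_fst _
  have hXi : ∫ z : ℝ × ℝ, φ (√q * z.1) ^ 2 ∂(stdNormal.prod stdNormal) =
      ∫ x, φ (√q * x) ^ 2 ∂stdNormal := by
    rw [integral_fun_fst (f := fun x => φ (√q * x) ^ 2)]
    simp
  have hmr : Measurable (fun z : ℝ × ℝ => c * z.1 + √(1 - c ^ 2) * z.2) := by fun_prop
  have hg' : Integrable (fun x => φ (√q * x) ^ 2)
      ((stdNormal.prod stdNormal).map (fun z : ℝ × ℝ => c * z.1 + √(1 - c ^ 2) * z.2)) := by
    rwa [map_rotation hc]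
  have hY : Integrable (fun z : ℝ × ℝ => φ (√q * (c * z.1 + √(1 - c ^ 2) * z.2)) ^ 2)
      (stdNormal.prod stdNormal) := hg'.comp_measurable hmr
  have hYi : ∫ z : ℝ × ℝ, φ (√q * (c * z.1 + √(1 - c ^ 2) * z.2)) ^ 2
      ∂(stdNormal.prod stdNormal) = ∫ x, φ (√q * x) ^ 2 ∂stdNormal := by
    conv_rhs => rw [← map_rotation hc]
    rw [integral_map hmr.aemeasurable]
    rw [map_rotation hc]
    exact hg.aestronglyMeasurable
  have hXY : Integrable (fun z : ℝ × ℝ =>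
      φ (√q * z.1) * φ (√q * (c * z.1 + √(1 - c ^ 2) * z.2))) (stdNormal.prod stdNormal) := by
    refine (hX.add hY).mono' (by fun_prop) (ae_of_all _ fun z => ?_)
    simp only [Pi.add_apply, Real.norm_eq_abs, abs_mul]
    nlinarith [sq_nonneg (|φ (√q * z.1)| - |φ (√q * (c * z.1 + √(1 - c ^ 2) * z.2))|),
      sq_abs (φ (√q * z.1)), sq_abs (φ (√q * (c * z.1 + √(1 - c ^ 2) * z.2))),
      sq_nonneg (φ (√q * z.1)), sq_nonneg (φ (√q * (c * z.1 + √(1 - c ^ 2) * z.2)))]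
  have hexp : ∫ z : ℝ × ℝ, (φ (√q * (c * z.1 + √(1 - c ^ 2) * z.2)) - φ (√q * z.1)) ^ 2
      ∂(stdNormal.prod stdNormal) = 2 * (∫ x, φ (√q * x) ^ 2 ∂stdNormal) -
        2 * ∫ z : ℝ × ℝ, φ (√q * z.1) * φ (√q * (c * z.1 + √(1 - c ^ 2) * z.2))
          ∂(stdNormal.prod stdNormal) := by
    rw [two_mul (∫ x, φ (√q * x) ^ 2 ∂stdNormal)]
    nth_rewrite 1 [← hYi]
    rw [← hXi, ← integral_const_mul, ← integral_add hY hX, ← integral_sub (by exact hY.add hX)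
      (hXY.const_mul 2)]
    refine integral_congr_ae (ae_of_all _ fun z => ?_)
    ring
  have hone : ∫ z : ℝ × ℝ, φ (√q * z.1) * φ (√q * (1 * z.1 + √(1 - 1 ^ 2) * z.2))
      ∂(stdNormal.prod stdNormal) = ∫ x, φ (√q * x) ^ 2 ∂stdNormal := by
    rw [← hXi]
    refine integral_congr_ae (ae_of_all _ fun z => ?_)
    simp [sq]
  rw [hexp, corrFun, corrFun, hone]
  -- For q = 0 both sides are divisions by zero, with value 0.
  rcases eq_or_ne q 0 with rfl | hq
  · simp
  · generalize ∫ z : ℝ × ℝ, φ (√q * z.1) * φ (√q * (c * z.1 + √(1 - c ^ 2) * z.2))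
      ∂(stdNormal.prod stdNormal) = I
    generalize ∫ x, φ (√q * x) ^ 2 ∂stdNormal = J
    field_simp
    ring

/-- The slope of the correlation function at `1` in terms of the activation. -/
lemma chi_eq (hφ : PseudoLipschitz φ) (σb σw : ℝ) {q : ℝ} (hq : 0 < q) :
    chi φ σb σw q = σw ^ 2 * ∫ z, deriv φ (√q * z) ^ 2 ∂stdNormal := by
  have hcont := hφ.continuous
  obtain ⟨K, p, hK, hlip⟩ := hφ.exists_nonneg
  set s := √q with hs
  have hs0 : 0 ≤ s := Real.sqrt_nonneg q
  have hspos : 0 < s := Real.sqrt_pos.2 hq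
  have hs2 : s ^ 2 = q := Real.sq_sqrt hq.le
  let Y : ℝ → ℝ × ℝ → ℝ := fun c z => s * (c * z.1 + √(1 - c ^ 2) * z.2)
  -- The squared increment of φ divided by 1 - c. Factoring √(1 - c²) = √(1 - c) √(1 + c) takes √(1
  -- - c) out of Y - √q z₁, and the `dslope` form still makes sense at c = 1.
  let G : ℝ → ℝ × ℝ → ℝ := fun c z => dslope φ (s * z.1) (Y c z) ^ 2 *
    (q * (√(1 + c) * z.2 - √(1 - c) * z.1) ^ 2)
  have hG : ∀ c ∈ Set.Icc (-1 : ℝ) 1, ∀ z,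
      (φ (Y c z) - φ (s * z.1)) ^ 2 = (1 - c) * G c z := by
    intro c hc z
    have h0 : 0 ≤ 1 - c := by linarith [hc.2]
    have h1 : 0 ≤ 1 + c := by linarith [hc.1]
    have h2 : φ (Y c z) - φ (s * z.1) = (Y c z - s * z.1) * dslope φ (s * z.1) (Y c z) := by
      have := sub_smul_dslope φ (s * z.1) (Y c z)
      rw [smul_eq_mul] at this
      exact this.symm
    have h3 : Y c z - s * z.1 = s * √(1 - c) * (√(1 + c) * z.2 - √(1 - c) * z.1) := by
      have h4 : √(1 - c ^ 2) = √(1 - c) * √(1 + c) := by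
        rw [← Real.sqrt_mul h0]
        ring_nf
      have h5 : √(1 - c) * √(1 - c) = 1 - c := Real.mul_self_sqrt h0
      simp only [Y]
      rw [h4]
      linear_combination (s * z.1) * h5
    rw [h2, h3]
    simp only [G]
    have h5 : √(1 - c) ^ 2 = 1 - c := Real.sq_sqrt h0
    rw [← hs2]
    linear_combination (s ^ 2 * (√(1 + c) * z.2 - √(1 - c) * z.1) ^ 2 *
      dslope φ (s * z.1) (Y c z) ^ 2) * h5
  have hbound : ∀ c ∈ Set.Icc (-1 : ℝ) 1, ∀ z, ‖G c z‖ ≤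
      K ^ 2 * (1 + 2 * s) ^ (2 * p) * (4 * q) * (1 + |z.1| + |z.2|) ^ (2 * p + 2) := by
    intro c hc z
    have h0 : 0 ≤ 1 - c := by linarith [hc.2]
    have h1 : 0 ≤ 1 + c := by linarith [hc.1]
    have hr : √(1 - c ^ 2) ≤ 1 := Real.sqrt_le_one.2 (by nlinarith [sq_nonneg c])
    have hY : |Y c z| ≤ s * (|z.1| + |z.2|) := by
      simp only [Y, abs_mul, abs_of_nonneg hs0]
      refine mul_le_mul_of_nonneg_left ((abs_add_le _ _).trans ?_) hs0
      rw [abs_mul, abs_mul, abs_of_nonneg (Real.sqrt_nonneg (1 - c ^ 2))]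
      have hc' : |c| ≤ 1 := abs_le.2 hc
      nlinarith [abs_nonneg z.1, abs_nonneg z.2]
    have hd : |dslope φ (s * z.1) (Y c z)| ≤
        K * ((1 + 2 * s) * (1 + |z.1| + |z.2|)) ^ p := by
      refine (PseudoLipschitz.abs_dslope_le hK hlip _ _).trans ?_
      gcongr
      rw [abs_mul, abs_of_nonneg hs0]
      nlinarith [abs_nonneg z.1, abs_nonneg z.2, mul_nonneg hs0 (abs_nonneg z.1),
        mul_nonneg hs0 (abs_nonneg z.2)]
    have hd2 : dslope φ (s * z.1) (Y c z) ^ 2 ≤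
        K ^ 2 * (1 + 2 * s) ^ (2 * p) * (1 + |z.1| + |z.2|) ^ (2 * p) := by
      rw [← sq_abs]
      refine (pow_le_pow_left₀ (abs_nonneg _) hd 2).trans (le_of_eq ?_)
      rw [mul_pow, mul_pow, mul_pow]
      ring
    have hw : (√(1 + c) * z.2 - √(1 - c) * z.1) ^ 2 ≤ 4 * (1 + |z.1| + |z.2|) ^ 2 := by
      have e1 : √(1 - c) ^ 2 = 1 - c := Real.sq_sqrt h0
      have e2 : √(1 + c) ^ 2 = 1 + c := Real.sq_sqrt h1
      have e3 : (√(1 + c) * z.2 - √(1 - c) * z.1) ^ 2 ≤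
          2 * ((1 + c) * z.2 ^ 2 + (1 - c) * z.1 ^ 2) := by
        have e6 : (√(1 + c) * z.2 - √(1 - c) * z.1) ^ 2 + (√(1 + c) * z.2 + √(1 - c) * z.1) ^ 2 =
            2 * ((1 + c) * z.2 ^ 2 + (1 - c) * z.1 ^ 2) := by
          linear_combination 2 * z.2 ^ 2 * e2 + 2 * z.1 ^ 2 * e1
        linarith [sq_nonneg (√(1 + c) * z.2 + √(1 - c) * z.1)]
      have e4 : 0 ≤ (1 - c) * z.2 ^ 2 := mul_nonneg h0 (sq_nonneg _)
      have e5 : 0 ≤ (1 + c) * z.1 ^ 2 := mul_nonneg h1 (sq_nonneg _)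
      nlinarith [sq_abs z.1, sq_abs z.2, abs_nonneg z.1, abs_nonneg z.2,
        mul_nonneg (abs_nonneg z.1) (abs_nonneg z.2)]
    rw [Real.norm_of_nonneg (by positivity)]
    calc dslope φ (s * z.1) (Y c z) ^ 2 * (q * (√(1 + c) * z.2 - √(1 - c) * z.1) ^ 2)
        ≤ (K ^ 2 * (1 + 2 * s) ^ (2 * p) * (1 + |z.1| + |z.2|) ^ (2 * p)) *
            (q * (4 * (1 + |z.1| + |z.2|) ^ 2)) := by gcongr
      _ = _ := by ring
  have hlim : ∀ᵐ z ∂(stdNormal.prod stdNormal), Tendsto (fun c => G c z)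
      (𝓝[Set.Icc (-1) 1 \ {1}] 1) (𝓝 (deriv φ (s * z.1) ^ 2 * (q * (2 * z.2 ^ 2)))) := by
    have hae : ∀ᵐ x ∂stdNormal, DifferentiableAt ℝ φ (s * x) :=
      ae_stdNormal_of_ae hφ.ae_differentiableAt hspos.ne'
    have hae' : ∀ᵐ z ∂(stdNormal.prod stdNormal), DifferentiableAt ℝ φ (s * z.1) :=
      Measure.quasiMeasurePreserving_fst.ae hae
    filter_upwards [hae'] with z hz
    have hc1 : ContinuousAt (dslope φ (s * z.1)) (Y 1 z) := by
      simpa [Y] using continuousAt_dslope_same.2 hz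
    have hcY : ContinuousAt (fun c => Y c z) 1 := by
      apply Continuous.continuousAt
      fun_prop
    have hc2 : ContinuousAt (fun c => dslope φ (s * z.1) (Y c z)) 1 :=
      ContinuousAt.comp (f := fun c => Y c z) (x := (1 : ℝ)) hc1 hcY
    have hc3 : ContinuousAt (fun c => G c z) 1 :=
      (hc2.pow 2).mul (Continuous.continuousAt (by fun_prop))
    have h4 : G 1 z = deriv φ (s * z.1) ^ 2 * (q * (2 * z.2 ^ 2)) := by
      have e : Y 1 z = s * z.1 := by simp [Y]
      simp only [G, e, dslope_same]
      norm_num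
      left
      left
      rw [mul_pow, Real.sq_sqrt (by norm_num)]
    rw [← h4]
    exact hc3.tendsto.mono_left nhdsWithin_le_nhds
  -- Away from c = 1, `G c` is the plain quotient, which is measurable because φ is continuous.
  have hmeas : ∀ᶠ c in 𝓝[Set.Icc (-1 : ℝ) 1 \ {1}] 1,
      AEStronglyMeasurable (G c) (stdNormal.prod stdNormal) := by
    filter_upwards [self_mem_nhdsWithin] with c hc
    have h0 : 1 - c ≠ 0 := sub_ne_zero.2 (Ne.symm hc.2)
    have : G c = fun z => (1 - c)⁻¹ * (φ (Y c z) - φ (s * z.1)) ^ 2 := by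
      funext z
      rw [hG c hc.1, inv_mul_cancel_left₀ h0]
    rw [this]
    have hYm : Measurable (Y c) := by fun_prop
    have : Measurable fun z => (1 - c)⁻¹ * (φ (Y c z) - φ (s * z.1)) ^ 2 := by
      have := hcont.measurable
      fun_prop
    exact this.aestronglyMeasurable
  have hDCT := tendsto_integral_filter_of_dominated_convergence _ hmeas
    (by filter_upwards [self_mem_nhdsWithin] with c hc using ae_of_all _ (hbound c hc.1))
    ((integrable_one_add_abs_add_abs_pow (2 * p + 2)).const_mul _) hlim
  have hz2 : ∫ z : ℝ, z ^ 2 ∂stdNormal = 1 := by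
    have := variance_fun_id_gaussianReal (μ := 0) (v := 1)
    rw [variance_of_integral_eq_zero (by fun_prop) (by simp)] at this
    simpa [stdNormal] using this
  have hval : ∫ z : ℝ × ℝ, deriv φ (s * z.1) ^ 2 * (q * (2 * z.2 ^ 2))
      ∂(stdNormal.prod stdNormal) = 2 * q * ∫ z, deriv φ (s * z) ^ 2 ∂stdNormal := by
    rw [integral_prod_mul (fun x => deriv φ (s * x) ^ 2) (fun y => q * (2 * y ^ 2)),
      integral_const_mul, integral_const_mul, hz2]
    ring
  rw [hval] at hDCT
  have hderiv : HasDerivWithinAt (corrFun φ σb σw q)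
      (σw ^ 2 * ∫ z, deriv φ (s * z) ^ 2 ∂stdNormal) (Set.Icc (-1) 1) 1 := by
    rw [hasDerivWithinAt_iff_tendsto_slope]
    have h5 := hDCT.const_mul (σw ^ 2 / (2 * q))
    have h6 : σw ^ 2 / (2 * q) * (2 * q * ∫ z, deriv φ (s * z) ^ 2 ∂stdNormal) =
        σw ^ 2 * ∫ z, deriv φ (s * z) ^ 2 ∂stdNormal := by
      field_simp
    rw [h6] at h5
    refine h5.congr' ?_
    filter_upwards [self_mem_nhdsWithin] with c hc
    have h0 : c - 1 ≠ 0 := sub_ne_zero.2 hc.2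
    rw [slope_def_field, corrFun_sub_corrFun_one hφ σb σw q hc.1]
    have : ∫ z : ℝ × ℝ, (φ (√q * (c * z.1 + √(1 - c ^ 2) * z.2)) - φ (√q * z.1)) ^ 2
        ∂(stdNormal.prod stdNormal) = (1 - c) * ∫ z, G c z ∂(stdNormal.prod stdNormal) := by
      rw [← integral_const_mul]
      exact integral_congr_ae (ae_of_all _ fun z => hG c hc.1 z)
    rw [this]
    field_simp
    ring
  exact hderiv.derivWithin (uniqueDiffOn_Icc (by norm_num) 1 (by norm_num))

end Chi

/-! ### Bounding the critical sparsity by counting -/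

section Pruning

variable {ι : Type*}

-- The supremum is tested at the smallest score that exceeds `x`; if there is none, then `k = 0` and
-- ⊤ is a witness. This turns pruning into counting scores.
open Classical in
lemma coe_lt_kthLargest_iff (S : Finset ι) (g : ι → ℝ) (k : ℕ) (x : ℝ) :
    (x : EReal) < kthLargest S g k ↔ k ≤ (S.filter fun i => x < g i).card := by
  rw [kthLargest, lt_sSup_iff]
  constructor
  · rintro ⟨t, ht, hxt⟩
    refine le_trans ht (Finset.card_le_card fun i hi => ?_)
    rw [Finset.mem_filter] at hi ⊢
    exact ⟨hi.1, EReal.coe_lt_coe_iff.1 (hxt.trans_le hi.2)⟩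
  · intro h
    rcases (S.filter fun i => x < g i).eq_empty_or_nonempty with h0 | h0
    · rw [h0, Finset.card_empty, Nat.le_zero] at h
      exact ⟨⊤, by simp [h], EReal.coe_lt_top x⟩
    · obtain ⟨j, hj, hmin⟩ := Finset.exists_min_image _ g h0
      refine ⟨g j, h.trans (Finset.card_le_card fun i hi => ?_), ?_⟩
      · exact Finset.mem_filter.2 ⟨(Finset.mem_filter.1 hi).1, EReal.coe_le_coe_iff.2 (hmin i hi)⟩
      · exact EReal.coe_lt_coe_iff.2 (Finset.mem_filter.1 hj).2

open Classical in
/-- The number of weights in layers `1, …, L` whose score exceeds `x`. -/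
def numAbove (L : ℕ) (layer : ℕ → Finset ι) (g : ℕ → ι → ℝ) (x : ℝ) : ℕ :=
  (((Finset.Icc 1 L).sigma layer).filter fun w => x < g w.1 w.2).card

lemma card_prunedSet_eq_iff (L : ℕ) (layer : ℕ → Finset ι) (g : ℕ → ι → ℝ) (s : ℝ) (l : ℕ) :
    (prunedSet L layer g s l).card = (layer l).card ↔
      ∀ i ∈ layer l, ⌊(1 - s) * ((∑ l' ∈ Finset.Icc 1 L, (layer l').card : ℕ) : ℝ)⌋₊ ≤
        numAbove L layer g (g l i) := by
  classical
  rw [prunedSet, Finset.card_filter_eq_iff]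
  refine forall₂_congr fun i _ => ?_
  rw [coe_lt_kthLargest_iff]
  rfl

lemma criticalSparsity_nonneg (L : ℕ) (layer : ℕ → Finset ι) (g : ℕ → ι → ℝ) :
    0 ≤ criticalSparsity L layer g :=
  Real.sInf_nonneg fun _ hs => hs.1.1.le

lemma criticalSparsity_le_of_mem {L : ℕ} {layer : ℕ → Finset ι} {g : ℕ → ι → ℝ} {s : ℝ}
    (hs : s ∈ {s : ℝ | s ∈ Set.Ioo 0 1 ∧
      ∃ l ∈ Finset.Icc 1 L, (prunedSet L layer g s l).card = (layer l).card}) :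
    criticalSparsity L layer g ≤ s :=
  csInf_le ⟨0, fun _ h => h.1.1.le⟩ hs

lemma criticalSparsity_le_one (L : ℕ) (layer : ℕ → Finset ι) (g : ℕ → ι → ℝ) :
    criticalSparsity L layer g ≤ 1 := by
  rcases Set.eq_empty_or_nonempty {s : ℝ | s ∈ Set.Ioo 0 1 ∧
      ∃ l ∈ Finset.Icc 1 L, (prunedSet L layer g s l).card = (layer l).card} with h | ⟨s, hs⟩
  -- If no sparsity empties a layer, the infimum has the default value 0.
  · rw [criticalSparsity, h, Real.sInf_empty]
    exact zero_le_one
  · exact (criticalSparsity_le_of_mem hs).trans hs.1.2.le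

open Classical in
/-- The critical sparsity is at most the fraction of the weights whose score is at most the
largest score of a given layer. -/
lemma criticalSparsity_le_div (L : ℕ) (layer : ℕ → Finset ι) (g : ℕ → ι → ℝ) {l : ℕ}
    (hl : l ∈ Finset.Icc 1 L) (hne : 0 < ∑ l' ∈ Finset.Icc 1 L, (layer l').card) :
    criticalSparsity L layer g ≤
      (((((Finset.Icc 1 L).sigma layer).filter
        fun w => ∃ i ∈ layer l, g w.1 w.2 ≤ g l i).card : ℕ) : ℝ) /
        ((∑ l' ∈ Finset.Icc 1 L, (layer l').card : ℕ) : ℝ) := by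
  set M := ∑ l' ∈ Finset.Icc 1 L, (layer l').card with hM
  set R := (((Finset.Icc 1 L).sigma layer).filter
    fun w => ∃ i ∈ layer l, g w.1 w.2 ≤ g l i).card with hR
  have hMpos : (0 : ℝ) < M := by exact_mod_cast hne
  have hRM : R ≤ M := by
    refine (Finset.card_filter_le _ _).trans (le_of_eq ?_)
    rw [Finset.card_sigma]
  refine le_of_forall_gt_imp_ge_of_dense fun s hs => ?_
  rcases le_or_gt 1 s with h1 | h1
  · exact (criticalSparsity_le_one L layer g).trans h1
  have h0 : 0 < s := (div_nonneg R.cast_nonneg M.cast_nonneg).trans_lt hs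
  refine criticalSparsity_le_of_mem ⟨⟨h0, h1⟩, l, hl, ?_⟩
  rw [card_prunedSet_eq_iff]
  intro i hi
  -- A weight outside the set counted by `R` exceeds every score of layer `l`. Since s > R / M, at
  -- least M - R ≥ (1 - s) M weights lie above each weight of that layer, so the whole layer is
  -- pruned.
  have hcount : M ≤ R + numAbove L layer g (g l i) := by
    have h2 := Finset.card_filter_add_card_filter_not
      (s := (Finset.Icc 1 L).sigma layer) (fun w => ∃ i ∈ layer l, g w.1 w.2 ≤ g l i)
    rw [Finset.card_sigma, ← hM, ← hR] at h2
    rw [← h2]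
    gcongr
    refine Finset.card_le_card fun w hw => ?_
    rw [Finset.mem_filter] at hw ⊢
    push Not at hw
    exact ⟨hw.1, hw.2 i hi⟩
  have h3 : (1 - s) * (M : ℝ) ≤ ((numAbove L layer g (g l i) : ℕ) : ℝ) := by
    rw [div_lt_iff₀ hMpos] at hs
    have : (M : ℝ) ≤ R + numAbove L layer g (g l i) := by exact_mod_cast hcount
    linarith
  exact Nat.floor_le_of_le h3

/-- The critical sparsity is determined by how many scores exceed each given one. These counts are
measurable with values in a countable discrete space, on which every function is measurable. -/
lemma measurable_criticalSparsity {Ω : Type*} [MeasurableSpace Ω] (L : ℕ)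
    (layer : ℕ → Finset ι) (g : Ω → ℕ → ι → ℝ)
    (hg : ∀ l i, Measurable fun ω => g ω l i) :
    Measurable fun ω => criticalSparsity L layer (g ω) := by
  classical
  let S := (Finset.Icc 1 L).sigma layer
  have hcount : Measurable fun ω => fun w : S => numAbove L layer (g ω) (g ω w.1.1 w.1.2) := by
    refine measurable_pi_lambda _ fun w => ?_
    unfold numAbove
    simp only [Finset.card_filter]
    refine Finset.measurable_sum _ fun w' _ => ?_
    exact Measurable.ite (measurableSet_lt (hg _ _) (hg _ _)) measurable_const measurable_const
  let Ψ : (S → ℕ) → ℝ := fun n => sInf {s : ℝ | s ∈ Set.Ioo 0 1 ∧ ∃ l ∈ Finset.Icc 1 L,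
    ∀ w : S, w.1.1 = l →
      ⌊(1 - s) * ((∑ l' ∈ Finset.Icc 1 L, (layer l').card : ℕ) : ℝ)⌋₊ ≤ n w}
  have hΨ : Measurable Ψ := measurable_of_countable _
  convert hΨ.comp hcount using 1
  funext ω
  simp only [Function.comp, criticalSparsity, Ψ]
  congr 1
  ext s
  refine and_congr_right fun _ => exists_congr fun l => and_congr_right fun hl => ?_
  rw [card_prunedSet_eq_iff]
  constructor
  · rintro h ⟨⟨l', i⟩, hw⟩ rfl
    exact h i (Finset.mem_sigma.1 hw).2
  · intro h i hi
    exact h ⟨⟨l, i⟩, Finset.mem_sigma.2 ⟨hl, hi⟩⟩ rfl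

end Pruning

lemma Batch.measurable_outGrad {P : ℕ} [NeZero P] (T : Batch P) (s : Fin T.size) (i : Fin T.out)
    (α : ZMod P) : Measurable fun y => T.outGrad y s i α := by
  have h := measurable_fderiv_apply_const ℝ (T.loss s)
    (Pi.single i (Pi.single α (1 : ℝ)) : Fin T.out → ZMod P → ℝ)
  have h2 : Measurable fun (y : Fin T.out → ℝ) (i' : Fin T.out) (_ : ZMod P) => y i' := by
    fun_prop
  exact h.comp h2

lemma lintegral_stdNormalFour_mul {f₁ f₂ f₃ f₄ : ℝ → ℝ≥0∞} (h₁ : Measurable f₁)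
    (h₂ : Measurable f₂) (h₃ : Measurable f₃) (h₄ : Measurable f₄) :
    ∫⁻ z, f₁ z.1 * (f₂ z.2.1 * (f₃ z.2.2.1 * f₄ z.2.2.2)) ∂stdNormalFour =
      (∫⁻ z, f₁ z ∂stdNormal) * ((∫⁻ z, f₂ z ∂stdNormal) *
        ((∫⁻ z, f₃ z ∂stdNormal) * ∫⁻ z, f₄ z ∂stdNormal)) := by
  have e1 : Measurable fun z : ℝ × ℝ => f₃ z.1 * f₄ z.2 := by fun_prop
  have e2 : Measurable fun z : ℝ × ℝ × ℝ => f₂ z.1 * (f₃ z.2.1 * f₄ z.2.2) := by fun_prop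
  rw [stdNormalFour, lintegral_prod_mul (g := fun z : ℝ × ℝ × ℝ => f₂ z.1 * (f₃ z.2.1 * f₄ z.2.2))
      h₁.aemeasurable e2.aemeasurable,
    lintegral_prod_mul (g := fun z : ℝ × ℝ => f₃ z.1 * f₄ z.2) h₂.aemeasurable e1.aemeasurable,
    lintegral_prod_mul h₃.aemeasurable h₄.aemeasurable]

lemma lintegral_sq_stdNormal : ∫⁻ z, ENNReal.ofReal (z ^ 2) ∂stdNormal = 1 := by
  rw [← ofReal_integral_eq_lintegral_ofReal ((polyGrowth_id.pow 2).integrable (by fun_prop))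
    (ae_of_all _ fun z => sq_nonneg z)]
  have := variance_fun_id_gaussianReal (μ := 0) (v := 1)
  rw [variance_of_integral_eq_zero (by fun_prop) (by simp)] at this
  rw [stdNormal, this]
  simp

/-! ### Back-propagation conditionally on the layers above -/

namespace Net

variable {P : ℕ} [NeZero P] (A : Net P)

instance : IsProbabilityMeasure A.law := by
  unfold law
  infer_instance

/-- The coordinates that enter back-propagation down to layer `depth - t`. -/
def upper (t : ℕ) : Set Coord :=
  {c | match c with
    | .fwd _ _ _ _ => False
    | .bwd l _ _ _ => A.depth - t < l
    | .pre l _ => A.depth - t ≤ l}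

@[simp] lemma fwd_mem_upper (t l i j : ℕ) (β : ℤ) : Coord.fwd l i j β ∈ A.upper t ↔ False := Iff.rfl

@[simp] lemma bwd_mem_upper (t l i j : ℕ) (β : ℤ) :
    Coord.bwd l i j β ∈ A.upper t ↔ A.depth - t < l := Iff.rfl

@[simp] lemma pre_mem_upper (t l i : ℕ) : Coord.pre l i ∈ A.upper t ↔ A.depth - t ≤ l := Iff.rfl

lemma upper_mono {t t' : ℕ} (h : t ≤ t') : A.upper t ⊆ A.upper t' := by
  rintro (⟨⟩ | ⟨l, i, j, β⟩ | ⟨l, i⟩) hc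
  · exact hc
  · rw [bwd_mem_upper] at hc ⊢
    omega
  · rw [pre_mem_upper] at hc ⊢
    omega

lemma measurable_delta (s : Fin A.batch.size) (t i : ℕ) (α : ZMod P) :
    Measurable fun ω => A.delta ω s t i α := by
  induction t generalizing i α with
  | zero =>
    simp only [delta]
    split_ifs with h
    · have h2 : Measurable fun (ω : Coord → ℝ) (i' : Fin A.batch.out) =>
          ω (.pre A.depth i') := by fun_prop
      exact (A.batch.measurable_outGrad s ⟨i, h⟩ α).comp h2
    · exact measurable_const
  | succ t ih =>
    simp only [delta]
    have := measurable_deriv A.φ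
    fun_prop

/-- The bound `t ≤ depth` is needed because subtraction truncates: the weights of layer `depth - t`
must lie strictly above layer `depth - (t + 1)`. -/
lemma dependsOn_delta (s : Fin A.batch.size) {t : ℕ} (ht : t ≤ A.depth) (i : ℕ) (α : ZMod P) :
    DependsOn (fun ω => A.delta ω s t i α) (A.upper t) := by
  induction t generalizing i α with
  | zero =>
    intro ω ω' h
    have h2 : (fun i' : Fin A.batch.out => ω (.pre A.depth i')) =
        fun i' : Fin A.batch.out => ω' (.pre A.depth i') := by
      funext i'
      exact h _ (by simp)
    simp only [delta, h2]
  | succ t ih =>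
    intro ω ω' h
    simp only [delta]
    congr 1
    · rw [h _ (by simp)]
    · refine Finset.sum_congr rfl fun j _ => Finset.sum_congr rfl fun β _ => ?_
      congr 1
      · exact ih (by omega) j _ fun c hc => h c (A.upper_mono (Nat.le_succ t) hc)
      · exact h _ (by rw [bwd_mem_upper]; omega)

/-- The pairing of the gradients at channel `i` of layer `depth - t` with coefficients `c`. -/
def paired (c : Fin A.batch.size → ZMod P → ℝ) (t i : ℕ) (ω : Coord → ℝ) : ℝ :=
  ∑ s, ∑ α, A.delta ω s t i α * c s α

/-- The translate of the coefficients by `β` positions. -/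
def shift {n : ℕ} (c : Fin n → ZMod P → ℝ) (β : ℤ) : Fin n → ZMod P → ℝ :=
  fun s α => c s (α + (β : ZMod P))

@[fun_prop]
lemma measurable_paired (c : Fin A.batch.size → ZMod P → ℝ) (t i : ℕ) :
    Measurable (A.paired c t i) := by
  have := fun s α => A.measurable_delta s t i α
  unfold paired
  fun_prop

lemma dependsOn_paired (c : Fin A.batch.size → ZMod P → ℝ) {t : ℕ} (ht : t ≤ A.depth) (i : ℕ) :
    DependsOn (A.paired c t i) (A.upper t) := fun _ _ h =>
  Finset.sum_congr rfl fun s _ => Finset.sum_congr rfl fun α _ =>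
    congrArg (· * c s α) (A.dependsOn_delta s ht i α h)

/-- Translating the sum over positions moves the filter offset from the gradient to the
coefficients. Pairings are thus closed under back-propagation, and given the layers above the inner
sum is linear in fresh Gaussian weights. -/
lemma paired_succ (c : Fin A.batch.size → ZMod P → ℝ) (t i : ℕ) (ω : Coord → ℝ) :
    A.paired c (t + 1) i ω = deriv A.φ (ω (.pre (A.depth - (t + 1)) i)) *
      ∑ x ∈ Finset.range (A.width (A.depth - t)) ×ˢ A.ker,
        A.paired (shift c x.2) t x.1 ω * ω (.bwd (A.depth - t) x.1 i x.2) := by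
  have hshift : ∀ (s : Fin A.batch.size) (j : ℕ) (β : ℤ),
      ∑ α, A.delta ω s t j (α - (β : ZMod P)) * c s α =
        ∑ α, A.delta ω s t j α * shift c β s α := by
    intro s j β
    rw [← Equiv.sum_comp (Equiv.addRight (β : ZMod P))]
    simp [shift]
  simp only [paired, delta, ← hshift, ← Finset.sum_product', Finset.sum_mul, Finset.mul_sum]
  refine Finset.sum_nbij' (fun p => (p.2.2, p.1, p.2.1)) (fun p => (p.2.1, p.2.2, p.1))
    (by simp) (by simp) (by simp) (by simp) fun p _ => ?_
  ring

lemma coe_variance_fwd (l i j : ℕ) (β : ℤ) : ((A.variance (.fwd l i j β) : ℝ≥0) : ℝ) =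
    A.σw ^ 2 / (A.width (l - 1) * (2 * A.k + 1)) :=
  Real.coe_toNNReal _ (by positivity)

lemma coe_variance_bwd (l i j : ℕ) (β : ℤ) : ((A.variance (.bwd l i j β) : ℝ≥0) : ℝ) =
    A.σw ^ 2 / (A.width (l - 1) * (2 * A.k + 1)) :=
  Real.coe_toNNReal _ (by positivity)

lemma coe_variance_pre (hq : 0 ≤ A.q) (l i : ℕ) : ((A.variance (.pre l i) : ℝ≥0) : ℝ) = A.q :=
  Real.coe_toNNReal _ hq

/-- The conditional law, given the layers above, of the variables that enter the scores of layer
`depth - (t + 1)`. -/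
lemma lintegral_layer (hq : 0 ≤ A.q) {t : ℕ} (ht : t + 1 < A.depth) (i j : ℕ) (β : ℤ)
    {F : (Coord → ℝ) → ℝ × ℝ × ℝ × ℝ → ℝ≥0∞} (hF : Measurable (Function.uncurry F))
    (hFd : DependsOn F (A.upper t)) {e : (Coord → ℝ) → ℕ × ℤ → ℝ}
    (he : ∀ x, Measurable fun ω => e ω x) (hed : DependsOn e (A.upper t)) :
    ∫⁻ ω, F ω (ω (.fwd (A.depth - (t + 1)) i j β), ω (.pre (A.depth - (t + 1) - 1) j),
        ω (.pre (A.depth - (t + 1)) i),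
        ∑ x ∈ Finset.range (A.width (A.depth - t)) ×ˢ A.ker,
          e ω x * ω (.bwd (A.depth - t) x.1 i x.2)) ∂A.law =
      ∫⁻ ω, ∫⁻ z, F ω (√(A.σw ^ 2 / (A.width (A.depth - (t + 1) - 1) * (2 * A.k + 1))) * z.1,
        √A.q * z.2.1, √A.q * z.2.2.1,
        √(∑ x ∈ Finset.range (A.width (A.depth - t)) ×ˢ A.ker,
          e ω x ^ 2 * (A.σw ^ 2 / (A.width (A.depth - t - 1) * (2 * A.k + 1)))) * z.2.2.2)
        ∂stdNormalFour ∂A.law := by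
  classical
  unfold law
  -- All coordinates outside `upper t` are resampled: `F` and `e` see only the old sample, the four
  -- variables of the layer only the new one.
  rw [lintegral_glue (T := A.upper t) (by
    have hF' : Measurable (fun p : (Coord → ℝ) × (ℝ × ℝ × ℝ × ℝ) => F p.1 p.2) := hF
    exact hF'.comp (measurable_id.prodMk (by fun_prop)))]
  refine lintegral_congr fun ω => ?_
  have hFω : Measurable (F ω) := hF.comp (measurable_const.prodMk measurable_id)
  let f : ℕ × ℤ → Coord := fun x => .bwd (A.depth - t) x.1 i x.2
  have hf : Function.Injective f := by
    intro x y h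
    simp only [f, Coord.bwd.injEq] at h
    exact Prod.ext h.2.1 h.2.2.2
  have key := map_coords_sum_gaussian A.variance
    (Finset.range (A.width (A.depth - t)) ×ˢ A.ker) (e ω) hf
    (c₁ := .fwd (A.depth - (t + 1)) i j β) (c₂ := .pre (A.depth - (t + 1) - 1) j)
    (c₃ := .pre (A.depth - (t + 1)) i) (by simp) (by simp)
    -- Here `t + 1 < depth` keeps the layer below distinct from the layer itself under truncated
    -- subtraction.
    (by simp only [ne_eq, Coord.pre.injEq, not_and]; omega) (by simp [f]) (by simp [f])
    (by simp [f])
  have h2 := congrArg (fun m => ∫⁻ y, F ω y ∂m) key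
  simp only [f] at h2
  rw [lintegral_map hFω (by fun_prop), lintegral_map hFω (by fun_prop)] at h2
  simp only [coe_variance_fwd, coe_variance_bwd, A.coe_variance_pre hq] at h2
  rw [← h2]
  refine lintegral_congr fun ω' => ?_
  have hagree : ∀ c ∈ A.upper t, (fun c => if c ∈ A.upper t then ω c else ω' c) c = ω c :=
    fun c hc => by simp [hc]
  rw [hFd hagree, hed hagree]
  have n1 : ¬ (A.depth - t ≤ A.depth - (t + 1) - 1) := by omega
  have n2 : ¬ (A.depth - t ≤ A.depth - (t + 1)) := by omega
  simp [n1, n2]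

variable {A}

/-- Given the layers above, φ'(y) is independent of the backward sum, a centred Gaussian whose
variance is the sum of the squared pairings times the weight variance. The weight `w` makes this a
conditional statement; it is used with `w = 1` for moments and with the inverse of an upper `gradSq`
for ratios. -/
lemma lintegral_mul_paired_succ (hφ : PseudoLipschitz A.φ) (hq : 0 ≤ A.q) {t : ℕ}
    (ht : t + 1 < A.depth) (c : Fin A.batch.size → ZMod P → ℝ) (i : ℕ)
    {w : (Coord → ℝ) → ℝ≥0∞} (hw : Measurable w) (hwd : DependsOn w (A.upper t)) :
    ∫⁻ ω, w ω * ENNReal.ofReal (A.paired c (t + 1) i ω ^ 2) ∂A.law =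
      ENNReal.ofReal ((A.σw ^ 2 * ∫ z, deriv A.φ (√A.q * z) ^ 2 ∂stdNormal) /
          (A.width (A.depth - (t + 1)) * (2 * A.k + 1))) *
        ∑ x ∈ Finset.range (A.width (A.depth - t)) ×ˢ A.ker,
          ∫⁻ ω, w ω * ENNReal.ofReal (A.paired (shift c x.2) t x.1 ω ^ 2) ∂A.law := by
  have hdm := measurable_deriv A.φ
  set S := Finset.range (A.width (A.depth - t)) ×ˢ A.ker with hS
  set v := A.σw ^ 2 / (A.width (A.depth - t - 1) * (2 * A.k + 1) : ℝ) with hv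
  have hv0 : 0 ≤ v := by positivity
  have hint : Integrable (fun z => deriv A.φ (√A.q * z) ^ 2) stdNormal :=
    ((hφ.polyGrowth_deriv.comp_mul (√A.q)).pow 2).integrable (by fun_prop)
  -- The forward weight and the activation do not enter, so their indices 0 are arbitrary.
  have hlay := A.lintegral_layer hq ht i 0 0
    (F := fun ω y => w ω * ENNReal.ofReal ((deriv A.φ y.2.2.1 * y.2.2.2) ^ 2))
    (by unfold Function.uncurry; fun_prop)
    (fun ω ω' h => by simp only [hwd h])
    (e := fun ω x => A.paired (shift c x.2) t x.1 ω) (by fun_prop)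
    (fun ω ω' h => funext fun x => A.dependsOn_paired _ (by omega) _ h)
  simp only [paired_succ]
  rw [hlay, ← hS, ← hv]
  have hin : ∀ ω, ∫⁻ z, w ω * ENNReal.ofReal ((deriv A.φ (√A.q * z.2.2.1) *
      (√(∑ x ∈ S, A.paired (shift c x.2) t x.1 ω ^ 2 * v) * z.2.2.2)) ^ 2) ∂stdNormalFour =
      ENNReal.ofReal (v * ∫ z, deriv A.φ (√A.q * z) ^ 2 ∂stdNormal) *
        ∑ x ∈ S, w ω * ENNReal.ofReal (A.paired (shift c x.2) t x.1 ω ^ 2) := by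
    intro ω
    have h4 := lintegral_stdNormalFour_mul (f₁ := 1) (f₂ := 1)
      (f₃ := fun z => ENNReal.ofReal (deriv A.φ (√A.q * z) ^ 2))
      (f₄ := fun z => ENNReal.ofReal (z ^ 2)) measurable_one measurable_one
      (by fun_prop) (by fun_prop)
    rw [lintegral_sq_stdNormal, ← ofReal_integral_eq_lintegral_ofReal hint
      (ae_of_all _ fun z => sq_nonneg _)] at h4
    simp only [Pi.one_apply, one_mul, lintegral_one, measure_univ, mul_one] at h4
    have hV : 0 ≤ ∑ x ∈ S, A.paired (shift c x.2) t x.1 ω ^ 2 * v :=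
      Finset.sum_nonneg fun x _ => by positivity
    have : ∀ z : ℝ × ℝ × ℝ × ℝ, w ω * ENNReal.ofReal ((deriv A.φ (√A.q * z.2.2.1) *
        (√(∑ x ∈ S, A.paired (shift c x.2) t x.1 ω ^ 2 * v) * z.2.2.2)) ^ 2) =
        w ω * ENNReal.ofReal (∑ x ∈ S, A.paired (shift c x.2) t x.1 ω ^ 2 * v) *
          (ENNReal.ofReal (deriv A.φ (√A.q * z.2.2.1) ^ 2) * ENNReal.ofReal (z.2.2.2 ^ 2)) := by
      intro z
      rw [mul_assoc, ← ENNReal.ofReal_mul (sq_nonneg _), ← ENNReal.ofReal_mul hV]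
      congr 2
      rw [mul_pow, mul_pow, Real.sq_sqrt hV]
      ring
    simp only [this]
    rw [lintegral_const_mul _ (by fun_prop), h4, ← Finset.sum_mul, mul_comm _ v,
      ENNReal.ofReal_mul hv0, ENNReal.ofReal_mul hv0,
      ENNReal.ofReal_sum_of_nonneg fun x _ => sq_nonneg _, ← Finset.mul_sum]
    ring
  simp only [hin]
  rw [lintegral_const_mul _ (by fun_prop), lintegral_finsetSum _ (by fun_prop)]
  congr 2
  rw [hv, show A.depth - t - 1 = A.depth - (t + 1) by omega]
  ring

variable (A) in
/-- The squared norm of the total gradient (over samples and positions) in layer `depth - t`. -/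
def gradSq (t : ℕ) (ω : Coord → ℝ) : ℝ :=
  ∑ i ∈ Finset.range (A.width (A.depth - t)), A.paired (fun _ _ => 1) t i ω ^ 2

variable (A) in
lemma gradSq_nonneg (t : ℕ) (ω : Coord → ℝ) : 0 ≤ A.gradSq t ω :=
  Finset.sum_nonneg fun _ _ => sq_nonneg _

variable (A) in
@[fun_prop]
lemma measurable_gradSq (t : ℕ) : Measurable (A.gradSq t) := by
  unfold gradSq
  fun_prop

lemma dependsOn_gradSq {t : ℕ} (ht : t ≤ A.depth) : DependsOn (A.gradSq t) (A.upper t) :=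
  fun _ _ h => Finset.sum_congr rfl fun i _ => by rw [A.dependsOn_paired _ ht i h]

variable (A) in
lemma card_ker : (A.ker.card : ℝ) = 2 * A.k + 1 := by
  have : A.ker.card = 2 * A.k + 1 := by
    rw [ker, Int.card_Icc]
    omega
  rw [this]
  push_cast
  ring

/-- Constant coefficients are invariant under translation, so the 2k + 1 filter offsets contribute
equally and cancel the 2k + 1 in the weight variance. -/
lemma lintegral_mul_paired_one_succ (hφ : PseudoLipschitz A.φ) (hq : 0 ≤ A.q) {t : ℕ}
    (ht : t + 1 < A.depth) (i : ℕ)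
    {w : (Coord → ℝ) → ℝ≥0∞} (hw : Measurable w) (hwd : DependsOn w (A.upper t)) :
    ∫⁻ ω, w ω * ENNReal.ofReal (A.paired (fun _ _ => 1) (t + 1) i ω ^ 2) ∂A.law =
      ENNReal.ofReal ((A.σw ^ 2 * ∫ z, deriv A.φ (√A.q * z) ^ 2 ∂stdNormal) /
          A.width (A.depth - (t + 1))) * ∫⁻ ω, w ω * ENNReal.ofReal (A.gradSq t ω) ∂A.law := by
  have hk : (0 : ℝ) < 2 * A.k + 1 := by positivity
  have hI : 0 ≤ ∫ z, deriv A.φ (√A.q * z) ^ 2 ∂stdNormal :=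
    integral_nonneg fun z => sq_nonneg _
  rw [lintegral_mul_paired_succ hφ hq ht _ i hw hwd]
  have hsh : ∀ β : ℤ, shift (fun (_ : Fin A.batch.size) (_ : ZMod P) => (1 : ℝ)) β =
      fun _ _ => 1 := fun β => rfl
  simp only [hsh]
  rw [Finset.sum_product]
  simp only [Finset.sum_const, nsmul_eq_mul]
  rw [← Finset.mul_sum, ← mul_assoc]
  congr 1
  · rw [← ENNReal.ofReal_natCast, ← ENNReal.ofReal_mul (by positivity), card_ker]
    congr 1
    field_simp
  · rw [← lintegral_finsetSum _ (by fun_prop)]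
    refine lintegral_congr fun ω => ?_
    rw [gradSq, ENNReal.ofReal_sum_of_nonneg fun x _ => sq_nonneg _, Finset.mul_sum]

/-- Summing over the channels of the layer cancels the remaining width, and the factor is exactly χ.
-/
lemma lintegral_mul_gradSq_succ (hφ : PseudoLipschitz A.φ) (hq : 0 ≤ A.q) {t : ℕ}
    (ht : t + 1 < A.depth) (hwidth : 1 ≤ A.width (A.depth - (t + 1)))
    {w : (Coord → ℝ) → ℝ≥0∞} (hw : Measurable w) (hwd : DependsOn w (A.upper t)) :
    ∫⁻ ω, w ω * ENNReal.ofReal (A.gradSq (t + 1) ω) ∂A.law =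
      ENNReal.ofReal (A.σw ^ 2 * ∫ z, deriv A.φ (√A.q * z) ^ 2 ∂stdNormal) *
        ∫⁻ ω, w ω * ENNReal.ofReal (A.gradSq t ω) ∂A.law := by
  have hI : 0 ≤ ∫ z, deriv A.φ (√A.q * z) ^ 2 ∂stdNormal :=
    integral_nonneg fun z => sq_nonneg _
  have h : ∀ ω, w ω * ENNReal.ofReal (A.gradSq (t + 1) ω) =
      ∑ i ∈ Finset.range (A.width (A.depth - (t + 1))),
        w ω * ENNReal.ofReal (A.paired (fun _ _ => 1) (t + 1) i ω ^ 2) := fun ω => by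
    rw [gradSq, ENNReal.ofReal_sum_of_nonneg fun x _ => sq_nonneg _, Finset.mul_sum]
  simp only [h]
  rw [lintegral_finsetSum _ (by fun_prop)]
  simp only [lintegral_mul_paired_one_succ hφ hq ht _ hw hwd]
  rw [Finset.sum_const, Finset.card_range, nsmul_eq_mul, ← mul_assoc]
  congr 1
  rw [← ENNReal.ofReal_natCast, ← ENNReal.ofReal_mul (by positivity)]
  congr 1
  have : (0 : ℝ) < A.width (A.depth - (t + 1)) := by exact_mod_cast hwidth
  field_simp

lemma lintegral_mul_gradSq_add (hφ : PseudoLipschitz A.φ) (hq : 0 ≤ A.q) {t : ℕ} (d : ℕ)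
    (ht : t + d < A.depth) (hwidth : ∀ l, 1 ≤ l → l < A.depth → 1 ≤ A.width l)
    {w : (Coord → ℝ) → ℝ≥0∞} (hw : Measurable w) (hwd : DependsOn w (A.upper t)) :
    ∫⁻ ω, w ω * ENNReal.ofReal (A.gradSq (t + d) ω) ∂A.law =
      ENNReal.ofReal (A.σw ^ 2 * ∫ z, deriv A.φ (√A.q * z) ^ 2 ∂stdNormal) ^ d *
        ∫⁻ ω, w ω * ENNReal.ofReal (A.gradSq t ω) ∂A.law := by
  induction d with
  | zero => simp
  | succ d ih =>
    rw [← add_assoc, lintegral_mul_gradSq_succ hφ hq (by omega)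
      (hwidth _ (by omega) (by omega)) hw
      (fun _ _ h => hwd fun c hc => h c (A.upper_mono (by omega) hc)), ih (by omega), pow_succ]
    ring

/-- From layer 2 on the incoming activation is the same for all samples and positions and factors
out of the sum. Only the total gradient remains, whereas in layer 1 the input itself supplies the
coefficients. -/
lemma weightGrad_of_two_le {l : ℕ} (hl : 2 ≤ l) (ω : Coord → ℝ) (w : ℕ × ℕ × ℤ) :
    A.weightGrad ω l w = (A.batch.size : ℝ)⁻¹ *
      (A.φ (ω (.pre (l - 1) w.2.1)) * A.paired (fun _ _ => 1) (A.depth - l) w.1 ω) := by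
  obtain ⟨m, rfl⟩ : ∃ m, l = m + 2 := ⟨l - 2, by omega⟩
  simp only [weightGrad, paired, mul_one, show m + 2 - 1 = m + 1 from rfl, activation]
  rw [mul_comm (A.φ _), Finset.sum_mul]
  simp only [Finset.sum_mul]

lemma weightGrad_one (ω : Coord → ℝ) (w : ℕ × ℕ × ℤ) :
    A.weightGrad ω 1 w = (A.batch.size : ℝ)⁻¹ *
      A.paired (fun s α => if h : w.2.1 < A.batch.inp then
        A.batch.input s ⟨w.2.1, h⟩ (α + (w.2.2 : ZMod P)) else 0) (A.depth - 1) w.1 ω := rfl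

lemma measurable_activation (hφ : Measurable A.φ) (s : Fin A.batch.size) (l j : ℕ)
    (α : ZMod P) : Measurable fun ω => A.activation ω s l j α := by
  cases l with
  | zero => exact measurable_const
  | succ l =>
    simp only [activation]
    fun_prop

lemma measurable_score (hφ : Measurable A.φ) (l : ℕ) (w : ℕ × ℕ × ℤ) :
    Measurable fun ω => A.score ω l w := by
  have h1 := fun s t i α => A.measurable_delta s t i α
  have h2 := fun s l j α => measurable_activation hφ s l j α
  unfold score weightGrad
  fun_prop

end Net

/-! ### A symmetric random walk on ℤ / P -/

section CyclicWalk

variable {P : ℕ} [NeZero P] (k : ℕ)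

/-- One step of the walk on `ℤ / P` with uniform increments in `[-k, k]`. -/
def cyclicAvg (f : ZMod P → ℝ) (γ : ZMod P) : ℝ :=
  (2 * (k : ℝ) + 1)⁻¹ * ∑ β ∈ Finset.Icc (-(k : ℤ)) k, f (γ + (β : ZMod P))

/-- The increments are symmetric under β ↦ -β, so the averaging operator is self-adjoint. -/
lemma sum_cyclicAvg_mul (f g : ZMod P → ℝ) :
    ∑ γ, cyclicAvg k f γ * g γ = ∑ γ, f γ * cyclicAvg k g γ := by
  simp only [cyclicAvg, Finset.mul_sum, Finset.sum_mul]
  rw [Finset.sum_comm, Finset.sum_comm (s := Finset.univ)]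
  refine Finset.sum_nbij' (fun β => -β) (fun β => -β) (by simp; omega) (by simp; omega)
    (by simp) (by simp) fun β _ => ?_
  refine Finset.sum_nbij' (fun γ => γ + (β : ZMod P)) (fun γ => γ - (β : ZMod P))
    (by simp) (by simp) (by simp) (by simp) fun γ _ => ?_
  push_cast
  rw [add_neg_cancel_right]
  ring

lemma sum_cyclicAvg_iterate_mul (f g : ZMod P → ℝ) (n : ℕ) :
    ∑ γ, (cyclicAvg k)^[n] f γ * g γ = ∑ γ, f γ * (cyclicAvg k)^[n] g γ := by
  induction n generalizing f with
  | zero => rfl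
  | succ n ih =>
    rw [Function.iterate_succ_apply, ih, sum_cyclicAvg_mul, Function.iterate_succ_apply']

lemma cyclicAvg_iterate_nonneg {f : ZMod P → ℝ} (hf : ∀ γ, 0 ≤ f γ) (n : ℕ) (γ : ZMod P) :
    0 ≤ (cyclicAvg k)^[n] f γ := by
  induction n generalizing γ with
  | zero => exact hf γ
  | succ n ih =>
    rw [Function.iterate_succ_apply', cyclicAvg]
    exact mul_nonneg (by positivity) (Finset.sum_nonneg fun β _ => ih _)

lemma cyclicAvg_iterate_one (n : ℕ) :
    (cyclicAvg k)^[n] (fun _ : ZMod P => (1 : ℝ)) = fun _ => 1 := by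
  induction n with
  | zero => rfl
  | succ n ih =>
    rw [Function.iterate_succ_apply, ← ih]
    congr 1
    funext γ
    rw [ih, cyclicAvg, Finset.sum_const, Int.card_Icc]
    have : ((k : ℤ) + 1 - -(k : ℤ)).toNat = 2 * k + 1 := by omega
    rw [this, nsmul_eq_mul]
    push_cast
    field_simp

lemma sum_cyclicAvg_iterate (f : ZMod P → ℝ) (n : ℕ) :
    ∑ γ, (cyclicAvg k)^[n] f γ = ∑ γ, f γ := by
  have := sum_cyclicAvg_iterate_mul k f (fun _ => 1) n
  simpa [cyclicAvg_iterate_one] using this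

lemma cyclicAvg_iterate_le {f : ZMod P → ℝ} (hf : ∀ γ, 0 ≤ f γ) (n : ℕ) (γ : ZMod P) :
    (cyclicAvg k)^[n] f γ ≤ ∑ γ', f γ' := by
  rw [← sum_cyclicAvg_iterate k f n]
  exact Finset.single_le_sum (f := (cyclicAvg k)^[n] f)
    (fun γ' _ => cyclicAvg_iterate_nonneg k hf n γ') (Finset.mem_univ γ)

/-- By self-adjointness the return probability after 2m steps is the sum of squares of the m-step
distribution, which by Cauchy–Schwarz is at least 1 / P. -/
lemma le_cyclicAvg_iterate_even {f : ZMod P → ℝ} (hf : ∀ γ, 0 ≤ f γ) (m : ℕ) :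
    f 0 / P ≤ (cyclicAvg k)^[m + m] f 0 := by
  let δ : ZMod P → ℝ := Pi.single 0 1
  have hδ : ∀ γ, 0 ≤ δ γ := fun γ => by
    simp only [δ, Pi.single_apply]
    split_ifs <;> norm_num
  have hP : (0 : ℝ) < P := by exact_mod_cast Nat.pos_of_ne_zero (NeZero.ne P)
  have hpick : ∀ g : ZMod P → ℝ, ∑ γ, g γ * δ γ = g 0 := fun g => by simp [δ, Pi.single_apply]
  have h1 : ∑ γ, f γ * (cyclicAvg k)^[m + m] δ γ = (cyclicAvg k)^[m + m] f 0 := by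
    rw [← sum_cyclicAvg_iterate_mul, hpick]
  have h2 : (cyclicAvg k)^[m + m] δ 0 = ∑ γ, (cyclicAvg k)^[m] δ γ ^ 2 := by
    rw [← hpick ((cyclicAvg k)^[m + m] δ), Function.iterate_add_apply, sum_cyclicAvg_iterate_mul]
    simp only [sq]
  have h3 : 1 / (P : ℝ) ≤ ∑ γ, (cyclicAvg k)^[m] δ γ ^ 2 := by
    have h := sq_sum_le_card_mul_sum_sq (s := Finset.univ) (f := (cyclicAvg k)^[m] δ)
    rw [sum_cyclicAvg_iterate, Finset.card_univ, ZMod.card] at h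
    have h4 : ∑ γ, δ γ = 1 := by simp [δ]
    rw [h4, one_pow] at h
    rw [div_le_iff₀ hP, mul_comm]
    exact h
  rw [← h1]
  refine le_trans ?_ (Finset.single_le_sum (f := fun γ => f γ * (cyclicAvg k)^[m + m] δ γ)
    (fun γ _ => mul_nonneg (hf γ) (cyclicAvg_iterate_nonneg k hδ _ γ)) (Finset.mem_univ 0))
  rw [h2, div_eq_mul_one_div]
  exact mul_le_mul_of_nonneg_left h3 (hf 0)

/-- The walk returns to its starting point with a probability that is bounded below. -/
lemma le_cyclicAvg_iterate {f : ZMod P → ℝ} (hf : ∀ γ, 0 ≤ f γ) (n : ℕ) :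
    f 0 / (P * (2 * k + 1)) ≤ (cyclicAvg k)^[n] f 0 := by
  have hP : (0 : ℝ) < P := by exact_mod_cast Nat.pos_of_ne_zero (NeZero.ne P)
  have hk : (1 : ℝ) ≤ 2 * k + 1 := by linarith [(Nat.cast_nonneg k : (0 : ℝ) ≤ k)]
  rw [← div_div]
  rcases Nat.even_or_odd n with ⟨m, rfl⟩ | ⟨m, rfl⟩
  · exact (div_le_self (div_nonneg (hf 0) hP.le) hk).trans (le_cyclicAvg_iterate_even k hf m)
  -- For an odd number of steps, keep only the increment β = 0 of one step, at the cost of a factor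
  -- 2k + 1.
  · rw [show 2 * m + 1 = (m + m).succ by omega, Function.iterate_succ_apply', cyclicAvg, div_eq_inv_mul]
    refine mul_le_mul_of_nonneg_left ((le_cyclicAvg_iterate_even k hf m).trans ?_) (by positivity)
    have := Finset.single_le_sum (s := Finset.Icc (-(k : ℤ)) k)
      (f := fun β : ℤ => (cyclicAvg k)^[m + m] f (0 + (β : ZMod P)))
      (fun β _ => cyclicAvg_iterate_nonneg k hf _ _) (a := 0) (by simp)
    simpa using this

end CyclicWalk

/-- The second moment of the gradient at output channel `i` paired with the coefficients `c`. -/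
def Batch.pairing {P : ℕ} [NeZero P] (T : Batch P) (q : ℝ) (c : Fin T.size → ZMod P → ℝ) (i : ℕ) :
    ℝ≥0∞ :=
  ∫⁻ y, ENNReal.ofReal ((∑ s, ∑ α, (if h : i < T.out then T.outGrad y s ⟨i, h⟩ α else 0) *
    c s α) ^ 2) ∂T.outLaw q

lemma Batch.pairing_ne_top {P : ℕ} [NeZero P] {T : Batch P} {q : ℝ} (hT : T.Regular q)
    (c : Fin T.size → ZMod P → ℝ) (i : ℕ) : T.pairing q c i ≠ ⊤ := by
  have h1 : MemLp (fun y => ∑ s, ∑ α,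
      (if h : i < T.out then T.outGrad y s ⟨i, h⟩ α else 0) * c s α) 2 (T.outLaw q) := by
    refine memLp_finsetSum _ fun s _ => memLp_finsetSum _ fun α _ => ?_
    split_ifs with h
    · simpa only [mul_comm] using (hT.2 s ⟨i, h⟩ α).const_mul (c s α)
    · simp
  have h2 := h1.integrable_sq
  exact (Integrable.lintegral_lt_top h2).ne

lemma Batch.pairing_pos {P : ℕ} [NeZero P] {T : Batch P} {q : ℝ}
    {c : Fin T.size → ZMod P → ℝ} {i : ℕ} (hi : i < T.out)
    (h : ¬ ∀ᵐ y ∂T.outLaw q, ∑ s, ∑ α, T.outGrad y s ⟨i, hi⟩ α * c s α = 0) :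
    0 < T.pairing q c i := by
  have hm : Measurable fun y => ∑ s, ∑ α, T.outGrad y s ⟨i, hi⟩ α * c s α := by
    have := fun s α => T.measurable_outGrad s ⟨i, hi⟩ α
    fun_prop
  rw [pos_iff_ne_zero]
  intro h0
  simp only [Batch.pairing, hi, dif_pos] at h0
  rw [lintegral_eq_zero_iff (by fun_prop)] at h0
  refine h ?_
  filter_upwards [h0] with y hy
  have : (∑ s, ∑ α, T.outGrad y s ⟨i, hi⟩ α * c s α) ^ 2 ≤ 0 := by
    simpa [-sq_nonpos_iff] using hy
  nlinarith [sq_nonneg (∑ s, ∑ α, T.outGrad y s ⟨i, hi⟩ α * c s α)]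

/-! ### Second moments of the scores -/

namespace Net

variable {P : ℕ} [NeZero P] {A : Net P}

lemma lintegral_eval {f : ℝ → ℝ≥0∞} (hf : Measurable f) (c : Coord) :
    ∫⁻ ω, f (ω c) ∂A.law = ∫⁻ z, f (√(A.variance c : ℝ) * z) ∂stdNormal := by
  have h : A.law.map (fun ω => ω c) = gaussianReal 0 (A.variance c) :=
    Measure.infinitePi_map_eval _ c
  rw [← lintegral_map hf (measurable_pi_apply c), h, gaussianReal_eq_map_stdNormal,
    lintegral_map hf (by fun_prop)]

variable (A) in
lemma map_output : A.law.map (fun ω (i : Fin A.batch.out) => ω (.pre A.depth i)) =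
    A.batch.outLaw A.q := by
  have h : iIndepFun (fun (c : Coord) (ω : Coord → ℝ) => ω c) A.law :=
    iIndepFun_infinitePi (X := fun _ x => x) (by fun_prop)
  have hinj : Function.Injective fun i : Fin A.batch.out => Coord.pre A.depth i := by
    intro i j hij
    simpa [Fin.ext_iff] using hij
  have h2 := h.precomp hinj
  rw [iIndepFun_iff_map_fun_eq_pi_map (fun i => (measurable_pi_apply _).aemeasurable)] at h2
  refine h2.trans ?_
  unfold Batch.outLaw
  congr 1
  funext i
  exact Measure.infinitePi_map_eval _ _

lemma lintegral_paired_zero (c : Fin A.batch.size → ZMod P → ℝ) (i : ℕ) :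
    ∫⁻ ω, ENNReal.ofReal (A.paired c 0 i ω ^ 2) ∂A.law = A.batch.pairing A.q c i := by
  rw [Batch.pairing, ← map_output, lintegral_map _ (by fun_prop)]
  · rfl
  · have : ∀ s α, Measurable fun y =>
        (if h : i < A.batch.out then A.batch.outGrad y s ⟨i, h⟩ α else 0) := by
      intro s α
      split_ifs with h
      · exact A.batch.measurable_outGrad s ⟨i, h⟩ α
      · exact measurable_const
    fun_prop

/-- Back-propagation uses copies of the weights, so the gradient does not involve the forward weight
and the second moment factors. -/
lemma lintegral_score_sq {l : ℕ} {w : ℕ × ℕ × ℤ} {g : (Coord → ℝ) → ℝ} (hg : Measurable g)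
    (hgd : DependsOn g {.fwd l w.1 w.2.1 w.2.2}ᶜ) (hwg : ∀ ω, A.weightGrad ω l w = g ω) :
    ∫⁻ ω, ENNReal.ofReal (A.score ω l w ^ 2) ∂A.law =
      ENNReal.ofReal (A.σw ^ 2 / (A.width (l - 1) * (2 * A.k + 1))) *
        ∫⁻ ω, ENNReal.ofReal (g ω ^ 2) ∂A.law := by
  have h : ∀ ω, ENNReal.ofReal (A.score ω l w ^ 2) =
      ENNReal.ofReal (ω (.fwd l w.1 w.2.1 w.2.2) ^ 2) * ENNReal.ofReal (g ω ^ 2) := fun ω => by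
    rw [score, sq_abs, hwg, mul_pow, ENNReal.ofReal_mul (sq_nonneg _)]
  simp only [h]
  unfold law
  rw [lintegral_mul_of_dependsOn (T := {.fwd l w.1 w.2.1 w.2.2}) (by fun_prop) (by fun_prop)
    (fun ω ω' h => by simp only [h _ rfl]) (fun ω ω' h => by simp only [hgd h])]
  congr 1
  rw [← law, lintegral_eval (f := fun x => ENNReal.ofReal (x ^ 2)) (by fun_prop),
    coe_variance_fwd]
  simp only [mul_pow]
  have hv : 0 ≤ A.σw ^ 2 / (A.width (l - 1) * (2 * A.k + 1) : ℝ) := by positivity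
  simp only [Real.sq_sqrt hv, ENNReal.ofReal_mul hv]
  rw [lintegral_const_mul _ (by fun_prop), lintegral_sq_stdNormal, mul_one]

/-- The pairing uses pre-activations of layers at least `l` only, so the activation from layer `l -
1` is independent of it and splits off as well. -/
lemma lintegral_score_sq_of_two_le (hφ : PseudoLipschitz A.φ) (hq : 0 ≤ A.q) {l : ℕ}
    (hl : 2 ≤ l) (hlL : l ≤ A.depth) (w : ℕ × ℕ × ℤ) :
    ∫⁻ ω, ENNReal.ofReal (A.score ω l w ^ 2) ∂A.law =
      ENNReal.ofReal (A.σw ^ 2 / (A.width (l - 1) * (2 * A.k + 1)) *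
        ((A.batch.size : ℝ)⁻¹ ^ 2 * ∫ z, A.φ (√A.q * z) ^ 2 ∂stdNormal)) *
        ∫⁻ ω, ENNReal.ofReal (A.paired (fun _ _ => 1) (A.depth - l) w.1 ω ^ 2) ∂A.law := by
  have hcont := hφ.continuous
  have hdep := A.dependsOn_paired (fun _ _ => 1) (Nat.sub_le A.depth l) w.1
  rw [lintegral_score_sq (g := fun ω => (A.batch.size : ℝ)⁻¹ *
      (A.φ (ω (.pre (l - 1) w.2.1)) * A.paired (fun _ _ => 1) (A.depth - l) w.1 ω))
    (by have := hcont.measurable; fun_prop) ?_ (fun ω => weightGrad_of_two_le hl ω w)]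
  · rw [ENNReal.ofReal_mul (by positivity), mul_assoc]
    congr 1
    have h : ∀ ω, ENNReal.ofReal (((A.batch.size : ℝ)⁻¹ * (A.φ (ω (.pre (l - 1) w.2.1)) *
        A.paired (fun _ _ => 1) (A.depth - l) w.1 ω)) ^ 2) =
        ENNReal.ofReal ((A.batch.size : ℝ)⁻¹ ^ 2) *
          (ENNReal.ofReal (A.φ (ω (.pre (l - 1) w.2.1)) ^ 2) *
          ENNReal.ofReal (A.paired (fun _ _ => 1) (A.depth - l) w.1 ω ^ 2)) := fun ω => by
      rw [← ENNReal.ofReal_mul (sq_nonneg _), ← ENNReal.ofReal_mul (sq_nonneg _)]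
      congr 1
      ring
    simp only [h]
    have hm := hcont.measurable
    rw [lintegral_const_mul _ (by fun_prop), ENNReal.ofReal_mul (sq_nonneg _), mul_assoc]
    congr 1
    unfold law
    rw [lintegral_mul_of_dependsOn (T := {.pre (l - 1) w.2.1}) (by fun_prop) (by fun_prop)
      (fun ω ω' h => by simp only [h _ rfl]) ?_]
    · congr 1
      rw [← law, lintegral_eval (f := fun x => ENNReal.ofReal (A.φ x ^ 2)) (by fun_prop),
        A.coe_variance_pre hq, ofReal_integral_eq_lintegral_ofReal
        (((hφ.polyGrowth.comp_mul (√A.q)).pow 2).integrable (by fun_prop))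
        (ae_of_all _ fun z => sq_nonneg _)]
    · intro ω ω' h
      simp only [hdep fun c hc => h c (by
        rintro rfl
        rw [pre_mem_upper] at hc
        omega)]
  · intro ω ω' h
    simp only [h (.pre (l - 1) w.2.1) (by simp), hdep fun c hc => h c (by
      rintro rfl
      simp at hc)]

lemma lintegral_score_sq_one (w : ℕ × ℕ × ℤ) :
    ∫⁻ ω, ENNReal.ofReal (A.score ω 1 w ^ 2) ∂A.law =
      ENNReal.ofReal (A.σw ^ 2 / (A.width 0 * (2 * A.k + 1)) * (A.batch.size : ℝ)⁻¹ ^ 2) *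
        ∫⁻ ω, ENNReal.ofReal (A.paired (fun s α => if h : w.2.1 < A.batch.inp then
        A.batch.input s ⟨w.2.1, h⟩ (α + (w.2.2 : ZMod P)) else 0) (A.depth - 1) w.1 ω ^ 2)
          ∂A.law := by
  set c : Fin A.batch.size → ZMod P → ℝ := fun s α => if h : w.2.1 < A.batch.inp then
        A.batch.input s ⟨w.2.1, h⟩ (α + (w.2.2 : ZMod P)) else 0
  have hdep := A.dependsOn_paired c (Nat.sub_le A.depth 1) w.1
  rw [lintegral_score_sq (g := fun ω => (A.batch.size : ℝ)⁻¹ * A.paired c (A.depth - 1) w.1 ω)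
    (by fun_prop) ?_ (fun ω => weightGrad_one ω w)]
  · simp only [mul_pow]
    have h0 : 0 ≤ (A.batch.size : ℝ)⁻¹ ^ 2 := sq_nonneg _
    simp only [ENNReal.ofReal_mul h0]
    rw [lintegral_const_mul _ (by fun_prop), ENNReal.ofReal_mul (by positivity), mul_assoc]
  · intro ω ω' h
    simp only [hdep fun c hc => h c (by
      rintro rfl
      simp at hc)]

lemma secondMoment_eq (hφ : Measurable A.φ) (l : ℕ) :
    A.secondMoment l = (∫⁻ ω, ENNReal.ofReal (A.score ω l (0, 0, -(A.k : ℤ)) ^ 2) ∂A.law).toReal :=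
  integral_eq_lintegral_of_nonneg_ae (ae_of_all _ fun _ => sq_nonneg _)
    ((measurable_score hφ l _).pow_const 2).aestronglyMeasurable

lemma sum_lintegral_paired_succ (hφ : PseudoLipschitz A.φ) (hq : 0 ≤ A.q) {t : ℕ}
    (ht : t + 1 < A.depth) (c : Fin A.batch.size → ZMod P → ℝ) (i : ℕ) :
    ∫⁻ ω, ENNReal.ofReal (A.paired c (t + 1) i ω ^ 2) ∂A.law =
      ENNReal.ofReal ((A.σw ^ 2 * ∫ z, deriv A.φ (√A.q * z) ^ 2 ∂stdNormal) /
          A.width (A.depth - (t + 1))) *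
        (ENNReal.ofReal (2 * A.k + 1)⁻¹ * ∑ β ∈ A.ker,
          ∑ j ∈ Finset.range (A.width (A.depth - t)),
            ∫⁻ ω, ENNReal.ofReal (A.paired (shift c β) t j ω ^ 2) ∂A.law) := by
  have hI : 0 ≤ ∫ z, deriv A.φ (√A.q * z) ^ 2 ∂stdNormal :=
    integral_nonneg fun z => sq_nonneg _
  have h := lintegral_mul_paired_succ hφ hq ht c i (w := 1) measurable_one
    (fun _ _ _ => rfl)
  simp only [Pi.one_apply, one_mul] at h
  rw [h, Finset.sum_product_right, ← mul_assoc, ← ENNReal.ofReal_mul (by positivity)]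
  congr 2
  rw [← div_div, div_eq_mul_inv]

/-- On the Edge of Chaos the second moments perform a random walk in the shift of the
coefficients. -/
lemma sum_lintegral_paired_eq (hφ : PseudoLipschitz A.φ) (hq : 0 ≤ A.q)
    (hone : A.σw ^ 2 * ∫ z, deriv A.φ (√A.q * z) ^ 2 ∂stdNormal = 1)
    (hT : A.batch.Regular A.q) (hwidth : ∀ l ≤ A.depth, 1 ≤ A.width l)
    (c : Fin A.batch.size → ZMod P → ℝ) {t : ℕ} (ht : t < A.depth) (γ : ZMod P) :
    ∑ j ∈ Finset.range (A.width (A.depth - t)),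
        ∫⁻ ω, ENNReal.ofReal (A.paired (fun s α => c s (α + γ)) t j ω ^ 2) ∂A.law =
      ENNReal.ofReal ((cyclicAvg A.k)^[t] (fun γ' => (∑ j ∈ Finset.range (A.width A.depth),
        A.batch.pairing A.q (fun s α => c s (α + γ')) j).toReal) γ) := by
  induction t generalizing γ with
  | zero =>
    simp only [lintegral_paired_zero, Nat.sub_zero, Function.iterate_zero, id]
    rw [ENNReal.ofReal_toReal]
    exact ENNReal.sum_ne_top.2 fun j _ => Batch.pairing_ne_top hT _ _
  | succ t ih =>
    have hw : (1 : ℝ) ≤ A.width (A.depth - (t + 1)) := by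
      exact_mod_cast hwidth _ (Nat.sub_le _ _)
    simp only [sum_lintegral_paired_succ hφ hq ht, hone]
    rw [Finset.sum_const, Finset.card_range, nsmul_eq_mul, ← mul_assoc,
      ← ENNReal.ofReal_natCast, ← ENNReal.ofReal_mul (by positivity),
      mul_one_div_cancel (by positivity), ENNReal.ofReal_one, one_mul,
      Function.iterate_succ_apply', cyclicAvg, ENNReal.ofReal_mul (by positivity),
      ENNReal.ofReal_sum_of_nonneg fun β _ =>
        cyclicAvg_iterate_nonneg _ (fun _ => ENNReal.toReal_nonneg) _ _]
    congr 1
    refine Finset.sum_congr rfl fun β _ => ?_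
    rw [← ih (by omega)]
    refine Finset.sum_congr rfl fun j _ => ?_
    have : shift (fun s α => c s (α + γ)) β = fun s α => c s (α + (γ + (β : ZMod P))) := by
      funext s α
      simp only [shift]
      congr 1
      ring
    rw [this]

end Net

namespace Net

variable {P : ℕ} [NeZero P] {A : Net P}

lemma secondMoment_depth (hφ : PseudoLipschitz A.φ) (hq : 0 ≤ A.q) (hL : 2 ≤ A.depth) :
    A.secondMoment A.depth = A.σw ^ 2 / (A.width (A.depth - 1) * (2 * A.k + 1)) *
      ((A.batch.size : ℝ)⁻¹ ^ 2 * ∫ z, A.φ (√A.q * z) ^ 2 ∂stdNormal) *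
        (A.batch.pairing A.q (fun _ _ => 1) 0).toReal := by
  have hI : 0 ≤ ∫ z, A.φ (√A.q * z) ^ 2 ∂stdNormal := integral_nonneg fun z => sq_nonneg _
  rw [secondMoment_eq hφ.continuous.measurable, lintegral_score_sq_of_two_le hφ hq hL le_rfl,
    Nat.sub_self, lintegral_paired_zero, ENNReal.toReal_mul, ENNReal.toReal_ofReal (by positivity)]

/-- The weight sees only channel 0 of its layer. One step up spreads this to all channels, giving
the norm `gradSq`; the other steps multiply by χ, for a total of `depth - l` factors. -/
lemma secondMoment_of_lt (hφ : PseudoLipschitz A.φ) (hq : 0 ≤ A.q) (hT : A.batch.Regular A.q)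
    (hwidth : ∀ l ≤ A.depth, 1 ≤ A.width l) {l : ℕ} (hl : 2 ≤ l) (hlL : l < A.depth) :
    A.secondMoment l = A.σw ^ 2 / (A.width (l - 1) * (2 * A.k + 1)) *
      ((A.batch.size : ℝ)⁻¹ ^ 2 * ∫ z, A.φ (√A.q * z) ^ 2 ∂stdNormal) *
        ((A.σw ^ 2 * ∫ z, deriv A.φ (√A.q * z) ^ 2 ∂stdNormal) ^ (A.depth - l) / A.width l *
          ∑ j ∈ Finset.range (A.width A.depth),
            (A.batch.pairing A.q (fun _ _ => 1) j).toReal) := by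
  have hI : 0 ≤ ∫ z, A.φ (√A.q * z) ^ 2 ∂stdNormal := integral_nonneg fun z => sq_nonneg _
  have hI' : 0 ≤ ∫ z, deriv A.φ (√A.q * z) ^ 2 ∂stdNormal := integral_nonneg fun z => sq_nonneg _
  obtain ⟨t, ht⟩ : ∃ t, A.depth - l = t + 1 := ⟨A.depth - l - 1, by omega⟩
  rw [secondMoment_eq hφ.continuous.measurable, lintegral_score_sq_of_two_le hφ hq hl hlL.le, ht]
  have h1 := lintegral_mul_paired_one_succ hφ hq (t := t) (by omega) 0 (w := 1) measurable_one
    (fun _ _ _ => rfl)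
  have h2 := lintegral_mul_gradSq_add hφ hq (t := 0) t (by omega)
    (fun l _ h => hwidth l h.le) (w := 1) measurable_one (fun _ _ _ => rfl)
  simp only [Pi.one_apply, one_mul, zero_add] at h1 h2
  have h3 : ∫⁻ ω, ENNReal.ofReal (A.gradSq 0 ω) ∂A.law =
      ∑ j ∈ Finset.range (A.width A.depth), A.batch.pairing A.q (fun _ _ => 1) j := by
    simp only [gradSq, ENNReal.ofReal_sum_of_nonneg fun x _ => sq_nonneg _]
    rw [lintegral_finsetSum _ (by fun_prop)]
    simp only [lintegral_paired_zero, Nat.sub_zero]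
  rw [h1, h2, h3, ENNReal.toReal_mul, ENNReal.toReal_mul, ENNReal.toReal_mul, ENNReal.toReal_pow,
    ENNReal.toReal_sum fun j _ => Batch.pairing_ne_top hT _ _, ENNReal.toReal_ofReal (by positivity),
    ENNReal.toReal_ofReal (by positivity), ENNReal.toReal_ofReal (by positivity),
    show A.depth - (t + 1) = l by omega, pow_succ]
  ring

variable (A) in
/-- The input seen through the first weight of the first layer. -/
def firstInput (s : Fin A.batch.size) (α : ZMod P) : ℝ :=
  if h : 0 < A.batch.inp then A.batch.input s ⟨0, h⟩ (α + ((-(A.k : ℤ) : ℤ) : ZMod P)) else 0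

lemma secondMoment_one_of_depth_eq_one (hφ : PseudoLipschitz A.φ) (hL : A.depth = 1) :
    A.secondMoment 1 = A.σw ^ 2 / (A.width 0 * (2 * A.k + 1)) * (A.batch.size : ℝ)⁻¹ ^ 2 *
      (A.batch.pairing A.q A.firstInput 0).toReal := by
  rw [secondMoment_eq hφ.continuous.measurable, lintegral_score_sq_one, hL, Nat.sub_self,
    lintegral_paired_zero, ENNReal.toReal_mul, ENNReal.toReal_ofReal (by positivity)]
  rfl

lemma secondMoment_one_of_two_le (hφ : PseudoLipschitz A.φ) (hq : 0 ≤ A.q)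
    (hone : A.σw ^ 2 * ∫ z, deriv A.φ (√A.q * z) ^ 2 ∂stdNormal = 1)
    (hT : A.batch.Regular A.q) (hwidth : ∀ l ≤ A.depth, 1 ≤ A.width l) (hL : 2 ≤ A.depth) :
    A.secondMoment 1 = A.σw ^ 2 / (A.width 0 * (2 * A.k + 1)) * (A.batch.size : ℝ)⁻¹ ^ 2 *
      (1 / A.width 1 * (cyclicAvg A.k)^[A.depth - 1] (fun γ =>
        (∑ j ∈ Finset.range (A.width A.depth),
          A.batch.pairing A.q (fun s α => A.firstInput s (α + γ)) j).toReal) 0) := by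
  obtain ⟨t, ht⟩ : ∃ t, A.depth - 1 = t + 1 := ⟨A.depth - 2, by omega⟩
  rw [secondMoment_eq hφ.continuous.measurable, lintegral_score_sq_one, ht]
  change (_ * ∫⁻ ω, ENNReal.ofReal (A.paired A.firstInput (t + 1) 0 ω ^ 2) ∂A.law).toReal = _
  rw [sum_lintegral_paired_succ hφ hq (by omega), hone]
  have h := fun β : ℤ => sum_lintegral_paired_eq hφ hq hone hT hwidth A.firstInput (t := t)
    (by omega) (β : ZMod P)
  simp only [show ∀ β : ℤ, shift A.firstInput β = fun s α => A.firstInput s (α + (β : ZMod P))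
    from fun _ => rfl, h]
  have hnn : ∀ γ, 0 ≤ (cyclicAvg A.k)^[t] (fun γ =>
        (∑ j ∈ Finset.range (A.width A.depth),
          A.batch.pairing A.q (fun s α => A.firstInput s (α + γ)) j).toReal) γ :=
    cyclicAvg_iterate_nonneg _ (fun _ => ENNReal.toReal_nonneg) _
  rw [← ENNReal.ofReal_sum_of_nonneg fun β _ => hnn _, ← ENNReal.ofReal_mul (by positivity),
    ENNReal.toReal_mul, ENNReal.toReal_mul, ENNReal.toReal_ofReal (by positivity),
    ENNReal.toReal_ofReal (by positivity), ENNReal.toReal_ofReal (mul_nonneg (by positivity)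
      (Finset.sum_nonneg fun β _ => hnn _)), Function.iterate_succ_apply',
    show A.depth - (t + 1) = 1 by omega]
  congr 2
  rw [cyclicAvg]
  simp only [zero_add]
  rfl

end Net

/-! ### Conditioning of the second moments -/

lemma WellConditioned.of_bounds {m : ℕ → ℕ → ℝ} {a b : ℝ} (ha : 0 < a)
    (h : ∀ L : ℕ, 1 ≤ L → ∀ l ∈ Finset.Icc 1 L, a ≤ m L l ∧ m L l ≤ b) : WellConditioned m := by
  have hab : a ≤ b := (h 1 le_rfl 1 (by simp)).1.trans (h 1 le_rfl 1 (by simp)).2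
  have hb : 0 < b := ha.trans_le hab
  refine ⟨a / b, b / a, by positivity, by positivity, fun L hL l hl => ?_⟩
  have h1 := h L hL l hl
  have h2 := h L hL L (Finset.mem_Icc.2 ⟨hL, le_rfl⟩)
  have h3 : 0 < m L L := ha.trans_le h2.1
  exact ⟨div_le_div₀ (ha.le.trans h1.1) h1.1 h3 h2.2, div_le_div₀ hb.le h1.2 ha h2.1⟩

section Conditioning

variable {φ : ℝ → ℝ} {σb σw q : ℝ} {k P : ℕ} [NeZero P] {T : Batch P} {width : ℕ → ℕ → ℕ}
  {Nmax : ℕ}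

lemma illConditioned_of_chi_lt_one (hφ : PseudoLipschitz φ) (hσw : 0 < σw) (hq : 0 < q)
    (hT : T.Regular q) (hfirst : T.FirstNonzero q k)
    (hnet : ∀ L : ℕ, 1 ≤ L →
      (Net.mk φ σw q k L (width L) T).Fits ∧ ∀ l ≤ L, width L l ≤ Nmax)
    (hchi : chi φ σb σw q < 1) :
    IllConditioned fun L l => (Net.mk φ σw q k L (width L) T).secondMoment l := by
  rintro ⟨a, b, ha, -, h⟩
  rw [chi_eq hφ σb σw hq] at hchi
  set χ := σw ^ 2 * ∫ z, deriv φ (√q * z) ^ 2 ∂stdNormal with hχ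
  have hχ0 : 0 ≤ χ := mul_nonneg (sq_nonneg _) (integral_nonneg fun z => sq_nonneg _)
  set E := ∫ z, φ (√q * z) ^ 2 ∂stdNormal with hE
  obtain ⟨hi, ho, hne, -⟩ := hfirst
  set d := (T.pairing q (fun _ _ => 1) 0).toReal with hd
  have hd0 : 0 < d := ENNReal.toReal_pos
    (Batch.pairing_pos ho (by simpa only [mul_one] using hne)).ne' (Batch.pairing_ne_top hT _ _)
  set S := ∑ j ∈ Finset.range T.out, (T.pairing q (fun _ _ => 1) j).toReal with hS
  have hS0 : 0 ≤ S := Finset.sum_nonneg fun _ _ => ENNReal.toReal_nonneg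
  -- Layer 2 is compared with the last layer: both moments have the factor E[φ²] in common, unlike
  -- that of layer 1, and their ratio carries χ^(L - 2).
  have hkey : ∀ L : ℕ, 3 ≤ L → a * d ≤ χ ^ (L - 2) * (S * Nmax) := by
    intro L hL
    have h1 := (h L (by omega) 2 (Finset.mem_Icc.2 ⟨by omega, by omega⟩)).1
    obtain ⟨⟨-, hout, hw⟩, hN⟩ := hnet L (by omega)
    change width L L = T.out at hout
    change ∀ l ≤ L, 1 ≤ width L l at hw
    have e1 : (Net.mk φ σw q k L (width L) T).secondMoment L = σw ^ 2 /
        (width L (L - 1) * (2 * k + 1)) * ((T.size : ℝ)⁻¹ ^ 2 * E) * d :=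
      Net.secondMoment_depth (A := Net.mk φ σw q k L (width L) T) hφ hq.le (by simp; omega)
    have e2 : (Net.mk φ σw q k L (width L) T).secondMoment 2 = σw ^ 2 /
        (width L (2 - 1) * (2 * k + 1)) * ((T.size : ℝ)⁻¹ ^ 2 * E) *
        (χ ^ (L - 2) / width L 2 * ∑ j ∈ Finset.range (width L L),
          (T.pairing q (fun _ _ => 1) j).toReal) :=
      Net.secondMoment_of_lt (A := Net.mk φ σw q k L (width L) T) hφ hq.le hT hw le_rfl
        (by simp; omega)
    rw [hout, ← hS] at e2
    have n1 : (1 : ℝ) ≤ width L 1 := by exact_mod_cast hw 1 (by omega)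
    have n2 : (1 : ℝ) ≤ width L 2 := by exact_mod_cast hw 2 (by omega)
    have n3 : (1 : ℝ) ≤ width L (L - 1) := by exact_mod_cast hw (L - 1) (by omega)
    have n3' : (width L (L - 1) : ℝ) ≤ Nmax := by exact_mod_cast hN (L - 1) (by omega)
    have hE0 : 0 ≤ E := integral_nonneg fun z => sq_nonneg _
    have hG : 0 ≤ σw ^ 2 / (2 * k + 1) * ((T.size : ℝ)⁻¹ ^ 2 * E) := by positivity
    set G := σw ^ 2 / (2 * k + 1) * ((T.size : ℝ)⁻¹ ^ 2 * E) with hGdef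
    have e1' : (Net.mk φ σw q k L (width L) T).secondMoment L = G * (d / width L (L - 1)) := by
      rw [e1, hGdef]
      field_simp
    have e2' : (Net.mk φ σw q k L (width L) T).secondMoment 2 =
        G * (χ ^ (L - 2) * S / (width L 1 * width L 2)) := by
      rw [e2, hGdef]
      field_simp
    simp only [e1', e2'] at h1
    clear_value χ E S d G
    -- If the common factor vanishes, both moments are 0 and the ratio has the default value 0,
    -- which is below `a`.
    rcases hG.eq_or_lt with hG0 | hG0
    · rw [← hG0] at h1
      simp at h1
      linarith
    rw [mul_div_mul_left _ _ hG0.ne', le_div_iff₀ (by positivity), ← mul_div_assoc,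
      div_le_iff₀ (by positivity)] at h1
    refine h1.trans ?_
    rw [← mul_assoc]
    have hnum : 0 ≤ χ ^ (L - 2) * S := by positivity
    refine mul_le_mul (div_le_self hnum ?_) n3' (by positivity) hnum
    nlinarith
  have hlim : Tendsto (fun L : ℕ => χ ^ (L - 2) * (S * Nmax)) atTop (𝓝 (0 * (S * Nmax))) :=
    ((tendsto_pow_atTop_nhds_zero_of_lt_one hχ0 hchi).comp (tendsto_sub_atTop_nat 2)).mul_const _
  rw [zero_mul] at hlim
  have := ge_of_tendsto hlim (eventually_atTop.2 ⟨3, hkey⟩)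
  have : 0 < a * d := mul_pos ha hd0
  linarith

lemma wellConditioned_of_chi_eq_one (hφ : PseudoLipschitz φ) (hσw : 0 < σw) (hq : 0 < q)
    (hT : T.Regular q) (hfirst : T.FirstNonzero q k)
    (hnet : ∀ L : ℕ, 1 ≤ L →
      (Net.mk φ σw q k L (width L) T).Fits ∧ ∀ l ≤ L, width L l ≤ Nmax)
    (hchi : chi φ σb σw q = 1) :
    WellConditioned fun L l => (Net.mk φ σw q k L (width L) T).secondMoment l := by
  rw [chi_eq hφ σb σw hq] at hchi
  obtain ⟨hi, ho, hne, hne'⟩ := hfirst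
  -- If E[φ²] = 0, the continuous φ vanishes identically, and then χ = 0 rather than 1.
  have hE : 0 < ∫ z, φ (√q * z) ^ 2 ∂stdNormal := by
    have hint : Integrable (fun z => φ (√q * z) ^ 2) stdNormal :=
      ((hφ.polyGrowth.comp_mul (√q)).pow 2).integrable (by
        have := hφ.continuous.measurable
        fun_prop)
    refine lt_of_le_of_ne (integral_nonneg fun z => sq_nonneg _) fun h0 => ?_
    rw [eq_comm, integral_eq_zero_iff_of_nonneg (fun z => sq_nonneg _) hint] at h0
    have h1 : (fun z => φ (√q * z) ^ 2) =ᵐ[volume] 0 :=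
      (gaussianReal_absolutelyContinuous' 0 one_ne_zero).ae_le h0
    have h2 : (fun z => φ (√q * z) ^ 2) = 0 := by
      refine (Continuous.ae_eq_iff_eq volume ?_ continuous_const).1 h1
      have := hφ.continuous
      fun_prop
    have h3 : φ = fun _ => 0 := by
      funext x
      have := congrFun h2 (x / √q)
      rw [mul_div_cancel₀ _ (Real.sqrt_pos.2 hq).ne'] at this
      simpa using this
    rw [h3] at hchi
    simp at hchi
  set E := ∫ z, φ (√q * z) ^ 2 ∂stdNormal
  set d := (T.pairing q (fun _ _ => 1) 0).toReal with hd
  have hd0 : 0 < d := ENNReal.toReal_pos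
    (Batch.pairing_pos ho (by simpa only [mul_one] using hne)).ne' (Batch.pairing_ne_top hT _ _)
  set S := ∑ j ∈ Finset.range T.out, (T.pairing q (fun _ _ => 1) j).toReal with hS
  have hdS : d ≤ S := Finset.single_le_sum (f := fun j => (T.pairing q (fun _ _ => 1) j).toReal)
    (fun _ _ => ENNReal.toReal_nonneg) (Finset.mem_range.2 ho)
  let c : Fin T.size → ZMod P → ℝ := fun s α =>
    if h : 0 < T.inp then T.input s ⟨0, h⟩ (α + ((-(k : ℤ) : ℤ) : ZMod P)) else 0
  set p := (T.pairing q c 0).toReal with hp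
  have hp0 : 0 < p := by
    refine ENNReal.toReal_pos (Batch.pairing_pos ho ?_).ne' (Batch.pairing_ne_top hT _ _)
    simpa [c, hi, ← sub_eq_add_neg] using hne'
  let r : ZMod P → ℝ := fun γ =>
    (∑ j ∈ Finset.range T.out, T.pairing q (fun s α => c s (α + γ)) j).toReal
  have hr : ∀ γ, 0 ≤ r γ := fun γ => ENNReal.toReal_nonneg
  have hpr : p ≤ r 0 := by
    simp only [r, add_zero]
    refine ENNReal.toReal_mono (ENNReal.sum_ne_top.2 fun j _ => Batch.pairing_ne_top hT _ _) ?_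
    exact Finset.single_le_sum (f := fun j => T.pairing q c j) (fun _ _ => zero_le)
      (Finset.mem_range.2 ho)
  have hsize : (0 : ℝ) < T.size := by
    rcases Nat.eq_zero_or_pos T.size with h0 | h0
    · exfalso
      refine hne (ae_of_all _ fun y => ?_)
      have : IsEmpty (Fin T.size) := by
        rw [h0]
        infer_instance
      exact Finset.sum_eq_zero fun s _ => (this.false s).elim
    · exact_mod_cast h0
  set G := σw ^ 2 / (2 * k + 1) * (T.size : ℝ)⁻¹ ^ 2 with hG
  have hG0 : 0 < G := by positivity
  have hP : (0 : ℝ) < P := by exact_mod_cast Nat.pos_of_ne_zero (NeZero.ne P)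
  -- The first entry bounds the moments of layers l ≥ 2 from below, the second those of layer 1,
  -- through the return probability of the walk.
  set u := min (E * d) (p / (P * (2 * k + 1))) with hu
  have hu0 : 0 < u := lt_min (by positivity) (by positivity)
  have hN1 : (1 : ℝ) ≤ Nmax := by
    have h := hnet 1 le_rfl
    exact_mod_cast (h.1.2.2 0 (Nat.zero_le _)).trans (h.2 0 (Nat.zero_le _))
  have hpu : u ≤ p := (min_le_right _ _).trans (div_le_self hp0.le (by
    have : (1 : ℝ) ≤ P := by exact_mod_cast Nat.pos_of_ne_zero (NeZero.ne P)
    nlinarith [(Nat.cast_nonneg k : (0 : ℝ) ≤ k)]))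
  set V := E * S + p + ∑ γ, r γ with hV
  have hrsum : 0 ≤ ∑ γ, r γ := Finset.sum_nonneg fun γ _ => hr γ
  have hES : 0 ≤ E * S := by nlinarith
  -- every second moment is `G * (x / (n * n'))` with `u ≤ x ≤ V` and `1 ≤ n, n' ≤ Nmax`
  have hbd : ∀ x n n' : ℝ, u ≤ x → x ≤ V → 1 ≤ n → n ≤ Nmax → 1 ≤ n' → n' ≤ Nmax →
      G * (u / (Nmax * Nmax)) ≤ G * (x / (n * n')) ∧ G * (x / (n * n')) ≤ G * V := by
    intro x n n' h1 h2 h3 h4 h5 h6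
    constructor
    · gcongr
      exact hu0.le.trans h1
    · gcongr
      exact (div_le_self (hu0.le.trans h1) (by nlinarith)).trans h2
  refine WellConditioned.of_bounds (a := G * (u / (Nmax * Nmax))) (b := G * V) (by positivity)
    fun L hL l hl => ?_
  rw [Finset.mem_Icc] at hl
  obtain ⟨⟨-, hout, hw⟩, hN⟩ := hnet L hL
  change width L L = T.out at hout
  change ∀ l ≤ L, 1 ≤ width L l at hw
  have hw' : ∀ l ≤ L, (1 : ℝ) ≤ width L l := fun l hl => by exact_mod_cast hw l hl
  have hN' : ∀ l ≤ L, (width L l : ℝ) ≤ Nmax := fun l hl => by exact_mod_cast hN l hl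
  rcases hl.1.eq_or_lt with rfl | hl1
  · have w0 := hw' 0 (by omega)
    rcases hL.eq_or_lt with rfl | hL2
    · have e : (Net.mk φ σw q k 1 (width 1) T).secondMoment 1 =
          σw ^ 2 / (width 1 0 * (2 * k + 1)) * (T.size : ℝ)⁻¹ ^ 2 * p :=
        Net.secondMoment_one_of_depth_eq_one (A := Net.mk φ σw q k 1 (width 1) T) hφ rfl
      have e' : (Net.mk φ σw q k 1 (width 1) T).secondMoment 1 =
          G * (p / (width 1 0 * 1)) := by
        rw [e, hG]
        field_simp
      simp only [e']
      exact hbd p _ _ hpu (by linarith) w0 (hN' 0 (by omega)) le_rfl hN1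
    · have w1 := hw' 1 (by omega)
      have e : (Net.mk φ σw q k L (width L) T).secondMoment 1 =
          σw ^ 2 / (width L 0 * (2 * k + 1)) * (T.size : ℝ)⁻¹ ^ 2 *
          (1 / width L 1 * (cyclicAvg k)^[L - 1] (fun γ =>
            (∑ j ∈ Finset.range (width L L),
              T.pairing q (fun s α => c s (α + γ)) j).toReal) 0) :=
        Net.secondMoment_one_of_two_le (A := Net.mk φ σw q k L (width L) T) hφ hq.le hchi hT hw
          (by simp; omega)
      rw [hout] at e
      have e' : (Net.mk φ σw q k L (width L) T).secondMoment 1 =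
          G * ((cyclicAvg k)^[L - 1] r 0 / (width L 0 * width L 1)) := by
        rw [e, hG]
        simp only [r]
        field_simp
      simp only [e']
      refine hbd _ _ _ ?_ ?_ w0 (hN' 0 (by omega)) w1 (hN' 1 (by omega))
      · refine (min_le_right _ _).trans (le_trans ?_ (le_cyclicAvg_iterate k hr _))
        gcongr
      · have := cyclicAvg_iterate_le k hr (L - 1) 0
        linarith
  · have wl := hw' (l - 1) (by omega)
    have hl2 : 2 ≤ l := hl1
    rcases hl.2.eq_or_lt with rfl | hlL
    · have e : (Net.mk φ σw q k l (width l) T).secondMoment l = σw ^ 2 /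
          (width l (l - 1) * (2 * k + 1)) * ((T.size : ℝ)⁻¹ ^ 2 * E) * d :=
        Net.secondMoment_depth (A := Net.mk φ σw q k l (width l) T) hφ hq.le hl2
      have e' : (Net.mk φ σw q k l (width l) T).secondMoment l =
          G * (E * d / (width l (l - 1) * 1)) := by
        rw [e, hG]
        field_simp
      simp only [e']
      exact hbd _ _ _ (min_le_left _ _) (by nlinarith) wl (hN' _ (by omega)) le_rfl hN1
    · have w2 := hw' l hl.2
      have e : (Net.mk φ σw q k L (width L) T).secondMoment l = σw ^ 2 /
          (width L (l - 1) * (2 * k + 1)) * ((T.size : ℝ)⁻¹ ^ 2 * E) *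
          ((σw ^ 2 * ∫ z, deriv φ (√q * z) ^ 2 ∂stdNormal) ^ (L - l) / width L l *
            ∑ j ∈ Finset.range (width L L), (T.pairing q (fun _ _ => 1) j).toReal) :=
        Net.secondMoment_of_lt (A := Net.mk φ σw q k L (width L) T) hφ hq.le hT hw hl2 hlL
      rw [hout, ← hS, hchi, one_pow] at e
      have e' : (Net.mk φ σw q k L (width L) T).secondMoment l =
          G * (E * S / (width L (l - 1) * width L l)) := by
        rw [e, hG]
        field_simp
      simp only [e']
      refine hbd _ _ _ ((min_le_left _ _).trans ?_) (by linarith) wl (hN' _ (by omega)) w2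
        (hN' _ hl.2)
      gcongr

end Conditioning

/-! ### The law of a score on the scale of its layer -/

section NormalisedScore

variable {φ : ℝ → ℝ} {q : ℝ}

/-- The squared score of a weight up to the scale of its layer. -/
def normScore (φ : ℝ → ℝ) (q : ℝ) (z : ℝ × ℝ × ℝ × ℝ) : ℝ :=
  (z.1 * (φ (√q * z.2.1) * (deriv φ (√q * z.2.2.1) * z.2.2.2))) ^ 2

lemma measurable_normScore (hφ : PseudoLipschitz φ) : Measurable (normScore φ q) := by
  have := hφ.continuous.measurable
  have := measurable_deriv φ
  unfold normScore
  fun_prop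

lemma lintegral_normScore_pow_ne_top (hφ : PseudoLipschitz φ) (n : ℕ) :
    ∫⁻ z, ENNReal.ofReal (normScore φ q z ^ n) ∂stdNormalFour ≠ ⊤ := by
  have hm := hφ.continuous.measurable
  have hm' := measurable_deriv φ
  have h : ∀ z : ℝ × ℝ × ℝ × ℝ, ENNReal.ofReal (normScore φ q z ^ n) =
      ENNReal.ofReal (z.1 ^ (2 * n)) * (ENNReal.ofReal (φ (√q * z.2.1) ^ (2 * n)) *
        (ENNReal.ofReal (deriv φ (√q * z.2.2.1) ^ (2 * n)) *
          ENNReal.ofReal (z.2.2.2 ^ (2 * n)))) := by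
    intro z
    have e : ∀ x : ℝ, 0 ≤ x ^ (2 * n) := fun x => by
      rw [pow_mul]
      positivity
    rw [← ENNReal.ofReal_mul (e _), ← ENNReal.ofReal_mul (e _), ← ENNReal.ofReal_mul (e _),
      normScore]
    congr 1
    ring
  have hfin : ∀ {g : ℝ → ℝ}, PolyGrowth g → Measurable g →
      ∫⁻ z, ENNReal.ofReal (g z ^ (2 * n)) ∂stdNormal ≠ ⊤ := fun hg hgm =>
    (Integrable.lintegral_lt_top ((hg.pow _).integrable (hgm.pow_const _))).ne
  simp only [h]
  rw [lintegral_stdNormalFour_mul (f₁ := fun x => ENNReal.ofReal (x ^ (2 * n)))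
    (f₂ := fun x => ENNReal.ofReal (φ (√q * x) ^ (2 * n)))
    (f₃ := fun x => ENNReal.ofReal (deriv φ (√q * x) ^ (2 * n)))
    (f₄ := fun x => ENNReal.ofReal (x ^ (2 * n)))
    (by fun_prop) (by fun_prop) (by fun_prop) (by fun_prop)]
  refine ENNReal.mul_ne_top (hfin polyGrowth_id measurable_id) (ENNReal.mul_ne_top
    (hfin (hφ.polyGrowth.comp_mul _) (by fun_prop)) (ENNReal.mul_ne_top
      (hfin (hφ.polyGrowth_deriv.comp_mul _) (by fun_prop)) (hfin polyGrowth_id measurable_id)))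

lemma ae_ne_zero_stdNormal : ∀ᵐ z ∂stdNormal, z ≠ 0 := by
  have : NullSingletonClass stdNormal := by
    unfold stdNormal
    exact nullSingletonClass_gaussianReal one_ne_zero
  exact Measure.ae_ne stdNormal 0

lemma ae_stdNormalFour_of_ae {p₁ p₂ p₃ p₄ : ℝ → Prop} (h₁ : ∀ᵐ z ∂stdNormal, p₁ z)
    (h₂ : ∀ᵐ z ∂stdNormal, p₂ z) (h₃ : ∀ᵐ z ∂stdNormal, p₃ z) (h₄ : ∀ᵐ z ∂stdNormal, p₄ z) :
    ∀ᵐ z ∂stdNormalFour, p₁ z.1 ∧ p₂ z.2.1 ∧ p₃ z.2.2.1 ∧ p₄ z.2.2.2 := by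
  have e3 : ∀ᵐ z ∂(stdNormal.prod stdNormal), p₃ z.1 ∧ p₄ z.2 :=
    (Measure.quasiMeasurePreserving_fst.ae h₃).and (Measure.quasiMeasurePreserving_snd.ae h₄)
  have e2 : ∀ᵐ z ∂(stdNormal.prod (stdNormal.prod stdNormal)),
      p₂ z.1 ∧ p₃ z.2.1 ∧ p₄ z.2.2 :=
    (Measure.quasiMeasurePreserving_fst.ae h₂).and (Measure.quasiMeasurePreserving_snd.ae e3)
  exact (Measure.quasiMeasurePreserving_fst.ae h₁).and (Measure.quasiMeasurePreserving_snd.ae e2)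

lemma ae_normScore_pos (hlog : LogIntegrable φ q) : ∀ᵐ z ∂stdNormalFour, 0 < normScore φ q z := by
  filter_upwards [ae_stdNormalFour_of_ae ae_ne_zero_stdNormal (hlog.1.mono fun _ h => h.1)
    (hlog.1.mono fun _ h => h.2) ae_ne_zero_stdNormal] with z hz
  have := mul_ne_zero hz.1 (mul_ne_zero hz.2.1 (mul_ne_zero hz.2.2.1 hz.2.2.2))
  unfold normScore
  positivity

lemma integrable_log_normScore (hlog : LogIntegrable φ q) :
    Integrable (fun z => Real.log (normScore φ q z)) stdNormalFour := by
  have hz := integrable_log_abs_stdNormal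
  have h3 : Integrable (fun z : ℝ × ℝ => Real.log |deriv φ (√q * z.1)| + Real.log |z.2|)
      (stdNormal.prod stdNormal) := (hlog.2.2.comp_fst _).add (hz.comp_snd _)
  have h2 : Integrable (fun z : ℝ × ℝ × ℝ => Real.log |φ (√q * z.1)| +
      (Real.log |deriv φ (√q * z.2.1)| + Real.log |z.2.2|))
      (stdNormal.prod (stdNormal.prod stdNormal)) := (hlog.2.1.comp_fst _).add (h3.comp_snd _)
  have h1 : Integrable (fun z : ℝ × ℝ × ℝ × ℝ => Real.log |z.1| + (Real.log |φ (√q * z.2.1)| +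
      (Real.log |deriv φ (√q * z.2.2.1)| + Real.log |z.2.2.2|))) stdNormalFour :=
    (hz.comp_fst _).add (h2.comp_snd _)
  refine (h1.const_mul 2).congr ?_
  filter_upwards [ae_stdNormalFour_of_ae ae_ne_zero_stdNormal (hlog.1.mono fun _ h => h.1)
    (hlog.1.mono fun _ h => h.2) ae_ne_zero_stdNormal] with z hz
  rw [normScore, Real.log_pow, Real.log_mul hz.1 (mul_ne_zero hz.2.1
    (mul_ne_zero hz.2.2.1 hz.2.2.2)), Real.log_mul hz.2.1 (mul_ne_zero hz.2.2.1 hz.2.2.2),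
    Real.log_mul hz.2.2.1 hz.2.2.2]
  simp only [Real.log_abs]
  norm_num

/-- Summed over an arithmetic progression, the probabilities that the logarithm is very negative
are bounded by its mean. -/
lemma sum_measureReal_normScore_le (hφ : PseudoLipschitz φ) (hlog : LogIntegrable φ q) {x : ℝ}
    (hx : 0 < x) (n : ℕ) :
    ∑ d ∈ Finset.Icc 1 n, stdNormalFour.real {z | normScore φ q z ≤ Real.exp (-(x * d))} ≤
      (∫ z, |Real.log (normScore φ q z)| ∂stdNormalFour) / x := by
  have hm := measurable_normScore (q := q) hφ
  have hset : ∀ d : ℕ, MeasurableSet {z | normScore φ q z ≤ Real.exp (-(x * d))} := fun d =>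
    measurableSet_le hm measurable_const
  have h1 : ∀ d : ℕ, stdNormalFour.real {z | normScore φ q z ≤ Real.exp (-(x * d))} =
      ∫ z, Set.indicator {z | normScore φ q z ≤ Real.exp (-(x * d))} 1 z ∂stdNormalFour :=
    fun d => (integral_indicator_one (hset d)).symm
  have hint : ∀ d : ℕ, Integrable
      (Set.indicator {z | normScore φ q z ≤ Real.exp (-(x * d))} (1 : ℝ × ℝ × ℝ × ℝ → ℝ)) stdNormalFour :=
    fun d => (integrable_const (1 : ℝ)).indicator (hset d)
  simp only [h1]
  rw [← integral_finsetSum _ (fun d _ => hint d), ← integral_div]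
  refine integral_mono_ae (integrable_finsetSum _ fun d _ => hint d)
    ((integrable_log_normScore hlog).abs.div_const x) ?_
  filter_upwards [ae_normScore_pos hlog] with z hz
  -- Pointwise, the events with index d ≤ n that occur all have d ≤ Y, so there are at most ⌊Y⌋ of
  -- them.
  set Y := |Real.log (normScore φ q z)| / x with hY
  have hY0 : 0 ≤ Y := by positivity
  have h2 : ∀ d ∈ Finset.Icc 1 n,
      Set.indicator {z | normScore φ q z ≤ Real.exp (-(x * d))} (1 : ℝ × ℝ × ℝ × ℝ → ℝ) z ≤
        if d ≤ ⌊Y⌋₊ then 1 else 0 := by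
    intro d _
    by_cases hd : normScore φ q z ≤ Real.exp (-(x * d))
    · have h3 : Real.log (normScore φ q z) ≤ -(x * d) := by
        rw [← Real.log_exp (-(x * d))]
        exact Real.log_le_log hz hd
      have h4 : (d : ℝ) ≤ Y := by
        rw [hY, le_div_iff₀ hx]
        have := neg_abs_le (Real.log (normScore φ q z))
        linarith
      rw [if_pos (Nat.le_floor h4)]
      exact Set.indicator_le_self' (fun _ _ => zero_le_one) z
    · rw [Set.indicator_of_notMem (by exact hd)]
      split_ifs <;> norm_num
  refine (Finset.sum_le_sum h2).trans ?_
  rw [Finset.sum_boole]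
  refine le_trans ?_ (Nat.floor_le hY0)
  have : (Finset.Icc 1 n).filter (· ≤ ⌊Y⌋₊) ⊆ Finset.Icc 1 ⌊Y⌋₊ := fun d hd => by
    simp only [Finset.mem_filter, Finset.mem_Icc] at hd ⊢
    omega
  have h5 := Finset.card_le_card this
  rw [Nat.card_Icc, Nat.add_sub_cancel] at h5
  exact_mod_cast h5

end NormalisedScore

/-! ### Scores given the gradient of the layer above -/

namespace Net

variable {P : ℕ} [NeZero P] {A : Net P}

variable (A) in
/-- The scale of the squared scores in layer `depth - (t + 1)` relative to the squared gradient of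
the layer above. -/
def scoreScale (t : ℕ) : ℝ :=
  (A.batch.size : ℝ)⁻¹ ^ 2 * (A.σw ^ 2) ^ 2 / (2 * A.k + 1) /
    (A.width (A.depth - (t + 1) - 1) * A.width (A.depth - (t + 1)))

lemma sum_paired_sq_mul_variance {t : ℕ} (ω : Coord → ℝ) :
    ∑ x ∈ Finset.range (A.width (A.depth - t)) ×ˢ A.ker,
      A.paired (shift (fun _ _ => 1) x.2) t x.1 ω ^ 2 *
        (A.σw ^ 2 / (A.width (A.depth - t - 1) * (2 * A.k + 1))) =
      A.σw ^ 2 / A.width (A.depth - (t + 1)) * A.gradSq t ω := by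
  have hk : (2 * (A.k : ℝ) + 1) ≠ 0 := by positivity
  have hsh : ∀ β : ℤ, shift (fun (_ : Fin A.batch.size) (_ : ZMod P) => (1 : ℝ)) β =
      fun _ _ => 1 := fun β => rfl
  simp only [hsh]
  rw [Finset.sum_product]
  simp only [Finset.sum_const, nsmul_eq_mul, card_ker]
  rw [gradSq, Finset.mul_sum, show A.depth - t - 1 = A.depth - (t + 1) by omega]
  refine Finset.sum_congr rfl fun i _ => ?_
  rw [← div_div]
  field_simp

/-- The conditional law of a squared score given the layers above. -/
lemma lintegral_score (hφ : PseudoLipschitz A.φ) (hq : 0 ≤ A.q) {t : ℕ}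
    (ht : t + 2 < A.depth) (w : ℕ × ℕ × ℤ) {F : (Coord → ℝ) → ℝ → ℝ≥0∞}
    (hF : Measurable (Function.uncurry F)) (hFd : DependsOn F (A.upper t)) :
    ∫⁻ ω, F ω (A.score ω (A.depth - (t + 1)) w ^ 2) ∂A.law =
      ∫⁻ ω, ∫⁻ z, F ω (A.scoreScale t * A.gradSq t ω * normScore A.φ A.q z)
        ∂stdNormalFour ∂A.law := by
  have hm := hφ.continuous.measurable
  have hm' := measurable_deriv A.φ
  obtain ⟨i, j, β⟩ := w
  have hlay := A.lintegral_layer hq (t := t) (by omega) i j β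
    (F := fun ω y => F ω ((y.1 * ((A.batch.size : ℝ)⁻¹ * (A.φ y.2.1 *
      (deriv A.φ y.2.2.1 * y.2.2.2)))) ^ 2))
    (by
      have hF' : Measurable (fun p : (Coord → ℝ) × ℝ => F p.1 p.2) := hF
      exact hF'.comp (measurable_fst.prodMk (by fun_prop)))
    (fun ω ω' h => by simp only [hFd h])
    (e := fun ω x => A.paired (shift (fun _ _ => 1) x.2) t x.1 ω) (by fun_prop)
    (fun ω ω' h => funext fun x => A.dependsOn_paired _ (by omega) _ h)
  have hsc : ∀ ω, A.score ω (A.depth - (t + 1)) (i, j, β) ^ 2 =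
      (ω (.fwd (A.depth - (t + 1)) i j β) * ((A.batch.size : ℝ)⁻¹ *
        (A.φ (ω (.pre (A.depth - (t + 1) - 1) j)) * (deriv A.φ (ω (.pre (A.depth - (t + 1)) i)) *
        ∑ x ∈ Finset.range (A.width (A.depth - t)) ×ˢ A.ker,
          A.paired (shift (fun _ _ => 1) x.2) t x.1 ω *
            ω (.bwd (A.depth - t) x.1 i x.2))))) ^ 2 := fun ω => by
    rw [score, sq_abs, weightGrad_of_two_le (by omega),
      show A.depth - (A.depth - (t + 1)) = t + 1 by omega, paired_succ]
  simp only [hsc]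
  rw [hlay]
  refine lintegral_congr fun ω => lintegral_congr fun z => ?_
  congr 1
  rw [sum_paired_sq_mul_variance]
  have h1 : 0 ≤ A.σw ^ 2 / (A.width (A.depth - (t + 1) - 1) * (2 * A.k + 1) : ℝ) := by positivity
  have h2 : 0 ≤ A.σw ^ 2 / A.width (A.depth - (t + 1)) * A.gradSq t ω :=
    mul_nonneg (by positivity) (A.gradSq_nonneg t ω)
  have e1 := Real.sq_sqrt h1
  have e2 := Real.sq_sqrt h2
  rw [scoreScale, normScore]
  calc _ = (√(A.σw ^ 2 / (A.width (A.depth - (t + 1) - 1) * (2 * A.k + 1) : ℝ))) ^ 2 *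
        (√(A.σw ^ 2 / A.width (A.depth - (t + 1)) * A.gradSq t ω)) ^ 2 *
        ((A.batch.size : ℝ)⁻¹ ^ 2 * (z.1 * (A.φ (√A.q * z.2.1) *
          (deriv A.φ (√A.q * z.2.2.1) * z.2.2.2))) ^ 2) := by ring
    _ = _ := by
      rw [e1, e2]
      rw [← div_div, ← div_div]
      ring

lemma batch_size_pos (hgrad : A.batch.GradNonzero A.q) : 0 < A.batch.size := by
  rcases Nat.eq_zero_or_pos A.batch.size with h0 | h0
  · exfalso
    have : IsProbabilityMeasure (A.batch.outLaw A.q) := by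
      unfold Batch.outLaw
      infer_instance
    obtain ⟨y, i, hi⟩ := hgrad.exists
    have : IsEmpty (Fin A.batch.size) := by
      rw [h0]
      infer_instance
    exact hi (Finset.sum_eq_zero fun s _ => (this.false s).elim)
  · exact h0

/-- One channel suffices: given a nonzero gradient above, its total gradient is φ'(y), almost surely
nonzero, times a nondegenerate Gaussian. The recursion starts from the assumption on the output
gradient. -/
lemma ae_gradSq_pos (hq : 0 < A.q) (hσw : 0 < A.σw)
    (hlog : LogIntegrable A.φ A.q) (hfit : A.Fits) (hgrad : A.batch.GradNonzero A.q) {t : ℕ}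
    (ht : t < A.depth) : ∀ᵐ ω ∂A.law, 0 < A.gradSq t ω := by
  induction t with
  | zero =>
    have h1 : ∀ᵐ ω ∂A.law, ∃ i, ∑ s, ∑ α,
        A.batch.outGrad (fun i' => ω (.pre A.depth i')) s i α ≠ 0 := by
      have h2 : ∀ᵐ y ∂(A.law.map fun ω (i : Fin A.batch.out) => ω (.pre A.depth i)),
          ∃ i, ∑ s, ∑ α, A.batch.outGrad y s i α ≠ 0 := by
        rw [map_output]
        exact hgrad
      exact ae_of_ae_map (f := fun (ω : Coord → ℝ) (i : Fin A.batch.out) => ω (.pre A.depth i))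
        (Measurable.aemeasurable (by fun_prop)) h2
    filter_upwards [h1] with ω ⟨i, hi⟩
    have h3 : A.paired (fun _ _ => 1) 0 i ω ≠ 0 := by
      simpa [paired, delta] using hi
    refine lt_of_lt_of_le (by positivity : 0 < A.paired (fun _ _ => 1) 0 i ω ^ 2) ?_
    refine Finset.single_le_sum (f := fun i => A.paired (fun _ _ => 1) 0 i ω ^ 2)
      (fun _ _ => sq_nonneg _) ?_
    rw [Finset.mem_range, Nat.sub_zero, hfit.2.1]
    exact i.2
  | succ t ih =>
    have hm' := measurable_deriv A.φ
    have hwidth : 1 ≤ A.width (A.depth - (t + 1)) := hfit.2.2 _ (Nat.sub_le _ _)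
    have hwr : (0 : ℝ) < A.width (A.depth - (t + 1)) := by exact_mod_cast hwidth
    suffices h : ∀ᵐ ω ∂A.law, A.paired (fun _ _ => 1) (t + 1) 0 ω ≠ 0 by
      filter_upwards [h] with ω hω
      refine lt_of_lt_of_le (by positivity : 0 < A.paired (fun _ _ => 1) (t + 1) 0 ω ^ 2) ?_
      exact Finset.single_le_sum (f := fun i => A.paired (fun _ _ => 1) (t + 1) i ω ^ 2)
        (fun _ _ => sq_nonneg _) (Finset.mem_range.2 hwidth)
    let F : ℝ × ℝ × ℝ × ℝ → ℝ≥0∞ :=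
      Set.indicator {y | deriv A.φ y.2.2.1 * y.2.2.2 = 0} 1
    have hFm : Measurable F := measurable_one.indicator
      (measurableSet_eq_fun (by fun_prop) measurable_const)
    have hlay := A.lintegral_layer hq.le ht 0 0 0 (F := fun _ y => F y)
      (by exact hFm.comp measurable_snd)
      (fun ω ω' h => rfl)
      (e := fun ω x => A.paired (shift (fun _ _ => 1) x.2) t x.1 ω) (by fun_prop)
      (fun ω ω' h => funext fun x => A.dependsOn_paired _ (by omega) _ h)
    have hzero : ∫⁻ ω, ∫⁻ z, F (√(A.σw ^ 2 / (A.width (A.depth - (t + 1) - 1) *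
        (2 * A.k + 1))) * z.1, √A.q * z.2.1, √A.q * z.2.2.1,
        √(∑ x ∈ Finset.range (A.width (A.depth - t)) ×ˢ A.ker,
          A.paired (shift (fun _ _ => 1) x.2) t x.1 ω ^ 2 *
            (A.σw ^ 2 / (A.width (A.depth - t - 1) * (2 * A.k + 1)))) * z.2.2.2)
        ∂stdNormalFour ∂A.law = 0 := by
      rw [← lintegral_zero (μ := A.law)]
      refine lintegral_congr_ae ?_
      filter_upwards [ih (by omega)] with ω hω
      simp only [sum_paired_sq_mul_variance]
      rw [← lintegral_zero (μ := stdNormalFour)]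
      refine lintegral_congr_ae ?_
      filter_upwards [ae_stdNormalFour_of_ae (p₁ := fun _ => True) (p₂ := fun _ => True)
        (by simp) (by simp) (hlog.1.mono fun _ h => h.2) ae_ne_zero_stdNormal] with z hz
      refine Set.indicator_of_notMem ?_ _
      have : 0 < √(A.σw ^ 2 / A.width (A.depth - (t + 1)) * A.gradSq t ω) :=
        Real.sqrt_pos.2 (by positivity)
      exact mul_ne_zero hz.2.2.1 (mul_ne_zero this.ne' hz.2.2.2)
    rw [hzero, lintegral_eq_zero_iff (by
      refine hFm.comp ?_
      fun_prop)] at hlay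
    filter_upwards [hlay] with ω hω h0
    rw [paired_succ] at h0
    have hmem : (ω (.fwd (A.depth - (t + 1)) 0 0 0), ω (.pre (A.depth - (t + 1) - 1) 0),
        ω (.pre (A.depth - (t + 1)) 0),
        ∑ x ∈ Finset.range (A.width (A.depth - t)) ×ˢ A.ker,
          A.paired (shift (fun _ _ => 1) x.2) t x.1 ω * ω (.bwd (A.depth - t) x.1 0 x.2)) ∈
        {y : ℝ × ℝ × ℝ × ℝ | deriv A.φ y.2.2.1 * y.2.2.2 = 0} := h0
    have h1 := Set.indicator_of_mem hmem (1 : ℝ × ℝ × ℝ × ℝ → ℝ≥0∞)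
    rw [Pi.one_apply] at h1
    exact one_ne_zero (h1.symm.trans hω)

lemma scoreScale_pos (hσw : 0 < A.σw) (hfit : A.Fits) (hgrad : A.batch.GradNonzero A.q) (t : ℕ) :
    0 < A.scoreScale t := by
  have h1 : (0 : ℝ) < A.batch.size := by exact_mod_cast batch_size_pos hgrad
  have h2 : (0 : ℝ) < A.width (A.depth - (t + 1) - 1) := by
    exact_mod_cast hfit.2.2 _ (by omega)
  have h3 : (0 : ℝ) < A.width (A.depth - (t + 1)) := by exact_mod_cast hfit.2.2 _ (by omega)
  unfold scoreScale
  positivity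

/-- The probability that a squared score is small on the scale of its layer. -/
lemma measure_score_sq_le (hφ : PseudoLipschitz A.φ) (hq : 0 < A.q) (hσw : 0 < A.σw)
    (hlog : LogIntegrable A.φ A.q) (hfit : A.Fits) (hgrad : A.batch.GradNonzero A.q) {t : ℕ}
    (ht : t + 2 < A.depth) (w : ℕ × ℕ × ℤ) (τ : ℝ) :
    A.law {ω | A.score ω (A.depth - (t + 1)) w ^ 2 ≤ A.scoreScale t * A.gradSq t ω * τ} =
      stdNormalFour {z | normScore A.φ A.q z ≤ τ} := by
  have hsm := measurable_score hφ.continuous.measurable (A := A)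
  have hUm := measurable_normScore (q := A.q) hφ
  have h := lintegral_score hφ hq.le ht w
    (F := fun ω x => Set.indicator {p : (Coord → ℝ) × ℝ |
      p.2 ≤ A.scoreScale t * A.gradSq t p.1 * τ} 1 (ω, x))
    (measurable_one.indicator (measurableSet_le (by fun_prop) (by fun_prop)))
    (fun ω ω' h => by
      funext x
      simp only [Set.indicator, Set.mem_ofPred_eq, dependsOn_gradSq (by omega) h, Pi.one_apply])
  have e1 : ∫⁻ ω, Set.indicator {p : (Coord → ℝ) × ℝ |
      p.2 ≤ A.scoreScale t * A.gradSq t p.1 * τ} (1 : (Coord → ℝ) × ℝ → ℝ≥0∞)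
      (ω, A.score ω (A.depth - (t + 1)) w ^ 2) ∂A.law =
      A.law {ω | A.score ω (A.depth - (t + 1)) w ^ 2 ≤
        A.scoreScale t * A.gradSq t ω * τ} := by
    rw [← lintegral_indicator_one (measurableSet_le (by fun_prop) (by fun_prop))]
    rfl
  rw [← e1, h]
  have hS := scoreScale_pos hσw hfit hgrad t
  have e2 : ∀ᵐ ω ∂A.law, ∫⁻ z, Set.indicator {p : (Coord → ℝ) × ℝ |
      p.2 ≤ A.scoreScale t * A.gradSq t p.1 * τ} (1 : (Coord → ℝ) × ℝ → ℝ≥0∞)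
      (ω, A.scoreScale t * A.gradSq t ω * normScore A.φ A.q z) ∂stdNormalFour =
      stdNormalFour {z | normScore A.φ A.q z ≤ τ} := by
    filter_upwards [ae_gradSq_pos hq hσw hlog hfit hgrad (t := t) (by omega)] with ω hω
    rw [← lintegral_indicator_one (measurableSet_le hUm measurable_const)]
    refine lintegral_congr fun z => ?_
    simp only [Set.indicator, Set.mem_ofPred_eq, mul_le_mul_iff_right₀ (mul_pos hS hω),
      Pi.one_apply]
  rw [lintegral_congr_ae e2, lintegral_const, measure_univ, mul_one]

/-- Moments of the squared scores on the scale of their layer, weighted by a function of the layers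
above. -/
lemma lintegral_mul_score_pow (hφ : PseudoLipschitz A.φ) (hq : 0 < A.q) (hσw : 0 < A.σw)
    (hlog : LogIntegrable A.φ A.q) (hfit : A.Fits) (hgrad : A.batch.GradNonzero A.q) {t : ℕ}
    (ht : t + 2 < A.depth) (w : ℕ × ℕ × ℤ) (n : ℕ) {f : (Coord → ℝ) → ℝ≥0∞} (hf : Measurable f)
    (hfd : DependsOn f (A.upper t)) :
    ∫⁻ ω, f ω * ENNReal.ofReal ((A.score ω (A.depth - (t + 1)) w ^ 2 /
        (A.scoreScale t * A.gradSq t ω)) ^ n) ∂A.law =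
      (∫⁻ ω, f ω ∂A.law) * ∫⁻ z, ENNReal.ofReal (normScore A.φ A.q z ^ n) ∂stdNormalFour := by
  have hUm := measurable_normScore (q := A.q) hφ
  have h := lintegral_score hφ hq.le ht w
    (F := fun ω x => f ω * ENNReal.ofReal ((x / (A.scoreScale t * A.gradSq t ω)) ^ n))
    (by unfold Function.uncurry; fun_prop)
    (fun ω ω' h => by
      funext x
      simp only [hfd h, dependsOn_gradSq (A := A) (t := t) (by omega) h])
  rw [h, ← lintegral_mul_const _ hf]
  refine lintegral_congr_ae ?_
  have hS := scoreScale_pos hσw hfit hgrad t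
  filter_upwards [ae_gradSq_pos hq hσw hlog hfit hgrad (t := t) (by omega)] with ω hω
  rw [← lintegral_const_mul _ (by fun_prop)]
  refine lintegral_congr fun z => ?_
  rw [mul_div_cancel_left₀ _ (mul_pos hS hω).ne']

end Net

/-- Either u ≤ c or u ≤ u (u / c)^m. Applied to every member of a family, it bounds the maximum by c
plus a sum of high moments. -/
lemma le_add_inv_mul_pow {u c : ℝ} (hu : 0 ≤ u) (hc : 0 < c) (m : ℕ) :
    u ≤ c + (c ^ m)⁻¹ * u ^ (m + 1) := by
  rcases le_total u c with h | h
  · have : 0 ≤ (c ^ m)⁻¹ * u ^ (m + 1) := by positivity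
    linarith
  · have h1 : c ^ m * u ≤ u ^ (m + 1) := by
      rw [pow_succ]
      gcongr
    have h2 : u ≤ (c ^ m)⁻¹ * u ^ (m + 1) := by
      rw [← div_eq_inv_mul, le_div_iff₀ (by positivity)]
      linarith
    linarith

/-- The bound 1 is used for about log y / x terms, until y exp(-x d) has dropped to 1; the rest is
dominated by a geometric series. -/
lemma sum_min_one_exp_le {x y : ℝ} (hx : 0 < x) (hy : 1 ≤ y) (n : ℕ) :
    ∑ d ∈ Finset.Icc 1 n, min 1 (y * Real.exp (-(x * d))) ≤
      Real.log y / x + 1 + (1 - Real.exp (-x))⁻¹ := by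
  have hr1 : Real.exp (-x) < 1 := Real.exp_lt_one_iff.2 (by linarith)
  set D := ⌈Real.log y / x⌉₊ with hD
  have hDle : (D : ℝ) ≤ Real.log y / x + 1 :=
    (Nat.ceil_lt_add_one (div_nonneg (Real.log_nonneg hy) hx.le)).le
  have hnn : ∀ d : ℕ, 0 ≤ min 1 (y * Real.exp (-(x * d))) := fun d => by positivity
  have hsub : Finset.Icc 1 n ⊆ Finset.range (D + (n + 1)) := fun d hd => by
    rw [Finset.mem_Icc] at hd
    rw [Finset.mem_range]
    omega
  refine (Finset.sum_le_sum_of_subset_of_nonneg hsub fun d _ _ => hnn d).trans ?_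
  rw [Finset.sum_range_add]
  have h1 : ∑ d ∈ Finset.range D, min 1 (y * Real.exp (-(x * d))) ≤ D := by
    refine (Finset.sum_le_card_nsmul _ _ 1 fun d _ => min_le_left _ _).trans (by simp)
  have h2 : ∀ j ∈ Finset.range (n + 1),
      min 1 (y * Real.exp (-(x * ((D + j : ℕ) : ℝ)))) ≤ Real.exp (-x) ^ j := fun j _ => by
    refine (min_le_right _ _).trans ?_
    rw [← Real.exp_nat_mul]
    have h3 : y ≤ Real.exp (x * D) := by
      rw [← Real.log_le_iff_le_exp (by linarith)]
      have := Nat.le_ceil (Real.log y / x)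
      rw [← hD, div_le_iff₀ hx] at this
      linarith
    calc y * Real.exp (-(x * ((D + j : ℕ) : ℝ)))
        ≤ Real.exp (x * D) * Real.exp (-(x * ((D + j : ℕ) : ℝ))) := by gcongr
      _ = Real.exp (j * -x) := by
        rw [← Real.exp_add]
        push_cast
        congr 1
        ring
  have h3 : ∑ j ∈ Finset.range (n + 1), Real.exp (-x) ^ j ≤ (1 - Real.exp (-x))⁻¹ := by
    rw [← tsum_geometric_of_lt_one (Real.exp_nonneg _) hr1]
    exact (summable_geometric_of_lt_one (Real.exp_nonneg _) hr1).sum_le_tsum _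
      fun _ _ => by positivity
  linarith [Finset.sum_le_sum h2]

/-! ### Comparing a weight with the maximum of a lower layer -/

namespace Net

variable {P : ℕ} [NeZero P] {A : Net P}

lemma score_nonneg (ω : Coord → ℝ) (l : ℕ) (w : ℕ × ℕ × ℤ) : 0 ≤ A.score ω l w := abs_nonneg _

/-- Either the normalised score of `w` is at most τ, or the best squared score d layers below
exceeds τ times the scale of `w`. In the second case Markov's inequality applies to the ratio of the
gradient norms times a moment bound for the lower maximum. The ratio has mean at most χ^d and is
independent of each normalised score of the lower layer. -/
lemma measure_exists_score_le (hφ : PseudoLipschitz A.φ) (hq : 0 < A.q) (hσw : 0 < A.σw)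
    (hlog : LogIntegrable A.φ A.q) (hfit : A.Fits) (hgrad : A.batch.GradNonzero A.q) {t d : ℕ}
    (ht : t + d + 2 < A.depth) (w : ℕ × ℕ × ℤ) (m : ℕ) {τ c : ℝ} (hτ : 0 < τ) (hc : 0 < c) :
    A.law {ω | ∃ i ∈ A.layer (A.depth - (t + d + 1)),
        A.score ω (A.depth - (t + 1)) w ≤ A.score ω (A.depth - (t + d + 1)) i} ≤
      stdNormalFour {z | normScore A.φ A.q z ≤ τ} +
        ENNReal.ofReal (A.scoreScale (t + d) / (A.scoreScale t * τ)) *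
          (ENNReal.ofReal (A.σw ^ 2 * ∫ z, deriv A.φ (√A.q * z) ^ 2 ∂stdNormal) ^ d *
          (ENNReal.ofReal c + ENNReal.ofReal (c ^ m)⁻¹ * ((A.layer (A.depth - (t + d + 1))).card *
            ∫⁻ z, ENNReal.ofReal (normScore A.φ A.q z ^ (m + 1)) ∂stdNormalFour))) := by
  have hsm := measurable_score hφ.continuous.measurable (A := A)
  set K := A.scoreScale (t + d) with hK
  set K' := A.scoreScale t with hK'
  have hK0 : 0 < K := scoreScale_pos hσw hfit hgrad _
  have hK'0 : 0 < K' := scoreScale_pos hσw hfit hgrad _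
  set S := A.layer (A.depth - (t + d + 1)) with hS
  set χ := A.σw ^ 2 * ∫ z, deriv A.φ (√A.q * z) ^ 2 ∂stdNormal
  set V := ∫⁻ z, ENNReal.ofReal (normScore A.φ A.q z ^ (m + 1)) ∂stdNormalFour
  -- The ratio of the squared gradient norms above the lower and above the upper layer; it uses only
  -- coordinates of `upper (t + d)`.
  let f : (Coord → ℝ) → ℝ≥0∞ := fun ω =>
    ENNReal.ofReal (A.gradSq t ω)⁻¹ * ENNReal.ofReal (A.gradSq (t + d) ω)
  let u : ℕ × ℕ × ℤ → (Coord → ℝ) → ℝ := fun i ω =>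
    A.score ω (A.depth - (t + d + 1)) i ^ 2 / (K * A.gradSq (t + d) ω)
  have hu : ∀ i ω, 0 ≤ u i ω := fun i ω =>
    div_nonneg (sq_nonneg _) (mul_nonneg hK0.le (A.gradSq_nonneg _ _))
  have hum : ∀ i, Measurable (u i) := fun i => by fun_prop
  have hfm : Measurable f := by fun_prop
  let G : (Coord → ℝ) → ℝ≥0∞ := fun ω => ENNReal.ofReal (K / (K' * τ)) *
    (f ω * ENNReal.ofReal c + ENNReal.ofReal (c ^ m)⁻¹ *
      ∑ i ∈ S, f ω * ENNReal.ofReal (u i ω ^ (m + 1)))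
  have hGm : Measurable G := by fun_prop
  have hfint : ∫⁻ ω, f ω ∂A.law ≤ ENNReal.ofReal χ ^ d := by
    have h := lintegral_mul_gradSq_add hφ hq.le (t := t) d (by omega)
      (fun l _ h => hfit.2.2 l h.le) (w := fun ω => ENNReal.ofReal (A.gradSq t ω)⁻¹)
      (by fun_prop) (fun ω ω' h => by simp only [dependsOn_gradSq (A := A) (t := t) (by omega) h])
    refine h.le.trans ?_
    refine mul_le_of_le_one_right (zero_le) ?_
    calc _ ≤ ∫⁻ _, 1 ∂A.law := lintegral_mono fun ω => by
          rw [← ENNReal.ofReal_mul (inv_nonneg.2 (A.gradSq_nonneg _ _)), ENNReal.ofReal_le_one]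
          exact inv_mul_le_one
      _ = 1 := by simp
  have hGint : ∫⁻ ω, G ω ∂A.law ≤ ENNReal.ofReal (K / (K' * τ)) * (ENNReal.ofReal χ ^ d *
      (ENNReal.ofReal c + ENNReal.ofReal (c ^ m)⁻¹ * (S.card * V))) := by
    simp only [G]
    rw [lintegral_const_mul _ (by fun_prop), lintegral_add_left (by fun_prop),
      lintegral_mul_const _ hfm, lintegral_const_mul _ (by fun_prop),
      lintegral_finsetSum _ (by fun_prop)]
    have h : ∀ i ∈ S, ∫⁻ ω, f ω * ENNReal.ofReal (u i ω ^ (m + 1)) ∂A.law =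
        (∫⁻ ω, f ω ∂A.law) * V := fun i _ =>
      lintegral_mul_score_pow hφ hq hσw hlog hfit hgrad (t := t + d) ht i (m + 1) hfm
        (fun ω ω' h => by
          simp only [f, dependsOn_gradSq (A := A) (t := t + d) (by omega) h,
            dependsOn_gradSq (A := A) (t := t) (by omega)
              fun c hc => h c (A.upper_mono (by omega) hc)])
    rw [Finset.sum_congr rfl h, Finset.sum_const, nsmul_eq_mul]
    calc _ = ENNReal.ofReal (K / (K' * τ)) * ((∫⁻ ω, f ω ∂A.law) *
          (ENNReal.ofReal c + ENNReal.ofReal (c ^ m)⁻¹ * (S.card * V))) := by ring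
      _ ≤ _ := by gcongr
  have hae : ∀ᵐ ω ∂A.law, ω ∈ {ω | ∃ i ∈ S,
      A.score ω (A.depth - (t + 1)) w ≤ A.score ω (A.depth - (t + d + 1)) i} →
      ω ∈ {ω | A.score ω (A.depth - (t + 1)) w ^ 2 ≤ K' * A.gradSq t ω * τ} ∪ {ω | 1 ≤ G ω} := by
    filter_upwards [ae_gradSq_pos hq hσw hlog hfit hgrad (t := t) (by omega),
      ae_gradSq_pos hq hσw hlog hfit hgrad (t := t + d) (by omega)] with ω hg' hg
    rintro ⟨i, hi, hle⟩
    by_cases hB : A.score ω (A.depth - (t + 1)) w ^ 2 ≤ K' * A.gradSq t ω * τ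
    · exact Or.inl hB
    right
    push Not at hB
    have h1 : A.score ω (A.depth - (t + 1)) w ^ 2 ≤
        A.score ω (A.depth - (t + d + 1)) i ^ 2 :=
      pow_le_pow_left₀ (score_nonneg _ _ _) hle 2
    have h2 : A.score ω (A.depth - (t + d + 1)) i ^ 2 = K * A.gradSq (t + d) ω * u i ω := by
      simp only [u]
      rw [mul_div_cancel₀ _ (mul_pos hK0 hg).ne']
    have h3 : u i ω ≤ c + (c ^ m)⁻¹ * ∑ i ∈ S, u i ω ^ (m + 1) := by
      refine (le_add_inv_mul_pow (hu i ω) hc m).trans ?_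
      gcongr
      exact Finset.single_le_sum (f := fun i => u i ω ^ (m + 1))
        (fun i _ => pow_nonneg (hu i ω) _) hi
    have hsum : 0 ≤ ∑ i ∈ S, u i ω ^ (m + 1) := Finset.sum_nonneg fun i _ => pow_nonneg (hu i ω) _
    have hGr : G ω = ENNReal.ofReal (K / (K' * τ) * ((A.gradSq t ω)⁻¹ * A.gradSq (t + d) ω *
        (c + (c ^ m)⁻¹ * ∑ i ∈ S, u i ω ^ (m + 1)))) := by
      have hg1 : 0 ≤ (A.gradSq t ω)⁻¹ := by positivity
      simp only [G, f]
      rw [ENNReal.ofReal_mul (by positivity), ENNReal.ofReal_mul (by positivity),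
        ENNReal.ofReal_mul hg1, ENNReal.ofReal_add hc.le (by positivity),
        ENNReal.ofReal_mul (by positivity),
        ENNReal.ofReal_sum_of_nonneg fun i _ => pow_nonneg (hu i ω) _, ← Finset.mul_sum]
      ring
    change 1 ≤ G ω
    rw [hGr, ENNReal.one_le_ofReal]
    have h4 : K' * A.gradSq t ω * τ ≤ K * A.gradSq (t + d) ω *
        (c + (c ^ m)⁻¹ * ∑ i ∈ S, u i ω ^ (m + 1)) :=
      (hB.le.trans (h1.trans h2.le)).trans
        (mul_le_mul_of_nonneg_left h3 (mul_pos hK0 hg).le)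
    have h5 : K / (K' * τ) * ((A.gradSq t ω)⁻¹ * A.gradSq (t + d) ω *
        (c + (c ^ m)⁻¹ * ∑ i ∈ S, u i ω ^ (m + 1))) =
        (K * A.gradSq (t + d) ω * (c + (c ^ m)⁻¹ * ∑ i ∈ S, u i ω ^ (m + 1))) /
          (K' * A.gradSq t ω * τ) := by
      rw [div_mul_eq_mul_div, div_eq_div_iff (by positivity) (by positivity)]
      field_simp
    rw [h5, one_le_div (by positivity)]
    exact h4
  refine (measure_mono_ae hae).trans ((measure_union_le _ _).trans (add_le_add ?_ ?_))
  · rw [measure_score_sq_le hφ hq hσw hlog hfit hgrad (by omega)]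
  · refine le_trans ?_ hGint
    simpa using mul_meas_ge_le_lintegral hGm 1 (μ := A.law)

lemma card_layer (l : ℕ) :
    ((A.layer l).card : ℝ) = A.width l * A.width (l - 1) * (2 * A.k + 1) := by
  rw [layer, Finset.card_product, Finset.card_product, Finset.card_range, Finset.card_range]
  push_cast
  rw [card_ker]
  ring

lemma measurable_scr (hφ : PseudoLipschitz A.φ) : Measurable A.scr :=
  measurable_criticalSparsity _ _ _ fun l w => measurable_score hφ.continuous.measurable l w

lemma integrable_scr (hφ : PseudoLipschitz A.φ) : Integrable A.scr A.law :=
  Integrable.of_bound (measurable_scr hφ).aestronglyMeasurable 1 (ae_of_all _ fun ω => by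
    rw [Real.norm_of_nonneg (show 0 ≤ A.scr ω from criticalSparsity_nonneg _ _ _)]
    exact criticalSparsity_le_one _ _ _)

lemma integral_scr_le_one (hφ : PseudoLipschitz A.φ) : ∫ ω, A.scr ω ∂A.law ≤ 1 := by
  have := integral_mono (integrable_scr hφ) (integrable_const (1 : ℝ))
    fun ω => criticalSparsity_le_one A.depth A.layer (A.score ω)
  simpa using this

/-- The expectation of the deterministic counting bound, with the count written as a sum of
indicators. -/
lemma integral_scr_le (hφ : PseudoLipschitz A.φ) {l : ℕ} (hl : l ∈ Finset.Icc 1 A.depth)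
    (hpos : 0 < ∑ l' ∈ Finset.Icc 1 A.depth, (A.layer l').card) :
    ∫ ω, A.scr ω ∂A.law ≤ (∑ l' ∈ Finset.Icc 1 A.depth, ∑ w ∈ A.layer l',
      A.law.real {ω | ∃ i ∈ A.layer l, A.score ω l' w ≤ A.score ω l i}) /
        ((∑ l' ∈ Finset.Icc 1 A.depth, (A.layer l').card : ℕ) : ℝ) := by
  classical
  have hsm := measurable_score hφ.continuous.measurable (A := A)
  have hset : ∀ l' w, MeasurableSet {ω | ∃ i ∈ A.layer l, A.score ω l' w ≤ A.score ω l i} := by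
    intro l' w
    have : {ω | ∃ i ∈ A.layer l, A.score ω l' w ≤ A.score ω l i} =
        ⋃ i ∈ A.layer l, {ω | A.score ω l' w ≤ A.score ω l i} := by
      ext ω
      simp
    rw [this]
    exact Finset.measurableSet_biUnion _ fun i _ => measurableSet_le (hsm _ _) (hsm _ _)
  have hint : ∀ l' w, Integrable (Set.indicator
      {ω | ∃ i ∈ A.layer l, A.score ω l' w ≤ A.score ω l i} (1 : (Coord → ℝ) → ℝ)) A.law :=
    fun l' w => (integrable_const (1 : ℝ)).indicator (hset l' w)
  have hrhs : ∑ l' ∈ Finset.Icc 1 A.depth, ∑ w ∈ A.layer l',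
      A.law.real {ω | ∃ i ∈ A.layer l, A.score ω l' w ≤ A.score ω l i} =
      ∫ ω, ∑ l' ∈ Finset.Icc 1 A.depth, ∑ w ∈ A.layer l', Set.indicator
        {ω | ∃ i ∈ A.layer l, A.score ω l' w ≤ A.score ω l i} (1 : (Coord → ℝ) → ℝ) ω ∂A.law := by
    rw [integral_finsetSum _ fun l' _ => integrable_finsetSum _ fun w _ => hint l' w]
    refine Finset.sum_congr rfl fun l' _ => ?_
    rw [integral_finsetSum _ fun w _ => hint l' w]
    exact Finset.sum_congr rfl fun w _ => (integral_indicator_one (hset l' w)).symm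
  rw [hrhs, ← integral_div]
  refine integral_mono (integrable_scr hφ) ((integrable_finsetSum _ fun l' _ =>
    integrable_finsetSum _ fun w _ => hint l' w).div_const _) fun ω => ?_
  refine (criticalSparsity_le_div A.depth A.layer (A.score ω) hl hpos).trans (le_of_eq ?_)
  congr 1
  rw [Finset.card_filter, Finset.sum_sigma]
  push_cast
  refine Finset.sum_congr rfl fun l' _ => Finset.sum_congr rfl fun w _ => ?_
  simp only [Set.indicator, Set.mem_ofPred_eq, Pi.one_apply]

end Net

/-! ### The expected critical sparsity -/

namespace Net

variable {P : ℕ} [NeZero P] {A : Net P}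

/-- In the ordered phase a weight of a layer `l > 2` is unlikely to have a score below the largest
one of layer `2`. -/
lemma measureReal_exists_score_le (hφ : PseudoLipschitz A.φ) (hq : 0 < A.q) (hσw : 0 < A.σw)
    (hlog : LogIntegrable A.φ A.q) (hfit : A.Fits) (hgrad : A.batch.GradNonzero A.q) {κ : ℝ}
    (hκ : A.σw ^ 2 * ∫ z, deriv A.φ (√A.q * z) ^ 2 ∂stdNormal = Real.exp (-(8 * κ)))
    {N : ℕ} (hN : 1 ≤ N) {a b : ℝ} (ha : 0 < a) (hup : ∀ l ≤ A.depth, (A.width l : ℝ) ≤ b * N)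
    (hlow : ∀ l : ℕ, 1 ≤ l → l < A.depth → a * N ≤ (A.width l : ℝ)) {l : ℕ} (hl : 3 ≤ l)
    (hlL : l < A.depth) (w : ℕ × ℕ × ℤ) (m : ℕ) :
    A.law.real {ω | ∃ i ∈ A.layer 2, A.score ω l w ≤ A.score ω 2 i} ≤
      stdNormalFour.real {z | normScore A.φ A.q z ≤ Real.exp (-(4 * κ * (l - 2 : ℕ)))} +
        (1 + b ^ 2 / a ^ 2 * (1 + b ^ 2 * (2 * A.k + 1) *
          (∫⁻ z, ENNReal.ofReal (normScore A.φ A.q z ^ (m + 1)) ∂stdNormalFour).toReal)) *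
        (N : ℝ) ^ (2 / ((m + 1 : ℕ) : ℝ)) * Real.exp (-(4 * κ * (l - 2 : ℕ))) := by
  obtain ⟨d, rfl⟩ : ∃ d, l = d + 2 := ⟨l - 2, by omega⟩
  obtain ⟨t, ht⟩ : ∃ t, A.depth = t + d + 3 := ⟨A.depth - d - 3, by omega⟩
  have hNr : (1 : ℝ) ≤ N := by exact_mod_cast hN
  have hN0 : (0 : ℝ) < N := by linarith
  rw [Nat.add_sub_cancel]
  -- τ² = χ^d, so dividing by τ in Markov's inequality still leaves a factor τ.
  set τ := Real.exp (-(4 * κ * d)) with hτ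
  have hτ0 : 0 < τ := Real.exp_pos _
  -- With c^(m+1) = N², the moment sum over the O(N²) weights of layer 2 is of the same order as c.
  set c := (N : ℝ) ^ (2 / ((m + 1 : ℕ) : ℝ)) with hc
  have hc0 : 0 < c := Real.rpow_pos_of_pos hN0 _
  have hcm : c ^ (m + 1) = (N : ℝ) ^ 2 := by
    rw [hc, ← Real.rpow_natCast, ← Real.rpow_mul hN0.le, div_mul_cancel₀ _ (by positivity)]
    norm_num
  set V := ∫⁻ z, ENNReal.ofReal (normScore A.φ A.q z ^ (m + 1)) ∂stdNormalFour with hV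
  have hVtop : V ≠ ⊤ := lintegral_normScore_pow_ne_top hφ _
  have h := measure_exists_score_le hφ hq hσw hlog hfit hgrad (t := t) (d := d) (by omega) w m
    hτ0 hc0
  have e1 : A.depth - (t + 1) = d + 2 := by omega
  have e2 : A.depth - (t + d + 1) = 2 := by omega
  rw [e1, e2, hκ, ← hV] at h
  have hK : 0 < A.scoreScale (t + d) := scoreScale_pos hσw hfit hgrad _
  have hK' : 0 < A.scoreScale t := scoreScale_pos hσw hfit hgrad _
  have hreal := ENNReal.toReal_mono (by finiteness) h
  rw [ENNReal.toReal_add (by finiteness) (by finiteness), ENNReal.toReal_mul, ENNReal.toReal_mul,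
    ENNReal.toReal_pow, ENNReal.toReal_add (by finiteness) (by finiteness), ENNReal.toReal_mul,
    ENNReal.toReal_mul, ENNReal.toReal_natCast, ENNReal.toReal_ofReal (Real.exp_nonneg _),
    ENNReal.toReal_ofReal hc0.le, ENNReal.toReal_ofReal (by positivity),
    ENNReal.toReal_ofReal (by positivity)] at hreal
  refine hreal.trans (add_le_add le_rfl ?_)
  have w1 := hlow 1 le_rfl (by omega)
  have w2 := hlow 2 (by omega) (by omega)
  have u1 := hup 1 (by omega)
  have u2 := hup 2 (by omega)
  have v1 := hup (d + 1) (by omega)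
  have v2 := hup (d + 2) (by omega)
  have haN : 0 < a * N := by positivity
  have hbN : 0 < b * N := by linarith
  have hcard : ((A.layer 2).card : ℝ) ≤ b ^ 2 * N ^ 2 * (2 * A.k + 1) := by
    rw [card_layer]
    have : (A.width 2 : ℝ) * A.width (2 - 1) ≤ (b * N) * (b * N) :=
      mul_le_mul u2 u1 (Nat.cast_nonneg _) hbN.le
    rw [← mul_pow, sq]
    gcongr
  have hratio : A.scoreScale (t + d) / (A.scoreScale t * τ) ≤ b ^ 2 / a ^ 2 / τ := by
    rw [← div_div]
    refine div_le_div_of_nonneg_right ?_ hτ0.le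
    have hs : 0 < (A.batch.size : ℝ)⁻¹ ^ 2 * (A.σw ^ 2) ^ 2 / (2 * A.k + 1) := by
      have : (0 : ℝ) < A.batch.size := by exact_mod_cast batch_size_pos hgrad
      positivity
    simp only [scoreScale]
    rw [e1, e2, div_div_div_cancel_left' _ _ hs.ne']
    have h1 : (A.width (d + 2 - 1) : ℝ) * A.width (d + 2) ≤ (b * N) * (b * N) :=
      mul_le_mul v1 v2 (Nat.cast_nonneg _) hbN.le
    have h2 : (a * N) * (a * N) ≤ (A.width (2 - 1) : ℝ) * A.width 2 :=
      mul_le_mul w1 w2 haN.le (Nat.cast_nonneg _)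
    refine (div_le_div₀ (by positivity) h1 (by positivity) h2).trans (le_of_eq ?_)
    field_simp
  have hχd : Real.exp (-(8 * κ)) ^ d = τ * τ := by
    rw [hτ, ← Real.exp_nat_mul, ← Real.exp_add]
    congr 1
    ring
  have hmain : c + (c ^ m)⁻¹ * ((A.layer 2).card * V.toReal) ≤
      c * (1 + b ^ 2 * (2 * A.k + 1) * V.toReal) := by
    have hVr : 0 ≤ V.toReal := ENNReal.toReal_nonneg
    have h1 : (c ^ m)⁻¹ * ((A.layer 2).card * V.toReal) ≤
        (c ^ m)⁻¹ * (b ^ 2 * N ^ 2 * (2 * A.k + 1) * V.toReal) := by gcongr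
    have h2 : (c ^ m)⁻¹ * (b ^ 2 * N ^ 2 * (2 * A.k + 1) * V.toReal) =
        c * (b ^ 2 * (2 * A.k + 1) * V.toReal) := by
      rw [← hcm, pow_succ]
      field_simp
      ring
    linarith
  rw [hχd]
  have hX : 0 ≤ 1 + b ^ 2 * (2 * A.k + 1) * V.toReal := by positivity
  calc A.scoreScale (t + d) / (A.scoreScale t * τ) *
        (τ * τ * (c + (c ^ m)⁻¹ * ((A.layer 2).card * V.toReal)))
      ≤ b ^ 2 / a ^ 2 / τ * (τ * τ * (c * (1 + b ^ 2 * (2 * A.k + 1) * V.toReal))) := by gcongr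
    _ = b ^ 2 / a ^ 2 * (1 + b ^ 2 * (2 * A.k + 1) * V.toReal) * c * τ := by field_simp
    _ ≤ _ := by
      gcongr
      linarith

/-- Only layers 2 to `depth - 1` have a lower bound on both adjacent widths, and for depth at least
4 they are at least half of all layers. -/
lemma sum_card_layer_ge {N : ℕ} {a : ℝ} (ha : 0 < a) (hL : 4 ≤ A.depth)
    (hlow : ∀ l : ℕ, 1 ≤ l → l < A.depth → a * N ≤ (A.width l : ℝ)) :
    A.depth / 2 * (a ^ 2 * N ^ 2 * (2 * A.k + 1)) ≤
      ((∑ l ∈ Finset.Icc 1 A.depth, (A.layer l).card : ℕ) : ℝ) := by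
  push_cast
  have h1 : ∀ l ∈ Finset.Icc 2 (A.depth - 1), a ^ 2 * N ^ 2 * (2 * A.k + 1) ≤
      ((A.layer l).card : ℝ) := by
    intro l hl
    rw [Finset.mem_Icc] at hl
    rw [card_layer, ← mul_pow, sq]
    have : (a * N) * (a * N) ≤ (A.width l : ℝ) * A.width (l - 1) :=
      mul_le_mul (hlow l (by omega) (by omega)) (hlow (l - 1) (by omega) (by omega))
        (by positivity) (Nat.cast_nonneg _)
    gcongr
  have h2 := Finset.card_nsmul_le_sum _ _ _ h1
  rw [nsmul_eq_mul, Nat.card_Icc] at h2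
  have h3 : (A.depth : ℝ) / 2 ≤ ((A.depth - 1 + 1 - 2 : ℕ) : ℝ) := by
    rw [div_le_iff₀ (by norm_num)]
    exact_mod_cast (by omega : A.depth ≤ (A.depth - 1 + 1 - 2) * 2)
  refine (mul_le_mul_of_nonneg_right h3 (by positivity)).trans (h2.trans ?_)
  refine Finset.sum_le_sum_of_subset_of_nonneg (fun l hl => ?_) fun _ _ _ => Nat.cast_nonneg _
  rw [Finset.mem_Icc] at hl ⊢
  omega

/-- Every layer is compared with layer 2. The first layer, layer 2 itself and the output layer get
the trivial bound 1, hence the summand 3; the remaining layers sum to the two series bounds. The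
factor ρ = b² / a² compares the largest possible layer size with the lower bound for interior
layers. -/
lemma integral_scr_le_of_four_le (hφ : PseudoLipschitz A.φ) (hq : 0 < A.q) (hσw : 0 < A.σw)
    (hlog : LogIntegrable A.φ A.q) (hfit : A.Fits) (hgrad : A.batch.GradNonzero A.q) {κ : ℝ}
    (hκ0 : 0 < κ)
    (hκ : A.σw ^ 2 * ∫ z, deriv A.φ (√A.q * z) ^ 2 ∂stdNormal = Real.exp (-(8 * κ)))
    {N : ℕ} (hN : 1 ≤ N) {a b : ℝ} (ha : 0 < a) (hup : ∀ l ≤ A.depth, (A.width l : ℝ) ≤ b * N)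
    (hlow : ∀ l : ℕ, 1 ≤ l → l < A.depth → a * N ≤ (A.width l : ℝ)) (hL : 4 ≤ A.depth)
    (m : ℕ) :
    ∫ ω, A.scr ω ∂A.law ≤ 2 * (b ^ 2 / a ^ 2) / A.depth *
      (3 + (∫ z, |Real.log (normScore A.φ A.q z)| ∂stdNormalFour) / (4 * κ) +
        (Real.log (1 + b ^ 2 / a ^ 2 * (1 + b ^ 2 * (2 * A.k + 1) *
          (∫⁻ z, ENNReal.ofReal (normScore A.φ A.q z ^ (m + 1)) ∂stdNormalFour).toReal)) +
          2 / ((m + 1 : ℕ) : ℝ) * Real.log N) / (4 * κ) + 1 + (1 - Real.exp (-(4 * κ)))⁻¹) := by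
  set V := (∫⁻ z, ENNReal.ofReal (normScore A.φ A.q z ^ (m + 1)) ∂stdNormalFour).toReal with hV
  have hV0 : 0 ≤ V := ENNReal.toReal_nonneg
  set C := 1 + b ^ 2 / a ^ 2 * (1 + b ^ 2 * (2 * A.k + 1) * V) with hC
  have hC1 : 1 ≤ C := by
    have : 0 ≤ b ^ 2 / a ^ 2 * (1 + b ^ 2 * (2 * A.k + 1) * V) := by positivity
    linarith
  have hNr : (1 : ℝ) ≤ N := by exact_mod_cast hN
  have hN0 : (0 : ℝ) < N := by linarith
  set y := C * (N : ℝ) ^ (2 / ((m + 1 : ℕ) : ℝ)) with hy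
  have hr1 : 1 ≤ (N : ℝ) ^ (2 / ((m + 1 : ℕ) : ℝ)) := Real.one_le_rpow hNr (by positivity)
  have hy1 : 1 ≤ y := by nlinarith
  have hlogy : Real.log y = Real.log C + 2 / ((m + 1 : ℕ) : ℝ) * Real.log N := by
    rw [hy, Real.log_mul (by positivity) (by positivity), Real.log_rpow hN0]
  rw [← hlogy]
  let s : ℕ → ℝ := fun d =>
    stdNormalFour.real {z | normScore A.φ A.q z ≤ Real.exp (-(4 * κ * d))}
  -- The truncation at 1 is allowed because the left side is a probability; without it the prefactor
  -- would contribute a power of N instead of log N.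
  let h : ℕ → ℝ := fun d => s d + min 1 (y * Real.exp (-(4 * κ * d)))
  have hh0 : ∀ d, 0 ≤ h d := fun d => add_nonneg measureReal_nonneg (by positivity)
  have hκ4 : 0 < 4 * κ := by positivity
  have hbN : 0 < b * N := by
    have h1 : (1 : ℝ) ≤ A.width 0 := by exact_mod_cast hfit.2.2 0 (Nat.zero_le _)
    linarith [hup 0 (Nat.zero_le _)]
  have hp : ∀ l ∈ Finset.Icc 1 A.depth, ∀ w ∈ A.layer l,
      A.law.real {ω | ∃ i ∈ A.layer 2, A.score ω l w ≤ A.score ω 2 i} ≤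
        (if l = 1 then 1 else 0) + (if l = 2 then 1 else 0) + (if l = A.depth then 1 else 0) +
          (if 3 ≤ l then h (l - 2) else 0) := by
    intro l hl w _
    rw [Finset.mem_Icc] at hl
    have hle1 : A.law.real {ω | ∃ i ∈ A.layer 2, A.score ω l w ≤ A.score ω 2 i} ≤ 1 :=
      measureReal_le_one
    have hh := hh0 (l - 2)
    by_cases h3 : 3 ≤ l
    · rw [if_pos h3, if_neg (by omega), if_neg (by omega)]
      rcases hl.2.eq_or_lt with hd | hd
      · rw [if_pos hd]
        linarith
      · rw [if_neg (by omega)]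
        have h4 := measureReal_exists_score_le hφ hq hσw hlog hfit hgrad hκ hN ha hup hlow h3 hd
          w m
        have h5 : 0 ≤ s (l - 2) := measureReal_nonneg
        simp only [zero_add, h]
        rcases min_cases 1 (y * Real.exp (-(4 * κ * ((l - 2 : ℕ) : ℝ)))) with h6 | h6
        · rw [h6.1]
          linarith
        · rw [h6.1]
          exact h4
    · have : l = 1 ∨ l = 2 := by omega
      have h7 : (0 : ℝ) ≤ if l = A.depth then 1 else 0 := by split_ifs <;> norm_num
      rcases this with rfl | rfl
      · rw [if_pos rfl, if_neg (by norm_num), if_neg h3]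
        linarith
      · rw [if_neg (by norm_num), if_pos rfl, if_neg h3]
        linarith
  have hcard : ∀ l ∈ Finset.Icc 1 A.depth,
      ((A.layer l).card : ℝ) ≤ b ^ 2 * N ^ 2 * (2 * A.k + 1) := by
    intro l hl
    rw [Finset.mem_Icc] at hl
    rw [card_layer, ← mul_pow, sq]
    have : (A.width l : ℝ) * A.width (l - 1) ≤ (b * N) * (b * N) :=
      mul_le_mul (hup l hl.2) (hup (l - 1) (by omega)) (Nat.cast_nonneg _) hbN.le
    gcongr
  have hsumh : ∑ d ∈ Finset.Icc 1 (A.depth - 2), h d ≤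
      (∫ z, |Real.log (normScore A.φ A.q z)| ∂stdNormalFour) / (4 * κ) +
        (Real.log y / (4 * κ) + 1 + (1 - Real.exp (-(4 * κ)))⁻¹) := by
    simp only [h, s]
    rw [Finset.sum_add_distrib]
    exact add_le_add (sum_measureReal_normScore_le hφ hlog hκ4 _) (sum_min_one_exp_le hκ4 hy1 _)
  have hshift : ∑ l ∈ Finset.Icc 1 A.depth, (if 3 ≤ l then h (l - 2) else 0) =
      ∑ d ∈ Finset.Icc 1 (A.depth - 2), h d := by
    rw [← Finset.sum_filter]
    refine Finset.sum_nbij' (fun l => l - 2) (fun d => d + 2) ?_ ?_ ?_ ?_ fun _ _ => rfl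
    · intro l hl
      simp only [Finset.mem_filter, Finset.mem_Icc] at hl ⊢
      omega
    · intro d hd
      simp only [Finset.mem_filter, Finset.mem_Icc] at hd ⊢
      omega
    · intro l hl
      simp only [Finset.mem_filter, Finset.mem_Icc] at hl
      omega
    · intro d _
      omega
  have hind : ∀ l₀ ∈ Finset.Icc 1 A.depth,
      ∑ l ∈ Finset.Icc 1 A.depth, (if l = l₀ then (1 : ℝ) else 0) = 1 := fun l₀ hl₀ => by
    rw [Finset.sum_ite_eq', if_pos hl₀]
  have hnum : ∑ l ∈ Finset.Icc 1 A.depth, ∑ w ∈ A.layer l,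
      A.law.real {ω | ∃ i ∈ A.layer 2, A.score ω l w ≤ A.score ω 2 i} ≤
      b ^ 2 * N ^ 2 * (2 * A.k + 1) * (3 + ∑ d ∈ Finset.Icc 1 (A.depth - 2), h d) := by
    calc _ ≤ ∑ l ∈ Finset.Icc 1 A.depth, b ^ 2 * N ^ 2 * (2 * A.k + 1) *
          ((if l = 1 then 1 else 0) + (if l = 2 then 1 else 0) +
            (if l = A.depth then 1 else 0) + (if 3 ≤ l then h (l - 2) else 0)) := by
          refine Finset.sum_le_sum fun l hl => ?_
          refine (Finset.sum_le_card_nsmul _ _ _ (hp l hl)).trans ?_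
          rw [nsmul_eq_mul]
          refine mul_le_mul_of_nonneg_right (hcard l hl) ?_
          have := hh0 (l - 2)
          split_ifs <;> linarith
      _ = _ := by
          rw [← Finset.mul_sum, Finset.sum_add_distrib, Finset.sum_add_distrib,
            Finset.sum_add_distrib, hshift, hind 1 (by simp; omega), hind 2 (by simp; omega),
            hind A.depth (by simp; omega)]
          norm_num
  have hden := sum_card_layer_ge (N := N) ha hL hlow
  have hLr : (0 : ℝ) < A.depth := by exact_mod_cast (by omega : 0 < A.depth)
  have hdenpos : 0 < (A.depth : ℝ) / 2 * (a ^ 2 * N ^ 2 * (2 * A.k + 1)) := by positivity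
  have hscr := integral_scr_le hφ (l := 2) (Finset.mem_Icc.2 ⟨by omega, by omega⟩)
    (by exact_mod_cast hdenpos.trans_le hden)
  have hnum0 : 0 ≤ 3 + ∑ d ∈ Finset.Icc 1 (A.depth - 2), h d :=
    add_nonneg (by norm_num) (Finset.sum_nonneg fun d _ => hh0 d)
  refine hscr.trans ((div_le_div₀ (by positivity) hnum hdenpos hden).trans ?_)
  have hk : (0 : ℝ) < 2 * A.k + 1 := by positivity
  have heq : b ^ 2 * N ^ 2 * (2 * A.k + 1) * (3 + ∑ d ∈ Finset.Icc 1 (A.depth - 2), h d) /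
      ((A.depth : ℝ) / 2 * (a ^ 2 * N ^ 2 * (2 * A.k + 1))) =
      2 * (b ^ 2 / a ^ 2) / A.depth * (3 + ∑ d ∈ Finset.Icc 1 (A.depth - 2), h d) := by
    field_simp
  rw [heq]
  refine mul_le_mul_of_nonneg_left ?_ (by positivity)
  linarith

end Net

/-- Absorbing the region of bounded `L N²` into the constant. -/
lemma exists_const_absorb {κ : ℝ} (hκ : 0 < κ) (B : ℝ) :
    ∃ C : ℝ, ∀ (L N : ℕ) (E : ℝ), 1 ≤ L → 1 ≤ N →
      E ≤ 1 / L * (B + Real.log (L * (N : ℝ) ^ 2) / (4 * κ)) →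
      E ≤ 1 / L * (1 + Real.log (κ * L * (N : ℝ) ^ 2) / κ) +
        C / (κ ^ 2 * √(L * (N : ℝ) ^ 2)) := by
  -- With z = L N², the given bracket exceeds 1 + log(κ z) / κ by D - (3/4) log z / κ. This is
  -- positive only if log z < (4/3) κ D, and then √z is at most the exponential in the witness.
  set D := B - 1 - Real.log κ / κ with hD
  refine ⟨κ ^ 2 * |D| * Real.exp (4 / 3 * κ * |D| / 2), fun L N E hL hN hE => ?_⟩
  have hLr : (1 : ℝ) ≤ L := by exact_mod_cast hL
  have hNr : (1 : ℝ) ≤ N := by exact_mod_cast hN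
  set z := (L : ℝ) * (N : ℝ) ^ 2 with hz
  have hz1 : 1 ≤ z := by nlinarith
  set x := Real.log z with hx
  have hx0 : 0 ≤ x := Real.log_nonneg hz1
  have hlog : Real.log (κ * L * (N : ℝ) ^ 2) = Real.log κ + x := by
    rw [mul_assoc, ← hz, Real.log_mul hκ.ne' (by positivity)]
  rw [hlog]
  refine hE.trans ?_
  have hdiff : 1 / (L : ℝ) * (B + x / (4 * κ)) =
      1 / L * (1 + (Real.log κ + x) / κ) + 1 / L * (D - 3 / 4 * (x / κ)) := by
    rw [hD]
    field_simp
    ring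
  rw [hdiff]
  refine add_le_add le_rfl ?_
  have hC0 : 0 ≤ κ ^ 2 * |D| * Real.exp (4 / 3 * κ * |D| / 2) / (κ ^ 2 * √z) := by positivity
  rcases le_or_gt D (3 / 4 * (x / κ)) with h | h
  · refine le_trans ?_ hC0
    exact mul_nonpos_of_nonneg_of_nonpos (by positivity) (by linarith)
  · have hxD : x ≤ 4 / 3 * κ * |D| := by
      have h1 : 3 / 4 * (x / κ) ≤ |D| := h.le.trans (le_abs_self D)
      have h2 : x / κ ≤ 4 / 3 * |D| := by linarith
      rw [div_le_iff₀ hκ] at h2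
      linarith
    have hsq : √z ≤ Real.exp (4 / 3 * κ * |D| / 2) := by
      rw [← Real.exp_log (by positivity : 0 < √z), Real.log_sqrt (by positivity), ← hx]
      exact Real.exp_le_exp.2 (by linarith)
    have hsq0 : 0 < √z := Real.sqrt_pos.2 (by positivity)
    have h3 : 1 / (L : ℝ) * (D - 3 / 4 * (x / κ)) ≤ |D| := by
      have h4 : D - 3 / 4 * (x / κ) ≤ |D| := by
        have : 0 ≤ 3 / 4 * (x / κ) := by positivity
        linarith [le_abs_self D]
      have h5 : 1 / (L : ℝ) ≤ 1 := by
        rw [div_le_one (by positivity)]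
        exact hLr
      calc _ ≤ 1 / (L : ℝ) * |D| := by gcongr
        _ ≤ 1 * |D| := by gcongr
        _ = |D| := one_mul _
    refine h3.trans ?_
    rw [mul_assoc, mul_div_mul_left _ _ (by positivity), le_div_iff₀ hsq0]
    gcongr

lemma exists_bound_integral_scr {φ : ℝ → ℝ} (hφ : PseudoLipschitz φ) {σb σw q : ℝ}
    (hσw : 0 < σw) (hq : 0 < q) (k : ℕ) (hchi : chi φ σb σw q < 1) (hlog : LogIntegrable φ q)
    {a : ℝ} (b : ℝ) (ha : 0 < a) :
    ∃ C : ℝ, ∀ (N L : ℕ) (P : ℕ) [NeZero P] (T : Batch P) (width : ℕ → ℕ),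
      1 ≤ N → 1 ≤ L → T.GradNonzero q → (Net.mk φ σw q k L width T).Fits →
      (∀ l ≤ L, (width l : ℝ) ≤ b * N) →
      (∀ l : ℕ, 1 ≤ l → l < L → a * N ≤ (width l : ℝ)) →
      (∫ ω, (Net.mk φ σw q k L width T).scr ω ∂(Net.mk φ σw q k L width T).law) ≤
        1 / L * (1 + Real.log (kappa φ σb σw q * L * N ^ 2) / kappa φ σb σw q) +
          C / (kappa φ σb σw q ^ 2 * √(L * N ^ 2)) := by
  -- φ' is almost surely nonzero along √q Z, so its second moment is positive; without this log χ
  -- would not make sense.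
  have hchi0 : 0 < chi φ σb σw q := by
    rw [chi_eq hφ σb σw hq]
    refine mul_pos (by positivity) ?_
    have hm := measurable_deriv φ
    have hint : Integrable (fun z => deriv φ (√q * z) ^ 2) stdNormal :=
      ((hφ.polyGrowth_deriv.comp_mul (√q)).pow 2).integrable (by fun_prop)
    refine lt_of_le_of_ne (integral_nonneg fun z => sq_nonneg _) fun h0 => ?_
    rw [eq_comm, integral_eq_zero_iff_of_nonneg (fun z => sq_nonneg _) hint] at h0
    obtain ⟨z, hz, hz'⟩ := (h0.and hlog.1).exists
    exact hz'.2 (by simpa using hz)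
  set κ := kappa φ σb σw q with hκ
  have hlogchi : Real.log (chi φ σb σw q) < 0 := Real.log_neg hchi0 hchi
  have h8 : 8 * κ = -Real.log (chi φ σb σw q) := by
    rw [hκ, kappa, abs_of_neg hlogchi]
    ring
  have hκ0 : 0 < κ := by linarith
  have hexp : σw ^ 2 * ∫ z, deriv φ (√q * z) ^ 2 ∂stdNormal = Real.exp (-(8 * κ)) := by
    rw [h8, neg_neg, Real.exp_log hchi0, chi_eq hφ σb σw hq]
  set ρ := b ^ 2 / a ^ 2 with hρ
  have hρ0 : 0 ≤ ρ := by positivity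
  -- Chosen so that 2ρ / (m + 1) ≤ 1: the coefficient of 2 log N ≤ log(L N²) is then at most 1 /
  -- (4κ).
  let m := ⌈2 * ρ⌉₊
  have hm : 2 * ρ ≤ ((m + 1 : ℕ) : ℝ) := by
    have := Nat.le_ceil (2 * ρ)
    push_cast
    linarith
  have hm0 : (0 : ℝ) < ((m + 1 : ℕ) : ℝ) := by positivity
  set V := (∫⁻ z, ENNReal.ofReal (normScore φ q z ^ (m + 1)) ∂stdNormalFour).toReal with hV
  set J := ∫ z, |Real.log (normScore φ q z)| ∂stdNormalFour with hJ
  have hJ0 : 0 ≤ J := integral_nonneg fun z => abs_nonneg _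
  set Λ := Real.log (1 + ρ * (1 + b ^ 2 * (2 * k + 1) * V)) with hΛ
  have hV0 : 0 ≤ V := ENNReal.toReal_nonneg
  have hΛ0 : 0 ≤ Λ := Real.log_nonneg (by
    have : 0 ≤ ρ * (1 + b ^ 2 * (2 * k + 1) * V) := by positivity
    linarith)
  set D := 3 + J / (4 * κ) + Λ / (4 * κ) + 1 + (1 - Real.exp (-(4 * κ)))⁻¹ with hD
  have hD0 : 0 ≤ D := by
    have : 0 ≤ 1 - Real.exp (-(4 * κ)) := by
      have := Real.exp_le_one_iff.2 (by linarith : -(4 * κ) ≤ 0)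
      linarith
    positivity
  -- The 3 covers depths below 4, where s_cr ≤ 1 ≤ 3 / L is all that is used.
  obtain ⟨C, hC⟩ := exists_const_absorb hκ0 (3 + 2 * ρ * D)
  refine ⟨C, fun N L P _ T width hN hL hgrad hfit hup hlow => hC L N _ hL hN ?_⟩
  have hLr : (1 : ℝ) ≤ L := by exact_mod_cast hL
  have hNr : (1 : ℝ) ≤ N := by exact_mod_cast hN
  have hlogN : 0 ≤ Real.log N := Real.log_nonneg hNr
  have hlogLN : 2 * Real.log N ≤ Real.log (L * (N : ℝ) ^ 2) := by
    rw [Real.log_mul (by positivity) (by positivity), Real.log_pow]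
    have := Real.log_nonneg hLr
    push_cast
    linarith
  rcases lt_or_ge L 4 with h4 | h4
  · refine (Net.integral_scr_le_one (A := Net.mk φ σw q k L width T) hφ).trans ?_
    have hL3 : (L : ℝ) ≤ 3 := by exact_mod_cast (by omega : L ≤ 3)
    rw [one_div, ← div_eq_inv_mul, le_div_iff₀ (by positivity), one_mul]
    have h1 : 0 ≤ Real.log (L * (N : ℝ) ^ 2) / (4 * κ) := div_nonneg (by linarith) (by linarith)
    have h2 : 0 ≤ 2 * ρ * D := by positivity
    linarith
  · have h := Net.integral_scr_le_of_four_le (A := Net.mk φ σw q k L width T) hφ hq hσw hlog hfit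
      hgrad hκ0 hexp hN ha hup hlow h4 m
    change _ ≤ 2 * ρ / (L : ℝ) * (3 + J / (4 * κ) +
      (Λ + 2 / ((m + 1 : ℕ) : ℝ) * Real.log N) / (4 * κ) + 1 +
        (1 - Real.exp (-(4 * κ)))⁻¹) at h
    refine h.trans ?_
    have e : 2 * ρ / (L : ℝ) * (3 + J / (4 * κ) +
        (Λ + 2 / ((m + 1 : ℕ) : ℝ) * Real.log N) / (4 * κ) + 1 +
          (1 - Real.exp (-(4 * κ)))⁻¹) =
        1 / L * (2 * ρ * D + 2 * ρ / ((m + 1 : ℕ) : ℝ) * (2 * Real.log N) / (4 * κ)) := by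
      rw [hD]
      field_simp
      ring
    rw [e]
    refine mul_le_mul_of_nonneg_left ?_ (by positivity)
    have h5 : 2 * ρ / ((m + 1 : ℕ) : ℝ) ≤ 1 := by rwa [div_le_one hm0]
    have h6 : 2 * ρ / ((m + 1 : ℕ) : ℝ) * (2 * Real.log N) ≤ Real.log (L * (N : ℝ) ^ 2) :=
      (mul_le_of_le_one_left (by linarith) h5).trans hlogLN
    have h7 : 2 * ρ / ((m + 1 : ℕ) : ℝ) * (2 * Real.log N) / (4 * κ) ≤
        Real.log (L * (N : ℝ) ^ 2) / (4 * κ) := by gcongr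
    linarith

end SBP

end

theorem theorem1 (φ : ℝ → ℝ) (hφ : SBP.PseudoLipschitz φ) (σb σw q : ℝ)
    (hσb : 0 ≤ σb) (hσw : 0 < σw) (hq : 0 < q) (hfix : SBP.varianceMap φ σb σw q = q) (k : ℕ) :
    -- conditioning, for networks of all depths on the same data, of bounded widths
    (∀ (P : ℕ) [NeZero P] (T : SBP.Batch P), T.Regular q → T.FirstNonzero q k →
      ∀ (width : ℕ → ℕ → ℕ) (Nmax : ℕ),
        (∀ L : ℕ, 1 ≤ L →
          (SBP.Net.mk φ σw q k L (width L) T).Fits ∧ ∀ l ≤ L, width L l ≤ Nmax) →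
        (SBP.chi φ σb σw q < 1 →
          SBP.IllConditioned fun L l =>
            (SBP.Net.mk φ σw q k L (width L) T).secondMoment l) ∧
        (SBP.chi φ σb σw q = 1 →
          SBP.kappa φ σb σw q = 0 ∧
          SBP.WellConditioned fun L l =>
            (SBP.Net.mk φ σw q k L (width L) T).secondMoment l)) ∧
    -- the critical sparsity in the ordered phase
    (SBP.chi φ σb σw q < 1 → SBP.LogIntegrable φ q →
      ∀ a b : ℝ, 0 < a → ∃ C : ℝ,
        ∀ (N L : ℕ) (P : ℕ) [NeZero P] (T : SBP.Batch P) (width : ℕ → ℕ),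
          1 ≤ N → 1 ≤ L → T.Regular q → T.GradNonzero q →
          (SBP.Net.mk φ σw q k L width T).Fits →
          (∀ l ≤ L, (width l : ℝ) ≤ b * N) →
          (∀ l : ℕ, 1 ≤ l → l < L → a * N ≤ (width l : ℝ)) →
          MeasureTheory.Integrable (SBP.Net.mk φ σw q k L width T).scr
              (SBP.Net.mk φ σw q k L width T).law ∧
          (∫ ω, (SBP.Net.mk φ σw q k L width T).scr ω
              ∂(SBP.Net.mk φ σw q k L width T).law) ≤
            1 / L * (1 + Real.log (SBP.kappa φ σb σw q * L * N ^ 2) / SBP.kappa φ σb σw q) +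
              C / (SBP.kappa φ σb σw q ^ 2 * √(L * N ^ 2))) := by
  refine ⟨fun P _ T hT hfirst width Nmax hnet => ⟨fun hchi => ?_, fun hchi => ⟨?_, ?_⟩⟩,
    fun hchi hlog a b ha => ?_⟩
  · exact SBP.illConditioned_of_chi_lt_one hφ hσw hq hT hfirst hnet hchi
  · simp [SBP.kappa, hchi]
  · exact SBP.wellConditioned_of_chi_eq_one hφ hσw hq hT hfirst hnet hchi
  · obtain ⟨C, hC⟩ := SBP.exists_bound_integral_scr hφ hσw hq k hchi hlog b ha
    exact ⟨C, fun N L P _ T width hN hL _ hgrad hfit hup hlow =>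
      ⟨SBP.Net.integrable_scr hφ, hC N L P T width hN hL hgrad hfit hup hlow⟩⟩
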